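/- Let $f:\mathbb{R}^d\times\mathbb{R}^k\to\mathbb{R}^d$ and $g,y:\mathbb{R}^d\to\mathbb{R}$ be $C^2$ and let $\mu$ be a probability measure on $\mathbb{R}^d$. Let $\mathcal{P}^2$ be the set of probability measures on $\mathbb{R}^k$ with finite second moment, with the Wasserstein distance $W_2$. Assume: 1. there is a constant $C_1$ with $|\partial_x^i\partial_\theta^j f(x,\theta)|\le C_1|\theta|^i(|x|+1)^j$ (Frobenius norm) for all $x,\theta$ and all $i,j\ge 0$ with $0<i+j\le 2$; 2. for every $R>0$ the functions $x\mapsto\int f(x,\theta)\,\mathrm{d}\rho(\theta)$, $\rho\in\mathcal{P}^2$, are dense in $\mathcal{C}(\{|x|\le R\};\mathbb{R}^d)$ for the supremum norm; 3. $g$ and $\nabla g$ are Lipschitz and $\inf_x|\nabla g(x)|>0$; 4. $\mu$ has an $L^\infty$ density with respect to Lebesgue measure, and $\mu(\{|x|\ge R\})=0$ for some $R>0$; 5. $y$ is bounded on every ball. Let $\mathcal{C}([0,1];\mathcal{P}^2)$ be the set of $W_2$-continuous paths $t\mapsto\rho(\cdot,t)\in\mathcal{P}^2$, with the metric $d_1(\rho_1,\rho_2)=\sup_{t\in[0,1]}W_2(\rho_1(\cdot,t),\rho_2(\cdot,t))$,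 and let $\mathcal{C}([0,\infty);\mathcal{C}([0,1];\mathcal{P}^2))$ be the set of $d_1$-continuous paths $s\mapsto\rho(\cdot,\cdot,s)$ in it. For $\rho\in\mathcal{C}([0,1];\mathcal{P}^2)$ let $Z_\rho(\cdot;x)$ solve $$\frac{\mathrm{d}z}{\mathrm{d}t}=\int_{\mathbb{R}^k}f(z(t),\theta)\,\mathrm{d}\rho(\theta,t),\quad t\in[0,1],\qquad z(0)=x,$$ put $E(\rho)=\mathbb{E}_{x\sim\mu}\big[\tfrac12(g(Z_\rho(1;x))-y(x))^2\big]$, and let $p_\rho(\cdot;x)$ solve $$\frac{\mathrm{d}p_\rho^\top}{\mathrm{d}t}=-p_\rho^\top\int_{\mathbb{R}^k}\partial_zf(Z_\rho(t;x),\theta)\,\mathrm{d}\rho(\theta,t),\qquad p_\rho(1;x)=\big(g(Z_\rho(1;x))-y(x)\big)\nabla g(Z_\rho(1;x)).$$ For $s\ge0$ set $$\frac{\delta E_s(\rho)}{\delta\rho}(\theta,t)=\mathbb{E}_{x\sim\mu}\big[p_\rho(t;x)^\top f(Z_\rho(t;x),\theta)\big]+e^{-s}|\theta|^2 .$$ Let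 $\rho_{\mathrm{ini}}(\theta,t)$ be admissible: there is a stochastic process $(\theta(t))_{t\in[0,1]}$ in $\mathbb{R}^k$ with continuous paths, with $\theta(t_0)\sim\rho_{\mathrm{ini}}(\cdot,t_0)$ and $\lim_{t\to t_0}\mathbb{E}|\theta(t)-\theta(t_0)|^2=0$ for all $t_0\in[0,1]$. Consider pairs $(\rho,\rho_\infty)$ such that - $\rho\in\mathcal{C}([0,\infty);\mathcal{C}([0,1];\mathcal{P}^2))$ is a weak solution of $$\frac{\partial\rho(\theta,t,s)}{\partial s}=\nabla_\theta\cdot\Big(\rho(\theta,t,s)\,\nabla_\theta\frac{\delta E_s(\rho(s))}{\delta\rho}(\theta,t)\Big),\quad s>0,\ t\in[0,1],\qquad \rho(\theta,t,0)=\rho_{\mathrm{ini}}(\theta,t),$$ that is, $\frac{\mathrm{d}}{\mathrm{d}s}\int h\,\mathrm{d}\rho(\theta,t,s)=-\int\nabla h\cdot\nabla_\theta\frac{\delta E_s(\rho(s))}{\delta\rho}\,\mathrm{d}\rho(\theta,t,s)$ for all $h\in C_c^\infty(\mathbb{R}^k)$, $s>0$, $t\in[0,1]$; - $\rho_\infty\in\mathcal{C}([0,1];\mathcal{P}^2)$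 and $d_1(\rho(\cdot,\cdot,s),\rho_\infty)\to0$ as $s\to\infty$; - for some $t_0\in[0,1]$ the support of $\rho_\infty(\cdot,t_0)$ is all of $\mathbb{R}^k$. Then $E(\rho_\infty)=0$ for every such pair, so that $\rho_\infty$ is a global minimizer of $E$ over $\mathcal{C}([0,1];\mathcal{P}^2)$. More specifically, for every $\epsilon>0$ there is a constant $C_0>0$, depending (for given $f,g,y,\mu$) only on $\rho_{\mathrm{ini}}$ and $\epsilon$, such that for every such pair $$E(\rho(s))\le\epsilon\qquad\text{for all } s>C_0 .$$ -/

import Mathlib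

open MeasureTheory ProbabilityTheory Filter Topology Set
open scoped ENNReal NNReal

namespace MeanFieldResNet

noncomputable section

/-- Euclidean space `ℝⁿ`. -/
abbrev Euc (n : ℕ) := EuclideanSpace ℝ (Fin n)

/-- The standard basis of `ℝⁿ`. -/
def stdVec {n : ℕ} (i : Fin n) : Euc n := EuclideanSpace.single i (1 : ℝ)

/-- Frobenius norm of a linear map (square root of the sum of the squared matrix entries). -/
def frob {m d : ℕ} (A : Euc m →L[ℝ] Euc d) : ℝ :=
  √(∑ i, ‖A (stdVec i)‖ ^ 2)

/-- Frobenius norm of a bilinear map (square root of the sum of all squared components). -/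
def frob₂ {m n d : ℕ} (B : Euc m →L[ℝ] Euc n →L[ℝ] Euc d) : ℝ :=
  √(∑ i, ∑ j, ‖B (stdVec i) (stdVec j)‖ ^ 2)

/-! ### Probability measures with finite second moment, and paths of them -/

/-- `ρ ∈ 𝒫²(ℝᵏ)`: a probability measure with finite second moment. -/
def MemP2 {k : ℕ} (ρ : Measure (Euc k)) : Prop :=
  IsProbabilityMeasure ρ ∧ ∫⁻ θ, ‖θ‖ₑ ^ 2 ∂ρ < ∞

/-- The Wasserstein-2 distance: the infimum of `(∫ |θ₁ - θ₂|² dπ)^{1/2}` over all couplings `π`. -/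
def W2 {k : ℕ} (ρ₁ ρ₂ : Measure (Euc k)) : ℝ≥0∞ :=
  ⨅ (π : Measure (Euc k × Euc k)) (_ : π.fst = ρ₁ ∧ π.snd = ρ₂),
    (∫⁻ z, ‖z.1 - z.2‖ₑ ^ 2 ∂π) ^ (1 / 2 : ℝ)

/-- `ρ ∈ 𝒞([0,1]; 𝒫²)`; the measure `ρ(·,t)` is written `ρ t`, and only `t ∈ [0,1]` matters. -/
def IsPath {k : ℕ} (ρ : ℝ → Measure (Euc k)) : Prop :=
  (∀ t ∈ Icc (0 : ℝ) 1, MemP2 (ρ t)) ∧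
  ∀ t₀ ∈ Icc (0 : ℝ) 1, Tendsto (fun t => W2 (ρ t) (ρ t₀)) (𝓝[Icc 0 1] t₀) (𝓝 0)

/-- The metric `d₁(ρ₁,ρ₂) = sup_{t ∈ [0,1]} W₂(ρ₁(·,t), ρ₂(·,t))` of `𝒞([0,1]; 𝒫²)`. -/
def d1 {k : ℕ} (ρ₁ ρ₂ : ℝ → Measure (Euc k)) : ℝ≥0∞ :=
  ⨆ t ∈ Icc (0 : ℝ) 1, W2 (ρ₁ t) (ρ₂ t)

/-- `ρ ∈ 𝒞([0,∞); 𝒞([0,1]; 𝒫²))`; the measure `ρ(·,t,s)` is written `ρ s t`, and only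
`s ≥ 0` and `t ∈ [0,1]` matter. -/
def IsFlowPath {k : ℕ} (ρ : ℝ → ℝ → Measure (Euc k)) : Prop :=
  (∀ s ∈ Ici (0 : ℝ), IsPath (ρ s)) ∧
  ∀ s₀ ∈ Ici (0 : ℝ), Tendsto (fun s => d1 (ρ s) (ρ s₀)) (𝓝[Ici 0] s₀) (𝓝 0)

/-- `ρ(θ,t)` is admissible: there is a stochastic process with continuous paths on `[0,1]`, continuous
in mean square, whose law at each time `t` is `ρ(·,t)`. -/
def Admissible {k : ℕ} (ρ : ℝ → Measure (Euc k)) : Prop :=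
  ∃ (Ω : Type) (_ : MeasurableSpace Ω) (P : Measure Ω) (X : ℝ → Ω → Euc k),
    IsProbabilityMeasure P ∧
    (∀ t ∈ Icc (0 : ℝ) 1, HasLaw (X t) (ρ t) P) ∧
    (∀ᵐ ω ∂P, ContinuousOn (fun t => X t ω) (Icc 0 1)) ∧
    ∀ t₀ ∈ Icc (0 : ℝ) 1,
      Tendsto (fun t => ∫⁻ ω, ‖X t ω - X t₀ ω‖ₑ ^ 2 ∂P) (𝓝[Icc 0 1] t₀) (𝓝 0)

/-! ### Standing assumptions on activation, measuring function, labels and data distribution -/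

/-- The standing assumptions on the activation function `f(x,θ)`, the measuring function `g`,
the label function `y` and the input distribution `μ`. -/
structure StandingAssumption {d k : ℕ} (f : Euc d → Euc k → Euc d) (g y : Euc d → ℝ)
    (μ : Measure (Euc d)) : Prop where
  contDiff_f : ContDiff ℝ 2 (Function.uncurry f)
  contDiff_g : ContDiff ℝ 2 g
  contDiff_y : ContDiff ℝ 2 y
  /-- `|∂ₓⁱ ∂_θʲ f| ≤ C₁ |θ|ⁱ (|x|+1)ʲ` for `0 < i + j ≤ 2`; the five cases `(i,j)` are
  `(1,0)`, `(0,1)`, `(2,0)`, `(1,1)`, `(0,2)` in this order. -/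
  deriv_bound : ∃ C₁ : ℝ, ∀ (x : Euc d) (θ : Euc k),
    frob (fderiv ℝ (fun x' => f x' θ) x) ≤ C₁ * ‖θ‖ ∧
    frob (fderiv ℝ (fun θ' => f x θ') θ) ≤ C₁ * (‖x‖ + 1) ∧
    frob₂ (fderiv ℝ (fun x' => fderiv ℝ (fun x'' => f x'' θ) x') x) ≤ C₁ * ‖θ‖ ^ 2 ∧
    frob₂ (fderiv ℝ (fun x' => fderiv ℝ (fun θ' => f x' θ') θ) x) ≤ C₁ * ‖θ‖ * (‖x‖ + 1) ∧
    frob₂ (fderiv ℝ (fun θ' => fderiv ℝ (fun θ'' => f x θ'') θ') θ) ≤ C₁ * (‖x‖ + 1) ^ 2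
  /-- The functions `x ↦ ∫ f(x,θ) dρ(θ)`, `ρ ∈ 𝒫²`, are dense, in the supremum norm, in the
  continuous functions on every ball. -/
  dense_range : ∀ R : ℝ, 0 < R →
    Dense {h : C(Metric.closedBall (0 : Euc d) R, Euc d) |
      ∃ ρ : Measure (Euc k), MemP2 ρ ∧ ∀ x, h x = ∫ θ, f x θ ∂ρ}
  lipschitz_g : ∃ K : ℝ≥0, LipschitzWith K g
  lipschitz_grad_g : ∃ K : ℝ≥0, LipschitzWith K (gradient g)
  grad_g_lower : ∃ δ : ℝ, 0 < δ ∧ ∀ x, δ ≤ ‖gradient g x‖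
  prob_μ : IsProbabilityMeasure μ
  /-- `μ` has an essentially bounded density with respect to Lebesgue measure. -/
  density_μ : ∃ q : Euc d → ℝ≥0∞, Measurable q ∧ μ = volume.withDensity q ∧
    ∃ B : ℝ≥0, ∀ᵐ x, q x ≤ B
  compact_μ : ∃ R : ℝ, 0 < R ∧ μ {x | R ≤ ‖x‖} = 0
  bounded_y : ∀ R : ℝ, 0 < R → ∃ B : ℝ, ∀ x, ‖x‖ ≤ R → |y x| ≤ B

/-! ### The mean-field ResNet, its cost and the variational derivative of the cost -/

section Cost

variable {d k : ℕ} (f : Euc d → Euc k → Euc d) (g y : Euc d → ℝ) (μ : Measure (Euc d))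

/-- `z` solves `dz/dt = ∫ f(z(t),θ) dρ(θ,t)` on `[0,1]` with `z(0) = x`. -/
def IsState (ρ : ℝ → Measure (Euc k)) (x : Euc d) (z : ℝ → Euc d) : Prop :=
  z 0 = x ∧ ∀ t ∈ Icc (0 : ℝ) 1, HasDerivWithinAt z (∫ θ, f (z t) θ ∂(ρ t)) (Icc 0 1) t

/-- `Z_ρ(·;x)`: the solution of the state equation started at `x`. -/
def state (ρ : ℝ → Measure (Euc k)) (x : Euc d) : ℝ → Euc d :=
  Classical.epsilon (IsState f ρ x)

/-- The cost `E(ρ) = 𝔼_{x ∼ μ} [ ½ (g(Z_ρ(1;x)) - y(x))² ]`, as an element of `[0,∞]`. -/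
def cost (ρ : ℝ → Measure (Euc k)) : ℝ≥0∞ :=
  ∫⁻ x, ENNReal.ofReal ((1 / 2) * (g (state f ρ x 1) - y x) ^ 2) ∂μ

/-- `p` solves `dpᵀ/dt = -pᵀ ∫ ∂_z f(Z_ρ(t;x),θ) dρ(θ,t)` on `[0,1]` with final value
`p(1) = (g(Z_ρ(1;x)) - y(x)) ∇g(Z_ρ(1;x))`. -/
def IsCostate (ρ : ℝ → Measure (Euc k)) (x : Euc d) (p : ℝ → Euc d) : Prop :=
  p 1 = (g (state f ρ x 1) - y x) • gradient g (state f ρ x 1) ∧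
  ∀ t ∈ Icc (0 : ℝ) 1, HasDerivWithinAt p
    (-(ContinuousLinearMap.adjoint
        (∫ θ, fderiv ℝ (fun z => f z θ) (state f ρ x t) ∂(ρ t)) (p t))) (Icc 0 1) t

/-- `p_ρ(·;x)`: the solution of the adjoint equation. -/
def costate (ρ : ℝ → Measure (Euc k)) (x : Euc d) : ℝ → Euc d :=
  Classical.epsilon (IsCostate f g y ρ x)

/-- `δE/δρ (θ,t) = 𝔼_{x ∼ μ} [ p_ρ(t;x)ᵀ f(Z_ρ(t;x),θ) ]`. -/
def costVariation (ρ : ℝ → Measure (Euc k)) (t : ℝ) (θ : Euc k) : ℝ :=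
  ∫ x, inner ℝ (costate f g y ρ x t) (f (state f ρ x t) θ) ∂μ

/-- `δE_s/δρ (θ,t) = δE/δρ (θ,t) + e^{-s} |θ|²`, the variational derivative of the regularized cost
`E_s(ρ) = E(ρ) + e^{-s} ∫₀¹ ∫ |θ|² dρ(θ,t) dt`. -/
def regCostVariation (s : ℝ) (ρ : ℝ → Measure (Euc k)) (t : ℝ) (θ : Euc k) : ℝ :=
  costVariation f g y μ ρ t θ + Real.exp (-s) * ‖θ‖ ^ 2

/-- `ρ ∈ 𝒞([0,∞); 𝒞([0,1]; 𝒫²))` is a (weak) solution of the regularized gradient flow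
`∂_s ρ = ∇_θ · (ρ ∇_θ δE_s(ρ(s))/δρ)` for `s > 0`, `t ∈ [0,1]`, with `ρ(θ,t,0) = ρ_ini(θ,t)`: tested
against every smooth compactly supported `h(θ)`,
`d/ds ∫ h dρ(θ,t,s) = -∫ ∇h · ∇_θ δE_s(ρ(s))/δρ (θ,t) dρ(θ,t,s)`. -/
structure IsGradientFlow (ρini : ℝ → Measure (Euc k)) (ρ : ℝ → ℝ → Measure (Euc k)) : Prop where
  isFlowPath : IsFlowPath ρ
  initial : ∀ t ∈ Icc (0 : ℝ) 1, ρ 0 t = ρini t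
  equation : ∀ h : Euc k → ℝ, ContDiff ℝ ((⊤ : ℕ∞) : WithTop ℕ∞) h → HasCompactSupport h →
    ∀ t ∈ Icc (0 : ℝ) 1, ∀ s : ℝ, 0 < s →
      HasDerivAt (fun s' => ∫ θ, h θ ∂(ρ s' t))
        (-∫ θ, inner ℝ (gradient h θ)
          (gradient (regCostVariation f g y μ s (ρ s) t) θ) ∂(ρ s t)) s

end Cost

/-- The long-time conditions: `ρ(·,·,s) → ρ_∞` in `𝒞([0,1]; 𝒫²)` as `s → ∞`, and `ρ_∞(·,t₀)` has
support `ℝᵏ` for some `t₀ ∈ [0,1]`. -/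
structure HasFullySupportedLimit {k : ℕ} (ρ : ℝ → ℝ → Measure (Euc k))
    (ρinf : ℝ → Measure (Euc k)) : Prop where
  isPath : IsPath ρinf
  tendsto : Tendsto (fun s => d1 (ρ s) ρinf) atTop (𝓝 0)
  full_support : ∃ t₀ ∈ Icc (0 : ℝ) 1, (ρinf t₀).support = univ

end

end MeanFieldResNet

namespace MeanFieldResNet

/-! ### Ordinary differential equations on a compact interval -/

section Gronwall

variable {E : Type*} [NormedAddCommGroup E] [NormedSpace ℝ E]

/-! Write `V` for the first variation of `E` at `ρinf`, at a time `t₀` where `ρinf t₀` has full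
support. For a test function `h`, the integral of `h` along the flow converges as `s → ∞`. Its
`s`-derivative also converges, because the gradient of the variation depends continuously on the
path and the term `e^{-s}|θ|²` disappears. The limit of the derivative must then be zero, so `∫ ∇h ·
∇V dρinf(t₀) = 0`. Since `V` is `C¹` with bounded gradient, `h = V` times a wide cutoff is
admissible up to an error controlled by the first moment, and `∫ |∇V|² dρinf(t₀) = 0`. Full support
and continuity give `∇V = 0` everywhere, so `V` is a constant `c`
(`exists_forall_eq_of_full_support`).

Integrating `V` against an arbitrary `ν ∈ 𝒫²` and exchanging integrals gives `𝔼[p · ∫ f(Z,θ) dν] =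
c`, with state `Z` and costate `p` at time `t₀`. By density `𝔼[p · F(Z)] = c` for every continuous
`F`, and `F = 0` shows `c = 0`. The map `x ↦ Z(t₀;x)` is injective by uniqueness for the ODE, so on
the compact ball carrying `μ` the costate is a continuous function of the state. Tietze extension
turns it into an admissible `F`, whence `𝔼|p|² = 0` (`costate_ae_eq_zero`). The costate equation is
linear, so `p` also vanishes at time `1`, and since `∇g` never vanishes the residual `g(Z(1)) - y`
is zero almost everywhere (`cost_eq_zero_of_costate`).

Stability of the state then gives `E(ρ(s)) → 0` along each flow. The constant `C₀` must not depend
on the flow, and this is obtained from uniqueness: the cost at time `s` is determined by `ρini`, so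
a constant that works for one flow works for all (`exists_forall_cost_le`). Uniqueness has two
steps. With its own velocity field frozen, each flow is the pushforward of the initial measure by
the characteristics (`LipField.eq_map_flow`). This is a duality argument in which the transported
test function, only Lipschitz, is mollified, and the commutator error is linear in the mollification
radius. Two flows are then compared along characteristics, in a distance weighted by `e^{ls}`, and
for large `l` each comparison halves any bound on that distance (`halve_distance`).

All constants come from Grönwall estimates for state and costate that are uniform over paths with a
common second moment bound (`StabilityBound`, `VariationBound`). -/

theorem HasDerivWithinAt.Ici_of_Icc {u : ℝ → E} {u' : E} {a b t : ℝ}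
    (h : HasDerivWithinAt u u' (Icc a b) t) (ht : t ∈ Ico a b) :
    HasDerivWithinAt u u' (Ici t) t :=
  h.mono_of_mem_nhdsWithin (mem_of_superset (Icc_mem_nhdsGE ht.2) (Icc_subset_Icc_left ht.1))

/-- The inequality `e^u - 1 ≤ u e^u` removes the division by `K`, so one formula also covers `K =
0`. -/
theorem gronwallBound_le {δ K ε x : ℝ} (hK : 0 ≤ K) (hε : 0 ≤ ε) :
    gronwallBound δ K ε x ≤ (δ + ε * x) * Real.exp (K * x) := by
  rcases hK.eq_or_lt with rfl | hK
  · simp [gronwallBound_K0]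
  · rw [gronwallBound_of_K_ne_0 hK.ne']
    have h1 : Real.exp (K * x) - 1 ≤ K * x * Real.exp (K * x) := by
      have h2 := Real.add_one_le_exp (-(K * x))
      have h3 : Real.exp (-(K * x)) * Real.exp (K * x) = 1 := by
        rw [← Real.exp_add]; simp
      nlinarith [Real.exp_pos (K * x)]
    have : ε / K * (Real.exp (K * x) - 1) ≤ ε / K * (K * x * Real.exp (K * x)) := by gcongr
    have h4 : ε / K * (K * x * Real.exp (K * x)) = ε * x * Real.exp (K * x) := by
      field_simp
    simp only
    linarith

theorem norm_le_of_hasDerivWithinAt_forward {u u' : ℝ → E} {a b K ε : ℝ} (hK : 0 ≤ K)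
    (hε : 0 ≤ ε) (hu : ∀ t ∈ Icc a b, HasDerivWithinAt u (u' t) (Icc a b) t)
    (hb : ∀ t ∈ Icc a b, ‖u' t‖ ≤ K * ‖u t‖ + ε) {t₀ t : ℝ} (ht₀ : t₀ ∈ Icc a b)
    (ht : t ∈ Icc a b) (h : t₀ ≤ t) :
    ‖u t‖ ≤ (‖u t₀‖ + ε * (t - t₀)) * Real.exp (K * (t - t₀)) := by
  have hsub : Icc t₀ b ⊆ Icc a b := Icc_subset_Icc_left ht₀.1
  refine (norm_le_gronwallBound_of_norm_deriv_right_le (a := t₀) (b := b) (f := u) (f' := u')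
    (fun s hs => ((hu s (hsub hs)).continuousWithinAt).mono hsub)
    (fun s hs => HasDerivWithinAt.Ici_of_Icc (hu s (hsub (Ico_subset_Icc_self hs)))
      ⟨ht₀.1.trans hs.1, hs.2⟩) le_rfl
    (fun s hs => hb s (hsub (Ico_subset_Icc_self hs))) t ⟨h, ht.2⟩).trans
    (gronwallBound_le hK hε)

theorem hasDerivWithinAt_comp_neg {u : ℝ → E} {u' : E} {a b t : ℝ}
    (h : HasDerivWithinAt u u' (Icc a b) (-t)) :
    HasDerivWithinAt (fun s => u (-s)) (-u') (Icc (-b) (-a)) t := by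
  have h2 := HasDerivWithinAt.scomp (h := fun s : ℝ => -s) (h' := -1) (s := Icc (-b) (-a)) t h
    ((hasDerivAt_neg t).hasDerivWithinAt) (fun s hs => ⟨by linarith [hs.2], by linarith [hs.1]⟩)
  simpa [Function.comp_def] using h2

/-- Two-sided Grönwall inequality. -/
theorem norm_le_of_hasDerivWithinAt {u u' : ℝ → E} {a b K ε : ℝ} (hK : 0 ≤ K) (hε : 0 ≤ ε)
    (hu : ∀ t ∈ Icc a b, HasDerivWithinAt u (u' t) (Icc a b) t)
    (hb : ∀ t ∈ Icc a b, ‖u' t‖ ≤ K * ‖u t‖ + ε) {t₀ t : ℝ} (ht₀ : t₀ ∈ Icc a b)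
    (ht : t ∈ Icc a b) :
    ‖u t‖ ≤ (‖u t₀‖ + ε * |t - t₀|) * Real.exp (K * |t - t₀|) := by
  rcases le_total t₀ t with h | h
  · rw [abs_of_nonneg (sub_nonneg.2 h)]
    exact norm_le_of_hasDerivWithinAt_forward hK hε hu hb ht₀ ht h
  · have hm : ∀ s ∈ Icc (-b) (-a), -s ∈ Icc a b :=
      fun s hs => ⟨by linarith [hs.2], by linarith [hs.1]⟩
    have key := norm_le_of_hasDerivWithinAt_forward (u := fun s => u (-s)) (u' := fun s => -u' (-s))
      (a := -b) (b := -a) hK hε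
      (fun s hs => hasDerivWithinAt_comp_neg (hu (-s) (hm s hs)))
      (fun s hs => by simpa using hb (-s) (hm s hs)) (t₀ := -t₀) (t := -t)
      ⟨by linarith [ht₀.2], by linarith [ht₀.1]⟩ ⟨by linarith [ht.2], by linarith [ht.1]⟩
      (by linarith)
    simp only [neg_neg] at key
    rw [abs_of_nonpos (sub_nonpos.2 h)]
    have e : -(t - t₀) = -t - -t₀ := by ring
    rw [e]; exact key

/-- Grönwall inequality with an exponentially growing source. -/
theorem norm_le_exp_of_hasDerivWithinAt {u u' : ℝ → E} {b K A l : ℝ} (hA : 0 < A)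
    (hl : 2 * K < l) (hl0 : 0 < l)
    (hu : ∀ t ∈ Icc 0 b, HasDerivWithinAt u (u' t) (Icc 0 b) t) (h0 : u 0 = 0)
    (hb : ∀ t ∈ Icc 0 b, ‖u' t‖ ≤ K * ‖u t‖ + A * Real.exp (l * t)) {t : ℝ}
    (ht : t ∈ Icc 0 b) :
    ‖u t‖ ≤ 2 * A / l * Real.exp (l * t) := by
  -- The barrier `(2A/l) e^{lt}` has derivative `2A e^{lt}`. Where `‖u‖` touches it, `‖u'‖` is at
  -- most `(2AK/l + A) e^{lt}`, which is strictly smaller because `2K < l`.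
  refine image_norm_le_of_norm_deriv_right_lt_deriv_boundary (f := u) (f' := u') (a := 0) (b := b)
    (B := fun t => 2 * A / l * Real.exp (l * t)) (B' := fun t => 2 * A * Real.exp (l * t))
    (fun s hs => (hu s hs).continuousWithinAt)
    (fun s hs => HasDerivWithinAt.Ici_of_Icc (hu s (Ico_subset_Icc_self hs)) hs) ?_ ?_ ?_ ht
  · rw [h0, norm_zero]; positivity
  · intro s
    have := (((hasDerivAt_id s).const_mul l).exp).const_mul (2 * A / l)
    convert! this using 1
    simp only [id]
    field_simp
  · intro s hs hus
    refine (hb s (Ico_subset_Icc_self hs)).trans_lt ?_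
    rw [hus]
    have h1 : K * (2 * A / l) < A := by
      rw [← mul_div_assoc, div_lt_iff₀ hl0]; nlinarith
    have := Real.exp_pos (l * s)
    nlinarith

end Gronwall

/-- The coordinatewise projection onto the cube `[-a,a]ⁿ`. -/
noncomputable def clamp {n : ℕ} (a : ℝ) (x : Euc n) : Euc n :=
  WithLp.toLp 2 fun i => max (-a) (min a (x i))

theorem clamp_eq_self {n : ℕ} {a : ℝ} {x : Euc n} (h : ‖x‖ ≤ a) : clamp a x = x := by
  ext i
  have h1 : |x i| ≤ a := (PiLp.norm_apply_le x i).trans h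
  have := abs_le.1 h1
  simp [clamp, min_eq_right this.2, max_eq_right this.1]

theorem norm_clamp_sub_le {n : ℕ} (a : ℝ) (x y : Euc n) : ‖clamp a x - clamp a y‖ ≤ ‖x - y‖ := by
  rw [EuclideanSpace.norm_eq, EuclideanSpace.norm_eq]
  refine Real.sqrt_le_sqrt (Finset.sum_le_sum fun i _ => ?_)
  refine pow_le_pow_left₀ (norm_nonneg _) ?_ 2
  simp only [clamp, PiLp.sub_apply, Real.norm_eq_abs]
  calc |max (-a) (min a (x i)) - max (-a) (min a (y i))|
      ≤ |min a (x i) - min a (y i)| := by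
        simpa using abs_max_sub_max_le_max (-a) (min a (x i)) (-a) (min a (y i))
    _ ≤ |x i - y i| := by simpa using abs_min_sub_min_le_max a (x i) a (y i)

theorem norm_clamp_le {n : ℕ} {a : ℝ} (ha : 0 ≤ a) (x : Euc n) : ‖clamp a x‖ ≤ ‖x‖ := by
  have h := norm_clamp_sub_le a x 0
  have h0 : clamp a (0 : Euc n) = 0 := clamp_eq_self (by simpa using ha)
  simpa [h0] using h

theorem exists_norm_clamp_le (n : ℕ) {a : ℝ} (ha : 0 ≤ a) :
    ∃ B, 0 ≤ B ∧ ∀ x : Euc n, ‖clamp a x‖ ≤ B := by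
  refine ⟨√(∑ _i : Fin n, a ^ 2), Real.sqrt_nonneg _, fun x => ?_⟩
  rw [EuclideanSpace.norm_eq]
  refine Real.sqrt_le_sqrt (Finset.sum_le_sum fun i _ => ?_)
  refine pow_le_pow_left₀ (norm_nonneg _) ?_ 2
  simp only [clamp, Real.norm_eq_abs]
  exact abs_le.2 ⟨le_max_left _ _, max_le (by linarith) (min_le_left _ _)⟩

/-- Global solvability of an ODE whose right-hand side is globally Lipschitz. -/
theorem exists_ode_solution {n : ℕ} {F : ℝ → Euc n → Euc n} {a b K : ℝ} (hK : 0 ≤ K)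
    (hF : ∀ t ∈ Icc a b, ∀ x y, ‖F t x - F t y‖ ≤ K * ‖x - y‖)
    (hc : ∀ x, ContinuousOn (fun t => F t x) (Icc a b)) {t₀ : ℝ} (ht₀ : t₀ ∈ Icc a b)
    (x₀ : Euc n) :
    ∃ z : ℝ → Euc n, z t₀ = x₀ ∧
      ∀ t ∈ Icc a b, HasDerivWithinAt z (F t (z t)) (Icc a b) t := by
  obtain ⟨M, hM⟩ := isCompact_Icc.exists_bound_of_continuousOn (hc 0)
  have hM0 : 0 ≤ M := (norm_nonneg _).trans (hM t₀ ht₀)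
  have hab : 0 ≤ b - a := by linarith [ht₀.1, ht₀.2]
  -- `A` is the Grönwall bound that any solution on `[a,b]` must satisfy.
  set A : ℝ := (‖x₀‖ + M * (b - a)) * Real.exp (K * (b - a)) with hA
  have hA0 : 0 ≤ A := by positivity
  obtain ⟨B, hB0, hB⟩ := exists_norm_clamp_le n hA0
  have hgrow : ∀ t ∈ Icc a b, ∀ x, ‖F t x‖ ≤ K * ‖x‖ + M := fun t ht x => by
    have h1 := hF t ht x 0
    have h2 := norm_sub_norm_le (F t x) (F t 0)
    have h3 := hM t ht
    simp only [sub_zero] at h1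
    linarith
  have hN : 0 ≤ K * B + M := by positivity
  -- Clamping the state makes the field bounded by `K * B + M`, so a Picard–Lindelöf ball of radius
  -- `(K * B + M)(b - a)` lasts for the whole interval.
  have hP : IsPicardLindelof (fun t x => F t (clamp A x)) (⟨t₀, ht₀⟩ : Icc a b) x₀
      (⟨(K * B + M) * (b - a), by positivity⟩ : ℝ≥0) 0 ⟨K * B + M, hN⟩ ⟨K, hK⟩ := by
    refine ⟨fun t ht => ?_, fun x _ => hc _, fun t ht x _ => ?_, ?_⟩
    · refine LipschitzOnWith.of_dist_le_mul fun x _ y _ => ?_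
      rw [dist_eq_norm, dist_eq_norm]
      exact (hF t ht _ _).trans (mul_le_mul_of_nonneg_left (norm_clamp_sub_le A x y) hK)
    · refine (hgrow t ht _).trans ?_
      change K * ‖clamp A x‖ + M ≤ K * B + M
      gcongr
      exact hB x
    · simp only [NNReal.coe_zero, sub_zero]
      refine mul_le_mul_of_nonneg_left (max_le ?_ ?_) hN
      · linarith [ht₀.1]
      · linarith [ht₀.2]
  obtain ⟨z, hz0, hz⟩ := hP.exists_eq_forall_mem_Icc_hasDerivWithinAt₀
  refine ⟨z, hz0, fun t ht => ?_⟩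
  -- The clamped field has the same linear growth, so its solution obeys the same bound and never
  -- meets the clamp.
  have hzA : ‖z t‖ ≤ A := by
    have := norm_le_of_hasDerivWithinAt hK hM0 hz (fun s hs => (hgrow s hs _).trans
      (by gcongr; exact norm_clamp_le hA0 _)) ht₀ ht
    rw [show z t₀ = x₀ from hz0] at this
    have hd : |t - t₀| ≤ b - a := abs_le.2 ⟨by linarith [ht.1, ht₀.2], by linarith [ht.2, ht₀.1]⟩
    refine this.trans ?_
    rw [hA]
    gcongr
  have := hz t ht
  simpa only [clamp_eq_self hzA] using this

/-! ### Second moments and couplings -/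

/-- `ρ` is a probability measure whose second moment is at most `M ^ 2`, with `M > 0`. -/
structure MomentBound {k : ℕ} (ρ : Measure (Euc k)) (M : ℝ) : Prop where
  prob : IsProbabilityMeasure ρ
  pos : 0 < M
  integrable : Integrable (fun θ => ‖θ‖ ^ 2) ρ
  le : ∫ θ, ‖θ‖ ^ 2 ∂ρ ≤ M ^ 2

/-- There is a coupling of `ρ` and `ρ'` whose quadratic cost is at most `w ^ 2`. -/
def W2Le {k : ℕ} (ρ ρ' : Measure (Euc k)) (w : ℝ) : Prop :=
  ∃ π : Measure (Euc k × Euc k), π.fst = ρ ∧ π.snd = ρ' ∧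
    Integrable (fun z => ‖z.1 - z.2‖ ^ 2) π ∧ ∫ z, ‖z.1 - z.2‖ ^ 2 ∂π ≤ w ^ 2

theorem lintegral_enorm_sq {α : Type*} {F : Type*} [MeasurableSpace α] [NormedAddCommGroup F]
    {π : Measure α} {u : α → F} (hi : Integrable (fun z => ‖u z‖ ^ 2) π) :
    ∫⁻ z, ‖u z‖ₑ ^ 2 ∂π = ENNReal.ofReal (∫ z, ‖u z‖ ^ 2 ∂π) := by
  rw [ofReal_integral_eq_lintegral_ofReal hi (ae_of_all _ fun z => by positivity)]
  refine lintegral_congr fun z => ?_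
  rw [ENNReal.ofReal_pow (norm_nonneg _), ofReal_norm]

theorem integrable_norm_sq {α : Type*} {F : Type*} [MeasurableSpace α] [NormedAddCommGroup F]
    {π : Measure α} {u : α → F} (hu : AEStronglyMeasurable u π)
    (hi : ∫⁻ z, ‖u z‖ₑ ^ 2 ∂π < ∞) : Integrable (fun z => ‖u z‖ ^ 2) π := by
  refine ⟨(hu.norm.pow 2), ?_⟩
  rw [hasFiniteIntegral_iff_enorm]
  refine lt_of_le_of_lt (lintegral_mono fun z => ?_) hi
  simp

/-- Cauchy–Schwarz through the weighted inequality `uv ≤ (B/2A)u² + (A/2B)v²`, which yields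
integrability of the product at the same time. -/
theorem integral_mul_le_of_sq_le {α : Type*} [MeasurableSpace α] {π : Measure α} {u v : α → ℝ}
    {A B : ℝ} (hA : 0 < A) (hB : 0 < B) (hu : AEStronglyMeasurable u π)
    (hv : AEStronglyMeasurable v π) (hiu : Integrable (fun z => u z ^ 2) π)
    (hiv : Integrable (fun z => v z ^ 2) π) (hA' : ∫ z, u z ^ 2 ∂π ≤ A ^ 2)
    (hB' : ∫ z, v z ^ 2 ∂π ≤ B ^ 2) :
    Integrable (fun z => u z * v z) π ∧ ∫ z, u z * v z ∂π ≤ A * B := by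
  have hle : ∀ z, ‖u z * v z‖ ≤ B / (2 * A) * u z ^ 2 + A / (2 * B) * v z ^ 2 := fun z => by
    have e : B / (2 * A) * u z ^ 2 + A / (2 * B) * v z ^ 2 =
        ((B * |u z|) ^ 2 + (A * |v z|) ^ 2) / (2 * A * B) := by
      rw [mul_pow, mul_pow, sq_abs, sq_abs]; field_simp
    rw [e, Real.norm_eq_abs, abs_mul, le_div_iff₀ (by positivity)]
    nlinarith [sq_nonneg (B * |u z| - A * |v z|)]
  have hi : Integrable (fun z => B / (2 * A) * u z ^ 2 + A / (2 * B) * v z ^ 2) π :=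
    (hiu.const_mul _).add (hiv.const_mul _)
  have hi2 : Integrable (fun z => u z * v z) π := hi.mono' (hu.mul hv) (ae_of_all _ hle)
  refine ⟨hi2, ?_⟩
  calc ∫ z, u z * v z ∂π ≤ ∫ z, B / (2 * A) * u z ^ 2 + A / (2 * B) * v z ^ 2 ∂π :=
        integral_mono hi2 hi fun z => (le_abs_self _).trans (hle z)
    _ = B / (2 * A) * ∫ z, u z ^ 2 ∂π + A / (2 * B) * ∫ z, v z ^ 2 ∂π := by
        rw [integral_add (hiu.const_mul _) (hiv.const_mul _), integral_const_mul,
          integral_const_mul]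
    _ ≤ B / (2 * A) * A ^ 2 + A / (2 * B) * B ^ 2 := by gcongr
    _ = A * B := by field_simp; ring

namespace MomentBound

variable {k : ℕ} {ρ ρ' : Measure (Euc k)} {M M' : ℝ}

theorem mono (h : MomentBound ρ M) (hM : M ≤ M') : MomentBound ρ M' :=
  ⟨h.prob, h.pos.trans_le hM, h.integrable, h.le.trans (by have := h.pos; gcongr)⟩

theorem integrable_norm_and_le (h : MomentBound ρ M) :
    Integrable (fun θ => ‖θ‖) ρ ∧ ∫ θ, ‖θ‖ ∂ρ ≤ M := by
  have := h.prob
  have := integral_mul_le_of_sq_le (π := ρ) (u := fun θ => ‖θ‖) (v := fun _ => (1 : ℝ)) h.pos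
    one_pos continuous_norm.aestronglyMeasurable aestronglyMeasurable_const h.integrable
    (integrable_const _) h.le (by simp)
  simpa using this

theorem integrable_of_le (h : MomentBound ρ M) {G : Type*} [NormedAddCommGroup G] {ψ : Euc k → G}
    (hψ : Continuous ψ) {c₀ c₁ c₂ : ℝ} (hb : ∀ θ, ‖ψ θ‖ ≤ c₀ + c₁ * ‖θ‖ + c₂ * ‖θ‖ ^ 2) :
    Integrable ψ ρ := by
  have := h.prob
  exact (((integrable_const c₀).add (h.integrable_norm_and_le.1.const_mul c₁)).add
    (h.integrable.const_mul c₂)).mono' hψ.aestronglyMeasurable (ae_of_all _ hb)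

theorem norm_integral_le (h : MomentBound ρ M) {G : Type*} [NormedAddCommGroup G]
    [NormedSpace ℝ G] {ψ : Euc k → G} {c₀ c₁ c₂ : ℝ} (h₁ : 0 ≤ c₁) (h₂ : 0 ≤ c₂)
    (hb : ∀ θ, ‖ψ θ‖ ≤ c₀ + c₁ * ‖θ‖ + c₂ * ‖θ‖ ^ 2) :
    ‖∫ θ, ψ θ ∂ρ‖ ≤ c₀ + c₁ * M + c₂ * M ^ 2 := by
  have := h.prob
  have i1 := h.integrable_norm_and_le
  have hi : Integrable (fun θ => c₀ + c₁ * ‖θ‖) ρ :=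
    (integrable_const c₀).add (i1.1.const_mul c₁)
  have hi2 := h.integrable.const_mul c₂
  refine (norm_integral_le_of_norm_le (hi.add hi2) (ae_of_all _ hb)).trans ?_
  simp only [Pi.add_apply]
  rw [integral_add hi hi2, integral_add (integrable_const c₀) (i1.1.const_mul c₁),
    integral_const_mul, integral_const_mul]
  simp only [integral_const, probReal_univ, one_smul]
  have := i1.2
  have := h.le
  gcongr

end MomentBound

theorem MemP2.exists_momentBound {k : ℕ} {ρ : Measure (Euc k)} (h : MemP2 ρ) :
    ∃ M, MomentBound ρ M := by
  have hi : Integrable (fun θ => ‖θ‖ ^ 2) ρ :=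
    integrable_norm_sq (u := fun θ : Euc k => θ) continuous_id.aestronglyMeasurable h.2
  have h0 : 0 ≤ ∫ θ, ‖θ‖ ^ 2 ∂ρ := integral_nonneg fun θ => by positivity
  -- With `m` the second moment, `1 + m` is positive and `m ≤ (1 + m)²`.
  refine ⟨1 + ∫ θ, ‖θ‖ ^ 2 ∂ρ, h.1, by positivity, hi, by nlinarith⟩

namespace W2Le

variable {k : ℕ} {ρ ρ' : Measure (Euc k)} {w w' M M' : ℝ}

theorem refl (ρ : Measure (Euc k)) (w : ℝ) : W2Le ρ ρ w := by
  have hm : Measurable fun θ : Euc k => (θ, θ) := measurable_id.prodMk measurable_id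
  have hc : Continuous fun z : Euc k × Euc k => ‖z.1 - z.2‖ ^ 2 := by fun_prop
  refine ⟨ρ.map fun θ => (θ, θ), ?_, ?_, ?_, ?_⟩
  · rw [Measure.fst, Measure.map_map measurable_fst hm]; exact Measure.map_id
  · rw [Measure.snd, Measure.map_map measurable_snd hm]; exact Measure.map_id
  · rw [integrable_map_measure hc.aestronglyMeasurable hm.aemeasurable]
    simp [Function.comp_def]
  · rw [integral_map hm.aemeasurable hc.aestronglyMeasurable]
    simp [sq_nonneg]

theorem symm (h : W2Le ρ ρ' w) : W2Le ρ' ρ w := by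
  obtain ⟨π, h1, h2, hi, hle⟩ := h
  have hc : Continuous fun z : Euc k × Euc k => ‖z.1 - z.2‖ ^ 2 := by fun_prop
  refine ⟨π.map Prod.swap, ?_, ?_, ?_, ?_⟩
  · rw [Measure.fst_map_swap, h2]
  · rw [Measure.snd_map_swap, h1]
  · rw [integrable_map_measure hc.aestronglyMeasurable measurable_swap.aemeasurable]
    refine hi.congr (ae_of_all _ fun z => ?_)
    simp [norm_sub_rev]
  · rw [integral_map measurable_swap.aemeasurable hc.aestronglyMeasurable]
    simpa [norm_sub_rev] using hle

/-- A strict inequality is witnessed by some competitor in the infimum, so optimal couplings are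
never needed. -/
theorem of_W2_lt (h : W2 ρ ρ' < ENNReal.ofReal w) : 0 < w ∧ W2Le ρ ρ' w := by
  have hw : 0 < w := ENNReal.ofReal_pos.1 (zero_le.trans_lt h)
  refine ⟨hw, ?_⟩
  simp only [W2, iInf_lt_iff] at h
  obtain ⟨π, ⟨h1, h2⟩, h⟩ := h
  have h3 : ∫⁻ z, ‖z.1 - z.2‖ₑ ^ 2 ∂π < ENNReal.ofReal (w ^ 2) := by
    have := ENNReal.rpow_lt_rpow h (z := 2) (by norm_num)
    rw [← ENNReal.rpow_mul] at this
    norm_num at this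
    rwa [ENNReal.ofReal_pow hw.le]
  have hi : Integrable (fun z => ‖z.1 - z.2‖ ^ 2) π :=
    integrable_norm_sq (u := fun z : Euc k × Euc k => z.1 - z.2)
      (by fun_prop) (h3.trans ENNReal.ofReal_lt_top)
  refine ⟨π, h1, h2, hi, ?_⟩
  rw [lintegral_enorm_sq hi] at h3
  exact ((ENNReal.ofReal_lt_ofReal_iff (by positivity)).1 h3).le

/-- From `|b|² ≤ 2|a|² + 2|a - b|²` under the coupling, and `2M² + 2w² ≤ (2(M + w))²`. -/
theorem momentBound (h : W2Le ρ ρ' w) (hw : 0 ≤ w) (hM : MomentBound ρ M) :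
    MomentBound ρ' (2 * (M + w)) := by
  obtain ⟨π, h1, h2, hi, hle⟩ := h
  have := hM.prob
  have hp : IsProbabilityMeasure π := ⟨by rw [← Measure.fst_univ, h1, measure_univ]⟩
  have hc : Continuous fun θ : Euc k => ‖θ‖ ^ 2 := by fun_prop
  have i1 : Integrable (fun z : Euc k × Euc k => ‖z.1‖ ^ 2) π := by
    have := hM.integrable
    rw [← h1, Measure.fst,
      integrable_map_measure hc.aestronglyMeasurable measurable_fst.aemeasurable] at this
    exact this
  have e1 : ∫ z : Euc k × Euc k, ‖z.1‖ ^ 2 ∂π ≤ M ^ 2 := by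
    have := hM.le
    rwa [← h1, Measure.fst, integral_map measurable_fst.aemeasurable hc.aestronglyMeasurable]
      at this
  have hb : ∀ z : Euc k × Euc k, ‖z.2‖ ^ 2 ≤ 2 * ‖z.1‖ ^ 2 + 2 * ‖z.1 - z.2‖ ^ 2 := fun z => by
    have h3 : ‖z.2‖ ≤ ‖z.1‖ + ‖z.1 - z.2‖ := by
      have := norm_sub_le z.1 (z.1 - z.2)
      simpa using this
    nlinarith [norm_nonneg z.2, norm_nonneg z.1, sq_nonneg (‖z.1‖ - ‖z.1 - z.2‖)]
  have hi2 : Integrable (fun z : Euc k × Euc k => 2 * ‖z.1‖ ^ 2 + 2 * ‖z.1 - z.2‖ ^ 2) π :=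
    (i1.const_mul 2).add (hi.const_mul 2)
  have i2 : Integrable (fun z : Euc k × Euc k => ‖z.2‖ ^ 2) π :=
    hi2.mono' (by fun_prop) (ae_of_all _ fun z => by simpa using hb z)
  refine ⟨h2 ▸ inferInstance, by have := hM.pos; positivity, ?_, ?_⟩
  · rw [← h2, Measure.snd,
      integrable_map_measure hc.aestronglyMeasurable measurable_snd.aemeasurable]
    exact i2
  · rw [← h2, Measure.snd, integral_map measurable_snd.aemeasurable hc.aestronglyMeasurable]
    refine (integral_mono i2 hi2 hb).trans ?_
    rw [integral_add (i1.const_mul 2) (hi.const_mul 2), integral_const_mul, integral_const_mul]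
    nlinarith [hM.pos, mul_nonneg hM.pos.le hw]

end W2Le

theorem integrable_of_locally_lipschitz {k : ℕ} {ρ : Measure (Euc k)} {M : ℝ}
    (h : MomentBound ρ M) {G : Type*} [NormedAddCommGroup G] {ψ : Euc k → G} (hψ : Continuous ψ)
    {A B : ℝ} (hL : ∀ θ θ', ‖ψ θ - ψ θ'‖ ≤ (A + B * (‖θ‖ + ‖θ'‖)) * ‖θ - θ'‖) :
    Integrable ψ ρ := by
  refine h.integrable_of_le hψ (c₀ := ‖ψ 0‖) (c₁ := A) (c₂ := B) fun θ => ?_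
  have h1 := hL θ 0
  have h2 := norm_sub_norm_le (ψ θ) (ψ 0)
  simp only [norm_zero, add_zero, sub_zero] at h1
  nlinarith

/-- Integrals of functions with linearly growing Lipschitz constant depend on the measure in a
Lipschitz way. -/
theorem norm_integral_sub_integral_le {k : ℕ} {ρ ρ' : Measure (Euc k)} {M w : ℝ}
    (h : MomentBound ρ M) (h' : MomentBound ρ' M) (hW : W2Le ρ ρ' w) (hw : 0 < w) {G : Type*}
    [NormedAddCommGroup G] [NormedSpace ℝ G] {ψ : Euc k → G} (hψ : Continuous ψ) {A B : ℝ}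
    (hA : 0 ≤ A) (hB : 0 ≤ B)
    (hL : ∀ θ θ', ‖ψ θ - ψ θ'‖ ≤ (A + B * (‖θ‖ + ‖θ'‖)) * ‖θ - θ'‖) :
    ‖∫ θ, ψ θ ∂ρ - ∫ θ, ψ θ ∂ρ'‖ ≤ (A + 2 * B * M) * w := by
  have iρ := integrable_of_locally_lipschitz h hψ hL
  have iρ' := integrable_of_locally_lipschitz h' hψ hL
  obtain ⟨π, h1, h2, hi, hle⟩ := hW
  have := h.prob
  have hp : IsProbabilityMeasure π := ⟨by rw [← Measure.fst_univ, h1, measure_univ]⟩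
  have hc : Continuous fun θ : Euc k => ‖θ‖ ^ 2 := by fun_prop
  have i1 := h.integrable
  have i2 := h'.integrable
  have e1 := h.le
  have e2 := h'.le
  rw [← h1, Measure.fst] at iρ i1 e1
  rw [← h2, Measure.snd] at iρ' i2 e2
  rw [integrable_map_measure hc.aestronglyMeasurable measurable_fst.aemeasurable] at i1
  rw [integrable_map_measure hc.aestronglyMeasurable measurable_snd.aemeasurable] at i2
  rw [integral_map measurable_fst.aemeasurable hc.aestronglyMeasurable] at e1
  rw [integral_map measurable_snd.aemeasurable hc.aestronglyMeasurable] at e2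
  rw [integrable_map_measure hψ.aestronglyMeasurable measurable_fst.aemeasurable] at iρ
  rw [integrable_map_measure hψ.aestronglyMeasurable measurable_snd.aemeasurable] at iρ'
  rw [← h1, ← h2, Measure.fst, Measure.snd,
    integral_map measurable_fst.aemeasurable hψ.aestronglyMeasurable,
    integral_map measurable_snd.aemeasurable hψ.aestronglyMeasurable]
  rw [← integral_sub (by exact iρ) (by exact iρ')]
  have md : AEStronglyMeasurable (fun z : Euc k × Euc k => ‖z.1 - z.2‖) π := by fun_prop
  -- Each of the three summands `1`, `‖z.1‖`, `‖z.2‖` of the Lipschitz factor is paired with `‖z.1 -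
  -- z.2‖` by Cauchy–Schwarz.
  have c0 := integral_mul_le_of_sq_le (π := π) (u := fun _ => (1 : ℝ))
    (v := fun z => ‖z.1 - z.2‖) one_pos hw (by fun_prop) md (by simp) hi (by simp) hle
  have c1 := integral_mul_le_of_sq_le (π := π) (u := fun z => ‖z.1‖)
    (v := fun z => ‖z.1 - z.2‖) h.pos hw (by fun_prop) md (by exact i1) hi e1 hle
  have c2 := integral_mul_le_of_sq_le (π := π) (u := fun z => ‖z.2‖)
    (v := fun z => ‖z.1 - z.2‖) h.pos hw (by fun_prop) md (by exact i2) hi e2 hle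
  have hI := ((c0.1.const_mul A).add ((c1.1.const_mul B).add (c2.1.const_mul B)))
  refine (norm_integral_le_of_norm_le hI (ae_of_all _ fun z => (hL z.1 z.2).trans
    (le_of_eq ?_))).trans ?_
  · simp only [Pi.add_apply]; ring
  · have s1 : ∫ z : Euc k × Euc k, ((fun z : Euc k × Euc k => A * (1 * ‖z.1 - z.2‖)) +
        ((fun z : Euc k × Euc k => B * (‖z.1‖ * ‖z.1 - z.2‖)) + fun z : Euc k × Euc k => B * (‖z.2‖ * ‖z.1 - z.2‖))) z ∂π =
        A * (∫ z : Euc k × Euc k, 1 * ‖z.1 - z.2‖ ∂π) + (B * (∫ z : Euc k × Euc k, ‖z.1‖ * ‖z.1 - z.2‖ ∂π) +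
          B * (∫ z : Euc k × Euc k, ‖z.2‖ * ‖z.1 - z.2‖ ∂π)) := by
      rw [integral_add' (c0.1.const_mul A) ((c1.1.const_mul B).add (c2.1.const_mul B)),
        integral_add' (c1.1.const_mul B) (c2.1.const_mul B)]
      simp only [integral_const_mul]
    rw [s1]
    have t0 := mul_le_mul_of_nonneg_left c0.2 hA
    have t1 := mul_le_mul_of_nonneg_left c1.2 hB
    have t2 := mul_le_mul_of_nonneg_left c2.2 hB
    linarith

/-! ### Paths have bounded moments -/

theorem W2Le.of_d1_lt {k : ℕ} {ρ ρ' : ℝ → Measure (Euc k)} {w : ℝ}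
    (h : d1 ρ ρ' < ENNReal.ofReal w) {t : ℝ} (ht : t ∈ Icc (0 : ℝ) 1) :
    0 < w ∧ W2Le (ρ t) (ρ' t) w :=
  W2Le.of_W2_lt ((le_iSup₂ (f := fun t (_ : t ∈ Icc (0 : ℝ) 1) => W2 (ρ t) (ρ' t)) t ht).trans_lt h)

/-- A moment bound at `t₀` extends to all times at `W2`-distance below `1`, and compactness of
`[0,1]` leaves finitely many such neighbourhoods. -/
theorem IsPath.exists_momentBound {k : ℕ} {ρ : ℝ → Measure (Euc k)} (h : IsPath ρ) :
    ∃ M, ∀ t ∈ Icc (0 : ℝ) 1, MomentBound (ρ t) M := by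
  -- The induction over compact sets ranges over arbitrary subsets of `ℝ`, hence the second
  -- membership condition.
  have key : ∃ M, ∀ t ∈ Icc (0 : ℝ) 1, t ∈ Icc (0 : ℝ) 1 → MomentBound (ρ t) M := by
    refine isCompact_Icc.induction_on
      (p := fun s => ∃ M, ∀ t ∈ s, t ∈ Icc (0 : ℝ) 1 → MomentBound (ρ t) M)
      ⟨1, by simp⟩ (fun s s' hs ⟨M, hM⟩ => ⟨M, fun t ht => hM t (hs ht)⟩) ?_ ?_
    · rintro s s' ⟨M, hM⟩ ⟨M', hM'⟩
      refine ⟨max M M', fun t ht htI => ?_⟩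
      rcases ht with ht | ht
      · exact (hM t ht htI).mono (le_max_left _ _)
      · exact (hM' t ht htI).mono (le_max_right _ _)
    · intro t₀ ht₀
      obtain ⟨M, hM⟩ := (h.1 t₀ ht₀).exists_momentBound
      have h1 := (h.2 t₀ ht₀).eventually_lt_const (u := ENNReal.ofReal 1) (by simp)
      refine ⟨_, h1, 2 * (M + 1), fun t ht _ => ?_⟩
      have := W2Le.of_W2_lt ht
      exact this.2.symm.momentBound zero_le_one hM
  obtain ⟨M, hM⟩ := key
  exact ⟨M, fun t ht => hM t ht ht⟩

theorem momentBound_of_d1_lt {k : ℕ} {ρ ρ' : ℝ → Measure (Euc k)} {M w : ℝ}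
    (h : d1 ρ' ρ < ENNReal.ofReal w) (hM : ∀ t ∈ Icc (0 : ℝ) 1, MomentBound (ρ t) M) :
    ∀ t ∈ Icc (0 : ℝ) 1, MomentBound (ρ' t) (2 * (M + w)) := fun t ht =>
  (W2Le.of_d1_lt h ht).2.symm.momentBound (W2Le.of_d1_lt h ht).1.le (hM t ht)

theorem IsFlowPath.exists_momentBound {k : ℕ} {ρ : ℝ → ℝ → Measure (Euc k)} (h : IsFlowPath ρ)
    (S : ℝ) : ∃ M, ∀ s ∈ Icc (0 : ℝ) S, ∀ t ∈ Icc (0 : ℝ) 1, MomentBound (ρ s t) M := by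
  have key : ∃ M, ∀ s ∈ Icc (0 : ℝ) S, s ∈ Icc (0 : ℝ) S →
      ∀ t ∈ Icc (0 : ℝ) 1, MomentBound (ρ s t) M := by
    refine isCompact_Icc.induction_on
      (p := fun U => ∃ M, ∀ s ∈ U, s ∈ Icc (0 : ℝ) S → ∀ t ∈ Icc (0 : ℝ) 1, MomentBound (ρ s t) M)
      ⟨1, by simp⟩ (fun s s' hs ⟨M, hM⟩ => ⟨M, fun t ht => hM t (hs ht)⟩) ?_ ?_
    · rintro s s' ⟨M, hM⟩ ⟨M', hM'⟩
      refine ⟨max M M', fun t ht htI t' ht' => ?_⟩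
      rcases ht with ht | ht
      · exact (hM t ht htI t' ht').mono (le_max_left _ _)
      · exact (hM' t ht htI t' ht').mono (le_max_right _ _)
    · intro s₀ hs₀
      obtain ⟨M, hM⟩ := (h.1 s₀ hs₀.1).exists_momentBound
      have h1 := (h.2 s₀ hs₀.1).eventually_lt_const (u := ENNReal.ofReal 1) (by simp)
      refine ⟨_, nhdsWithin_mono s₀ Icc_subset_Ici_self h1, 2 * (M + 1), fun s hs _ => ?_⟩
      exact momentBound_of_d1_lt hs hM
  obtain ⟨M, hM⟩ := key
  exact ⟨M, fun t ht => hM t ht ht⟩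

/-! ### Estimates on the activation function -/

theorem sum_smul_stdVec {n : ℕ} (v : Euc n) : v = ∑ i, v i • stdVec i := by
  have := (EuclideanSpace.basisFun (Fin n) ℝ).sum_repr v
  simpa [stdVec] using this.symm

theorem norm_sum_smul_le {n : ℕ} {G : Type*} [NormedAddCommGroup G] [NormedSpace ℝ G]
    (v : Euc n) (a : Fin n → G) : ‖∑ i, v i • a i‖ ≤ ‖v‖ * √(∑ i, ‖a i‖ ^ 2) := by
  calc ‖∑ i, v i • a i‖ ≤ ∑ i, ‖v i‖ * ‖a i‖ :=
        (norm_sum_le _ _).trans (Finset.sum_le_sum fun i _ => (norm_smul _ _).le)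
    _ ≤ √(∑ i, ‖v i‖ ^ 2) * √(∑ i, ‖a i‖ ^ 2) :=
        Real.sum_mul_le_sqrt_mul_sqrt _ _ _
    _ = _ := by rw [EuclideanSpace.norm_eq]

theorem norm_le_frob {m d : ℕ} (A : Euc m →L[ℝ] Euc d) : ‖A‖ ≤ frob A := by
  refine A.opNorm_le_bound (Real.sqrt_nonneg _) fun v => ?_
  conv_lhs => rw [sum_smul_stdVec v]
  rw [map_sum]
  simp only [map_smul]
  exact (norm_sum_smul_le v _).trans (mul_comm _ _).le

theorem norm_le_frob₂ {m n d : ℕ} (B : Euc m →L[ℝ] Euc n →L[ℝ] Euc d) : ‖B‖ ≤ frob₂ B := by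
  refine B.opNorm_le_bound (Real.sqrt_nonneg _) fun v => (norm_le_frob _).trans ?_
  have h : ∀ j, ‖B v (stdVec j)‖ ^ 2 ≤ ‖v‖ ^ 2 * ∑ i, ‖B (stdVec i) (stdVec j)‖ ^ 2 := fun j => by
    have h1 : B v (stdVec j) = ∑ i, v i • B (stdVec i) (stdVec j) := by
      conv_lhs => rw [sum_smul_stdVec v]
      simp
    have h2 := norm_sum_smul_le v fun i => B (stdVec i) (stdVec j)
    rw [← h1] at h2
    calc _ ≤ (‖v‖ * √(∑ i, ‖B (stdVec i) (stdVec j)‖ ^ 2)) ^ 2 := by gcongr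
      _ = _ := by rw [mul_pow, Real.sq_sqrt (Finset.sum_nonneg fun i _ => by positivity)]
  rw [frob, frob₂, mul_comm, ← Real.sqrt_sq (norm_nonneg v),
    ← Real.sqrt_mul (by positivity), Finset.sum_comm, Finset.mul_sum]
  exact Real.sqrt_le_sqrt (Finset.sum_le_sum fun j _ => h j)

/-- First order and Lipschitz bounds on the derivatives of the activation function. -/
structure ActivationBound {d k : ℕ} (f : Euc d → Euc k → Euc d) (C : ℝ) : Prop where
  nonneg : 0 ≤ C
  contDiff : ContDiff ℝ 2 (Function.uncurry f)
  norm_fderiv_left : ∀ x θ, ‖fderiv ℝ (fun x' => f x' θ) x‖ ≤ C * ‖θ‖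
  norm_fderiv_right : ∀ x θ, ‖fderiv ℝ (f x) θ‖ ≤ C * (‖x‖ + 1)
  fderiv_left_sub_left : ∀ x x' θ,
    ‖fderiv ℝ (fun z => f z θ) x - fderiv ℝ (fun z => f z θ) x'‖ ≤ C * ‖θ‖ ^ 2 * ‖x - x'‖
  fderiv_left_sub_right : ∀ x θ θ',
    ‖fderiv ℝ (fun z => f z θ) x - fderiv ℝ (fun z => f z θ') x‖ ≤
      C * (‖x‖ + 1) * (‖θ‖ + ‖θ'‖) * ‖θ - θ'‖
  fderiv_right_sub_left : ∀ x x' θ,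
    ‖fderiv ℝ (f x) θ - fderiv ℝ (f x') θ‖ ≤ C * ‖θ‖ * (‖x‖ + ‖x'‖ + 1) * ‖x - x'‖
  fderiv_right_sub_right : ∀ x θ θ',
    ‖fderiv ℝ (f x) θ - fderiv ℝ (f x) θ'‖ ≤ C * (‖x‖ + 1) ^ 2 * ‖θ - θ'‖

section

variable {d k : ℕ} {f : Euc d → Euc k → Euc d}

theorem contDiff_left (hf : ContDiff ℝ 2 (Function.uncurry f)) (θ : Euc k) :
    ContDiff ℝ 2 fun x => f x θ :=
  hf.comp (contDiff_id.prodMk contDiff_const)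

theorem contDiff_right (hf : ContDiff ℝ 2 (Function.uncurry f)) (x : Euc d) :
    ContDiff ℝ 2 (f x) :=
  hf.comp (contDiff_const.prodMk contDiff_id)

theorem contDiff_fderiv_left (hf : ContDiff ℝ 2 (Function.uncurry f)) :
    ContDiff ℝ 1 fun p : Euc d × Euc k => fderiv ℝ (fun x => f x p.2) p.1 :=
  ContDiff.fderiv (f := fun (p : Euc d × Euc k) x => f x p.2) (m := 2)
    (hf.comp (contDiff_snd.prodMk (contDiff_snd.comp contDiff_fst))) contDiff_fst (by norm_num)

theorem contDiff_fderiv_right (hf : ContDiff ℝ 2 (Function.uncurry f)) :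
    ContDiff ℝ 1 fun p : Euc d × Euc k => fderiv ℝ (f p.1) p.2 :=
  ContDiff.fderiv (f := fun (p : Euc d × Euc k) θ => f p.1 θ) (m := 2)
    (hf.comp ((contDiff_fst.comp contDiff_fst).prodMk contDiff_snd)) contDiff_snd (by norm_num)

/-- Most bounds are mean value inequalities along segments. Bounding the change of `∂ₓf` in `θ`
would call for `∂_θ∂ₓf`, while the assumption concerns `∂ₓ∂_θf`. Symmetry of second derivatives is
avoided by differencing `f` in both variables. -/
theorem StandingAssumption.exists_activationBound {g y : Euc d → ℝ} {μ : Measure (Euc d)}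
    (h : StandingAssumption f g y μ) : ∃ C, ActivationBound f C := by
  have hf := h.contDiff_f
  obtain ⟨C₁, hC₁⟩ := h.deriv_bound
  set C := |C₁| with hC
  have hC0 : 0 ≤ C := abs_nonneg _
  have hle : C₁ ≤ C := le_abs_self _
  have b1 : ∀ x θ, ‖fderiv ℝ (fun x' => f x' θ) x‖ ≤ C * ‖θ‖ := fun x θ =>
    (norm_le_frob _).trans ((hC₁ x θ).1.trans (by gcongr))
  have b2 : ∀ x θ, ‖fderiv ℝ (f x) θ‖ ≤ C * (‖x‖ + 1) := fun x θ =>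
    (norm_le_frob _).trans ((hC₁ x θ).2.1.trans (by gcongr))
  have b3 : ∀ x θ, ‖fderiv ℝ (fun x' => fderiv ℝ (fun x'' => f x'' θ) x') x‖ ≤ C * ‖θ‖ ^ 2 :=
    fun x θ => (norm_le_frob₂ _).trans ((hC₁ x θ).2.2.1.trans (by gcongr))
  have b4 : ∀ x θ, ‖fderiv ℝ (fun x' => fderiv ℝ (fun θ' => f x' θ') θ) x‖ ≤
      C * ‖θ‖ * (‖x‖ + 1) :=
    fun x θ => (norm_le_frob₂ _).trans ((hC₁ x θ).2.2.2.1.trans (by gcongr))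
  have b5 : ∀ x θ, ‖fderiv ℝ (fun θ' => fderiv ℝ (f x) θ') θ‖ ≤ C * (‖x‖ + 1) ^ 2 :=
    fun x θ => (norm_le_frob₂ _).trans ((hC₁ x θ).2.2.2.2.trans (by gcongr))
  have dl : ∀ θ, Differentiable ℝ fun x => f x θ := fun θ =>
    (contDiff_left hf θ).differentiable (by norm_num)
  have dr : ∀ x, Differentiable ℝ (f x) := fun x =>
    (contDiff_right hf x).differentiable (by norm_num)
  have dll : ∀ θ, Differentiable ℝ fun x => fderiv ℝ (fun x' => f x' θ) x := fun θ =>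
    ((contDiff_fderiv_left hf).comp (contDiff_id.prodMk contDiff_const)).differentiable
      (by norm_num)
  have dlr : ∀ θ, Differentiable ℝ fun x => fderiv ℝ (f x) θ := fun θ =>
    ((contDiff_fderiv_right hf).comp (contDiff_id.prodMk contDiff_const)).differentiable
      (by norm_num)
  have drr : ∀ x, Differentiable ℝ fun θ => fderiv ℝ (f x) θ := fun x =>
    ((contDiff_fderiv_right hf).comp (contDiff_const.prodMk contDiff_id)).differentiable
      (by norm_num)
  have c4 : ∀ x x' θ, ‖fderiv ℝ (f x) θ - fderiv ℝ (f x') θ‖ ≤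
      C * ‖θ‖ * (‖x‖ + ‖x'‖ + 1) * ‖x - x'‖ := fun x x' θ => by
    refine Convex.norm_image_sub_le_of_norm_fderiv_le (𝕜 := ℝ) (f := fun x => fderiv ℝ (f x) θ)
      (fun z _ => dlr θ z) (fun z hz => (b4 z θ).trans ?_)
      (convex_closedBall (0 : Euc d) (‖x‖ + ‖x'‖)) (by simp) (by simp)
    have : ‖z‖ ≤ ‖x‖ + ‖x'‖ := by simpa using hz
    gcongr
  refine ⟨2 * C, by positivity, hf, fun x θ => (b1 x θ).trans ?_, fun x θ => (b2 x θ).trans ?_,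
    fun x x' θ => ?_, fun x θ θ' => ?_, fun x x' θ => (c4 x x' θ).trans ?_, fun x θ θ' => ?_⟩
  · gcongr; linarith
  · gcongr; linarith
  · refine (convex_univ.norm_image_sub_le_of_norm_fderiv_le (𝕜 := ℝ) (C := C * ‖θ‖ ^ 2)
      (f := fun x => fderiv ℝ (fun x' => f x' θ) x)
      (fun z _ => dll θ z) (fun z _ => b3 z θ) (mem_univ x') (mem_univ x)).trans ?_
    gcongr; linarith
  -- The derivative at `x` is bounded by a local Lipschitz constant of `z ↦ f z θ - f z θ'`, and
  -- this constant comes from the mean value inequality in `θ` applied to `f z - f z'`. On the ball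
  -- of radius `1/2`, `‖z‖ + ‖z'‖ + 1 ≤ 2(‖x‖ + 1)`, the source of the factor `2`.
  · have hd : fderiv ℝ (fun z => f z θ) x - fderiv ℝ (fun z => f z θ') x =
        fderiv ℝ (fun z => f z θ - f z θ') x := (fderiv_fun_sub (dl θ x) (dl θ' x)).symm
    rw [hd]
    set L : ℝ := 2 * C * (‖x‖ + 1) * (‖θ‖ + ‖θ'‖) * ‖θ - θ'‖ with hL
    have hL0 : 0 ≤ L := by positivity
    have hlip : LipschitzOnWith ⟨L, hL0⟩ (fun z => f z θ - f z θ')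
        (Metric.ball x (1 / 2)) := by
      refine LipschitzOnWith.of_dist_le_mul fun z hz z' hz' => ?_
      rw [dist_eq_norm, dist_eq_norm]
      have hzn : ∀ z ∈ Metric.ball x (1 / 2 : ℝ), ‖z‖ ≤ ‖x‖ + 1 / 2 := fun z hz => by
        have h1 := norm_sub_norm_le z x
        have h2 : ‖z - x‖ < 1 / 2 := by simpa [dist_eq_norm] using hz
        linarith
      have e : f z θ - f z θ' - (f z' θ - f z' θ') = (f z θ - f z' θ) - (f z θ' - f z' θ') := by
        abel
      rw [e]
      have := Convex.norm_image_sub_le_of_norm_fderiv_le (𝕜 := ℝ)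
        (f := fun ϑ => f z ϑ - f z' ϑ) (C := C * (‖θ‖ + ‖θ'‖) * (2 * (‖x‖ + 1)) * ‖z - z'‖)
        (s := Metric.closedBall (0 : Euc k) (‖θ‖ + ‖θ'‖)) (x := θ') (y := θ)
        (fun ϑ _ => (dr z ϑ).sub (dr z' ϑ)) (fun ϑ hϑ => ?_)
        (convex_closedBall (0 : Euc k) (‖θ‖ + ‖θ'‖)) (by simp) (by simp)
      · refine this.trans (le_of_eq ?_)
        change _ = L * ‖z - z'‖
        rw [hL]; ring
      · have hn : ‖ϑ‖ ≤ ‖θ‖ + ‖θ'‖ := by simpa using hϑ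
        rw [fderiv_fun_sub (dr z ϑ) (dr z' ϑ)]
        refine (c4 z z' ϑ).trans ?_
        have := hzn z hz
        have := hzn z' hz'
        gcongr
        linarith
    exact norm_fderiv_le_of_lipschitzOn ℝ (Metric.ball_mem_nhds x (by norm_num)) hlip
  · gcongr; linarith
  · refine (convex_univ.norm_image_sub_le_of_norm_fderiv_le (𝕜 := ℝ) (C := C * (‖x‖ + 1) ^ 2)
      (f := fun θ => fderiv ℝ (f x) θ)
      (fun z _ => drr x z) (fun z _ => b5 x z) (mem_univ θ') (mem_univ θ)).trans ?_
    gcongr; linarith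

end

namespace ActivationBound

variable {d k : ℕ} {f : Euc d → Euc k → Euc d} {C : ℝ}

theorem differentiable_left (h : ActivationBound f C) (θ : Euc k) :
    Differentiable ℝ fun x => f x θ :=
  (contDiff_left h.contDiff θ).differentiable (by norm_num)

theorem differentiable_right (h : ActivationBound f C) (x : Euc d) : Differentiable ℝ (f x) :=
  (contDiff_right h.contDiff x).differentiable (by norm_num)

theorem sub_left (h : ActivationBound f C) (x x' : Euc d) (θ : Euc k) :
    ‖f x θ - f x' θ‖ ≤ C * ‖θ‖ * ‖x - x'‖ :=
  convex_univ.norm_image_sub_le_of_norm_fderiv_le (𝕜 := ℝ) (f := fun x => f x θ)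
    (fun z _ => h.differentiable_left θ z) (fun z _ => h.norm_fderiv_left z θ)
    (mem_univ x') (mem_univ x)

theorem sub_right (h : ActivationBound f C) (x : Euc d) (θ θ' : Euc k) :
    ‖f x θ - f x θ'‖ ≤ C * (‖x‖ + 1) * ‖θ - θ'‖ :=
  convex_univ.norm_image_sub_le_of_norm_fderiv_le (𝕜 := ℝ) (f := f x)
    (fun z _ => h.differentiable_right x z) (fun z _ => h.norm_fderiv_right x z)
    (mem_univ θ') (mem_univ θ)

/-- The bound on `∂ₓf` vanishes at `θ = 0`, so `f(·,0)` is constant and only the growth in `θ`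
remains. -/
theorem norm_le (h : ActivationBound f C) (x : Euc d) (θ : Euc k) :
    ‖f x θ‖ ≤ ‖f 0 0‖ + C * (‖x‖ + 1) * ‖θ‖ := by
  have h1 := h.sub_right x θ 0
  have h2 := h.sub_left x 0 0
  simp only [sub_zero, norm_zero, mul_zero, zero_mul] at h1 h2
  have h3 : f x 0 = f 0 0 := sub_eq_zero.1 (norm_le_zero_iff.1 h2)
  have h4 := norm_sub_norm_le (f x θ) (f x 0)
  rw [h3] at h4 h1
  linarith

theorem continuous (h : ActivationBound f C) : Continuous (Function.uncurry f) :=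
  h.contDiff.continuous

theorem continuous_right (h : ActivationBound f C) (x : Euc d) : Continuous (f x) :=
  (contDiff_right h.contDiff x).continuous

theorem continuous_fderiv_left (h : ActivationBound f C) (x : Euc d) :
    Continuous fun θ => fderiv ℝ (fun z => f z θ) x :=
  (contDiff_fderiv_left h.contDiff).continuous.comp (by fun_prop : Continuous fun θ => (x, θ))

theorem integrable (h : ActivationBound f C) {ρ : Measure (Euc k)} {M : ℝ}
    (hM : MomentBound ρ M) (x : Euc d) : Integrable (f x) ρ :=
  hM.integrable_of_le (h.continuous_right x) (c₀ := ‖f 0 0‖) (c₁ := C * (‖x‖ + 1)) (c₂ := 0)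
    fun θ => by simpa using h.norm_le x θ

theorem integrable_fderiv_left (h : ActivationBound f C) {ρ : Measure (Euc k)} {M : ℝ}
    (hM : MomentBound ρ M) (x : Euc d) : Integrable (fun θ => fderiv ℝ (fun z => f z θ) x) ρ :=
  hM.integrable_of_le (h.continuous_fderiv_left x) (c₀ := 0) (c₁ := C) (c₂ := 0)
    fun θ => by simpa using h.norm_fderiv_left x θ

theorem norm_integral_le (h : ActivationBound f C) {ρ : Measure (Euc k)} {M : ℝ}
    (hM : MomentBound ρ M) (x : Euc d) :
    ‖∫ θ, f x θ ∂ρ‖ ≤ ‖f 0 0‖ + C * (‖x‖ + 1) * M := by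
  have := hM.norm_integral_le (ψ := f x) (c₀ := ‖f 0 0‖) (c₁ := C * (‖x‖ + 1)) (c₂ := 0)
    (by have := h.nonneg; positivity) le_rfl fun θ => by simpa using h.norm_le x θ
  simpa using this

theorem norm_integral_fderiv_left_le (h : ActivationBound f C) {ρ : Measure (Euc k)} {M : ℝ}
    (hM : MomentBound ρ M) (x : Euc d) :
    ‖∫ θ, fderiv ℝ (fun z => f z θ) x ∂ρ‖ ≤ C * M := by
  have := hM.norm_integral_le (ψ := fun θ => fderiv ℝ (fun z => f z θ) x) (c₀ := 0) (c₁ := C)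
    (c₂ := 0) h.nonneg le_rfl fun θ => by simpa using h.norm_fderiv_left x θ
  simpa using this

theorem integral_sub_left (h : ActivationBound f C) {ρ : Measure (Euc k)} {M : ℝ}
    (hM : MomentBound ρ M) (x x' : Euc d) :
    ‖∫ θ, f x θ ∂ρ - ∫ θ, f x' θ ∂ρ‖ ≤ C * M * ‖x - x'‖ := by
  rw [← integral_sub (h.integrable hM x) (h.integrable hM x')]
  have := hM.norm_integral_le (ψ := fun θ => f x θ - f x' θ) (c₀ := 0) (c₁ := C * ‖x - x'‖)
    (c₂ := 0) (by have := h.nonneg; positivity) le_rfl fun θ => by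
      have := h.sub_left x x' θ
      linarith
  linarith

theorem integral_fderiv_left_sub_left (h : ActivationBound f C) {ρ : Measure (Euc k)} {M : ℝ}
    (hM : MomentBound ρ M) (x x' : Euc d) :
    ‖∫ θ, fderiv ℝ (fun z => f z θ) x ∂ρ - ∫ θ, fderiv ℝ (fun z => f z θ) x' ∂ρ‖ ≤
      C * M ^ 2 * ‖x - x'‖ := by
  rw [← integral_sub (h.integrable_fderiv_left hM x) (h.integrable_fderiv_left hM x')]
  have := hM.norm_integral_le
    (ψ := fun θ => fderiv ℝ (fun z => f z θ) x - fderiv ℝ (fun z => f z θ) x') (c₀ := 0)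
    (c₁ := 0) (c₂ := C * ‖x - x'‖) le_rfl (by have := h.nonneg; positivity) fun θ => by
      have := h.fderiv_left_sub_left x x' θ
      linarith
  linarith

theorem integral_sub_measure (h : ActivationBound f C) {ρ ρ' : Measure (Euc k)} {M w : ℝ}
    (hM : MomentBound ρ M) (hM' : MomentBound ρ' M) (hW : W2Le ρ ρ' w) (hw : 0 < w)
    (x : Euc d) : ‖∫ θ, f x θ ∂ρ - ∫ θ, f x θ ∂ρ'‖ ≤ C * (‖x‖ + 1) * w := by
  have := norm_integral_sub_integral_le hM hM' hW hw (h.continuous_right x)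
    (A := C * (‖x‖ + 1)) (B := 0) (by have := h.nonneg; positivity) le_rfl fun θ θ' => by
      simpa using h.sub_right x θ θ'
  simpa using this

theorem integral_fderiv_left_sub_measure (h : ActivationBound f C) {ρ ρ' : Measure (Euc k)}
    {M w : ℝ} (hM : MomentBound ρ M) (hM' : MomentBound ρ' M) (hW : W2Le ρ ρ' w) (hw : 0 < w)
    (x : Euc d) :
    ‖∫ θ, fderiv ℝ (fun z => f z θ) x ∂ρ - ∫ θ, fderiv ℝ (fun z => f z θ) x ∂ρ'‖ ≤
      2 * C * (‖x‖ + 1) * M * w := by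
  have := norm_integral_sub_integral_le hM hM' hW hw (h.continuous_fderiv_left x)
    (A := 0) (B := C * (‖x‖ + 1)) le_rfl (by have := h.nonneg; positivity) fun θ θ' => by
      simpa using h.fderiv_left_sub_right x θ θ'
  linarith

end ActivationBound

/-! ### State and costate -/

theorem abs_sub_le_one {t t₀ : ℝ} (ht : t ∈ Icc (0 : ℝ) 1) (ht₀ : t₀ ∈ Icc (0 : ℝ) 1) :
    |t - t₀| ≤ 1 :=
  abs_le.2 ⟨by linarith [ht.1, ht₀.2], by linarith [ht.2, ht₀.1]⟩

/-- A continuous path of measures whose second moments are at most `M ^ 2`. -/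
structure BddPath {k : ℕ} (ρ : ℝ → Measure (Euc k)) (M : ℝ) : Prop where
  isPath : IsPath ρ
  moment : ∀ t ∈ Icc (0 : ℝ) 1, MomentBound (ρ t) M

theorem IsPath.exists_bddPath {k : ℕ} {ρ : ℝ → Measure (Euc k)} (h : IsPath ρ) :
    ∃ M, BddPath ρ M :=
  let ⟨M, hM⟩ := h.exists_momentBound
  ⟨M, h, hM⟩

theorem BddPath.pos {k : ℕ} {ρ : ℝ → Measure (Euc k)} {M : ℝ} (h : BddPath ρ M) : 0 < M :=
  (h.moment 0 (by simp)).pos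

/-- Transfers a Lipschitz bound in `W2` along a path to continuity in time. This makes the
right-hand sides of the state and costate equations continuous in `t`. -/
theorem IsPath.continuousOn_of_le {k : ℕ} {ρ : ℝ → Measure (Euc k)} (h : IsPath ρ)
    {G : Type*} [NormedAddCommGroup G] {φ : ℝ → G} {A : ℝ}
    (hφ : ∀ t ∈ Icc (0 : ℝ) 1, ∀ t₀ ∈ Icc (0 : ℝ) 1, ∀ w, 0 < w → W2Le (ρ t) (ρ t₀) w →
      ‖φ t - φ t₀‖ ≤ A * w) : ContinuousOn φ (Icc 0 1) := by
  intro t₀ ht₀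
  rw [ContinuousWithinAt, Metric.tendsto_nhds]
  intro ε hε
  have hw : 0 < ε / (|A| + 1) := by positivity
  have h1 := (h.2 t₀ ht₀).eventually_lt_const (u := ENNReal.ofReal (ε / (|A| + 1))) (by simpa)
  filter_upwards [h1, self_mem_nhdsWithin] with t ht htI
  rw [dist_eq_norm]
  refine (hφ t htI t₀ ht₀ _ hw (W2Le.of_W2_lt ht).2).trans_lt ?_
  calc A * (ε / (|A| + 1)) ≤ |A| * (ε / (|A| + 1)) := by gcongr; exact le_abs_self A
    _ < ε := by rw [← mul_div_assoc, div_lt_iff₀ (by positivity)]; nlinarith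

section

variable {d k : ℕ} {f : Euc d → Euc k → Euc d} {C : ℝ} {ρ ρ' : ℝ → Measure (Euc k)} {M : ℝ}

theorem ActivationBound.continuousOn_integral (h : ActivationBound f C) (hρ : BddPath ρ M)
    (z : Euc d) : ContinuousOn (fun t => ∫ θ, f z θ ∂(ρ t)) (Icc 0 1) :=
  hρ.isPath.continuousOn_of_le fun t ht t₀ ht₀ _ hw hW =>
    h.integral_sub_measure (hρ.moment t ht) (hρ.moment t₀ ht₀) hW hw z

theorem ActivationBound.continuousOn_integral_fderiv_left (h : ActivationBound f C)
    (hρ : BddPath ρ M) {z : ℝ → Euc d} (hz : ContinuousOn z (Icc 0 1)) :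
    ContinuousOn (fun t => ∫ θ, fderiv ℝ (fun x => f x θ) (z t) ∂(ρ t)) (Icc 0 1) := by
  have h1 : ∀ x, ContinuousOn (fun t => ∫ θ, fderiv ℝ (fun x => f x θ) x ∂(ρ t)) (Icc 0 1) :=
    fun x => hρ.isPath.continuousOn_of_le fun t ht t₀ ht₀ _ hw hW =>
      h.integral_fderiv_left_sub_measure (hρ.moment t ht) (hρ.moment t₀ ht₀) hW hw x
  have hC : 0 ≤ C * M ^ 2 := by have := h.nonneg; positivity
  have h2 := continuousOn_prod_of_continuousOn_lipschitzOnWith'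
    (fun p : ℝ × Euc d => ∫ θ, fderiv ℝ (fun x => f x θ) p.2 ∂(ρ p.1))
    (s := Icc (0 : ℝ) 1) (t := univ) ⟨C * M ^ 2, hC⟩
    (fun t ht => LipschitzOnWith.of_dist_le_mul fun x _ x' _ => by
      rw [dist_eq_norm, dist_eq_norm]
      exact h.integral_fderiv_left_sub_left (hρ.moment t ht) x x')
    (fun x _ => h1 x)
  exact h2.comp (continuousOn_id.prodMk hz) fun t ht => ⟨ht, mem_univ _⟩

/-- The averaged field is globally Lipschitz with constant `C * M`, so a solution exists and the
choice made in `state` is a genuine one. -/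
theorem ActivationBound.isState_state (h : ActivationBound f C) (hρ : BddPath ρ M) (x : Euc d) :
    IsState f ρ x (state f ρ x) := by
  have hCM : 0 ≤ C * M := mul_nonneg h.nonneg hρ.pos.le
  obtain ⟨z, hz⟩ := exists_ode_solution (F := fun t z => ∫ θ, f z θ ∂(ρ t)) hCM
    (fun t ht x y => h.integral_sub_left (hρ.moment t ht) x y)
    (fun x => h.continuousOn_integral hρ x) (t₀ := 0) (by simp) x
  exact Classical.epsilon_spec (p := IsState f ρ x) ⟨z, hz⟩

theorem ActivationBound.continuousOn_state (h : ActivationBound f C) (hρ : BddPath ρ M)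
    (x : Euc d) : ContinuousOn (state f ρ x) (Icc 0 1) := fun t ht =>
  ((h.isState_state hρ x).2 t ht).continuousWithinAt

/-- The equation is linear with coefficient of norm at most `C * M`, and it is solved from the final
time `t₀ = 1`. -/
theorem ActivationBound.isCostate_costate (h : ActivationBound f C) (g y : Euc d → ℝ)
    (hρ : BddPath ρ M) (x : Euc d) : IsCostate f g y ρ x (costate f g y ρ x) := by
  have hCM : 0 ≤ C * M := mul_nonneg h.nonneg hρ.pos.le
  have hG := h.continuousOn_integral_fderiv_left hρ (h.continuousOn_state hρ x)
  obtain ⟨p, hp⟩ := exists_ode_solution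
    (F := fun t p => -(ContinuousLinearMap.adjoint
      (∫ θ, fderiv ℝ (fun z => f z θ) (state f ρ x t) ∂(ρ t)) p)) hCM
    (fun t ht p q => by
      rw [← neg_sub_neg, neg_neg, neg_neg, ← map_sub, norm_sub_rev p q]
      refine (ContinuousLinearMap.le_opNorm _ _).trans ?_
      rw [LinearIsometryEquiv.norm_map]
      gcongr
      exact h.norm_integral_fderiv_left_le (hρ.moment t ht) _)
    (fun p => by
      have := (ContinuousLinearMap.adjoint (𝕜 := ℝ) (E := Euc d) (F := Euc d)).continuous
      exact ((this.comp_continuousOn hG).clm_apply continuousOn_const).neg)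
    (t₀ := 1) (by simp) ((g (state f ρ x 1) - y x) • gradient g (state f ρ x 1))
  exact Classical.epsilon_spec (p := IsCostate f g y ρ x) ⟨p, hp⟩

theorem ActivationBound.norm_state_le (h : ActivationBound f C) (hρ : BddPath ρ M) (x : Euc d)
    {t : ℝ} (ht : t ∈ Icc (0 : ℝ) 1) :
    ‖state f ρ x t‖ ≤ (‖x‖ + (‖f 0 0‖ + C * M)) * Real.exp (C * M) := by
  have hs := h.isState_state hρ x
  have hCM : 0 ≤ C * M := mul_nonneg h.nonneg hρ.pos.le
  have := norm_le_of_hasDerivWithinAt (ε := ‖f 0 0‖ + C * M) hCM (by positivity) hs.2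
    (fun t ht => (h.norm_integral_le (hρ.moment t ht) _).trans (by linarith))
    (t₀ := 0) (by simp) ht
  rw [hs.1, sub_zero, abs_of_nonneg ht.1] at this
  refine this.trans ?_
  have h0 := ht.1
  have h1 := ht.2
  calc (‖x‖ + (‖f 0 0‖ + C * M) * t) * Real.exp (C * M * t)
      ≤ (‖x‖ + (‖f 0 0‖ + C * M) * 1) * Real.exp (C * M * 1) := by gcongr
    _ = _ := by rw [mul_one, mul_one]

/-- The reference time `t₀` may lie on either side of `t`. Taken after `t`, it gives backward
uniqueness, hence injectivity of `x ↦ Z(t₀;x)`. -/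
theorem ActivationBound.norm_state_sub_le (h : ActivationBound f C) (hρ : BddPath ρ M)
    (x x' : Euc d) {t t₀ : ℝ} (ht : t ∈ Icc (0 : ℝ) 1) (ht₀ : t₀ ∈ Icc (0 : ℝ) 1) :
    ‖state f ρ x t - state f ρ x' t‖ ≤
      ‖state f ρ x t₀ - state f ρ x' t₀‖ * Real.exp (C * M) := by
  have hs := h.isState_state hρ x
  have hs' := h.isState_state hρ x'
  have hCM : 0 ≤ C * M := mul_nonneg h.nonneg hρ.pos.le
  have := norm_le_of_hasDerivWithinAt (ε := 0) (u := fun t => state f ρ x t - state f ρ x' t)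
    hCM le_rfl (fun t ht => (hs.2 t ht).sub (hs'.2 t ht))
    (fun t ht => (h.integral_sub_left (hρ.moment t ht) _ _).trans (by simp)) ht₀ ht
  rw [zero_mul, add_zero] at this
  refine this.trans ?_
  exact mul_le_mul_of_nonneg_left
    (Real.exp_le_exp.2 (mul_le_of_le_one_right hCM (abs_sub_le_one ht ht₀))) (norm_nonneg _)

/-- Grönwall for a linear equation in both time directions: a costate that vanishes at one time
vanishes at all times. -/
theorem ActivationBound.norm_costate_le (h : ActivationBound f C) (g y : Euc d → ℝ)
    (hρ : BddPath ρ M) (x : Euc d) {t t₀ : ℝ} (ht : t ∈ Icc (0 : ℝ) 1)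
    (ht₀ : t₀ ∈ Icc (0 : ℝ) 1) :
    ‖costate f g y ρ x t‖ ≤ ‖costate f g y ρ x t₀‖ * Real.exp (C * M) := by
  have hs := h.isCostate_costate g y hρ x
  have hCM : 0 ≤ C * M := mul_nonneg h.nonneg hρ.pos.le
  have := norm_le_of_hasDerivWithinAt (ε := 0) hCM le_rfl hs.2
    (fun t ht => by
      rw [norm_neg, add_zero]
      refine (ContinuousLinearMap.le_opNorm _ _).trans ?_
      rw [LinearIsometryEquiv.norm_map]
      gcongr
      exact h.norm_integral_fderiv_left_le (hρ.moment t ht) _) ht₀ ht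
  rw [zero_mul, add_zero] at this
  refine this.trans ?_
  exact mul_le_mul_of_nonneg_left
    (Real.exp_le_exp.2 (mul_le_of_le_one_right hCM (abs_sub_le_one ht ht₀))) (norm_nonneg _)

/-- `L` bounds states and costates started in the ball of radius `R`, and their dependence on the
starting point and the path of measures. -/
structure StabilityBound (f : Euc d → Euc k → Euc d) (g y : Euc d → ℝ) (R M L : ℝ) : Prop where
  nonneg : 0 ≤ L
  norm_state : ∀ ρ, BddPath ρ M → ∀ x, ‖x‖ ≤ R → ∀ t ∈ Icc (0 : ℝ) 1, ‖state f ρ x t‖ ≤ L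
  norm_costate : ∀ ρ, BddPath ρ M → ∀ x, ‖x‖ ≤ R → ∀ t ∈ Icc (0 : ℝ) 1,
    ‖costate f g y ρ x t‖ ≤ L
  abs_sub : ∀ ρ, BddPath ρ M → ∀ x, ‖x‖ ≤ R → |g (state f ρ x 1) - y x| ≤ L
  state_sub : ∀ ρ ρ', BddPath ρ M → BddPath ρ' M → ∀ w, 0 < w →
    (∀ t ∈ Icc (0 : ℝ) 1, W2Le (ρ t) (ρ' t) w) → ∀ x x', ‖x‖ ≤ R → ‖x'‖ ≤ R →
    ∀ t ∈ Icc (0 : ℝ) 1, ‖state f ρ x t - state f ρ' x' t‖ ≤ L * (‖x - x'‖ + w)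
  costate_sub : ∀ ρ ρ', BddPath ρ M → BddPath ρ' M → ∀ w, 0 < w →
    (∀ t ∈ Icc (0 : ℝ) 1, W2Le (ρ t) (ρ' t) w) → ∀ x x', ‖x‖ ≤ R → ‖x'‖ ≤ R →
    ∀ t ∈ Icc (0 : ℝ) 1, ‖costate f g y ρ x t - costate f g y ρ' x' t‖ ≤ L * (‖x - x'‖ + w)
  abs_sub_sub : ∀ ρ ρ', BddPath ρ M → BddPath ρ' M → ∀ w, 0 < w →
    (∀ t ∈ Icc (0 : ℝ) 1, W2Le (ρ t) (ρ' t) w) → ∀ x x', ‖x‖ ≤ R → ‖x'‖ ≤ R →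
    |(g (state f ρ x 1) - y x) - (g (state f ρ' x' 1) - y x')| ≤ L * (‖x - x'‖ + w)

theorem ActivationBound.exists_state_sub (h : ActivationBound f C) {R M : ℝ}
    {B : ℝ} (hB0 : 0 ≤ B)
    (hB : ∀ ρ, BddPath ρ M → ∀ x, ‖x‖ ≤ R → ∀ t ∈ Icc (0 : ℝ) 1, ‖state f ρ x t‖ ≤ B) :
    ∃ L, 0 ≤ L ∧ ∀ ρ ρ', BddPath ρ M → BddPath ρ' M → ∀ w, 0 < w →
    (∀ t ∈ Icc (0 : ℝ) 1, W2Le (ρ t) (ρ' t) w) → ∀ x x', ‖x‖ ≤ R → ‖x'‖ ≤ R →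
    ∀ t ∈ Icc (0 : ℝ) 1, ‖state f ρ x t - state f ρ' x' t‖ ≤ L * (‖x - x'‖ + w) := by
  have hC := h.nonneg
  refine ⟨(1 + C * (B + 1)) * Real.exp (C * M), by positivity, ?_⟩
  intro ρ ρ' hρ hρ' w hw hW x x' hx hx' t ht
  have hs := h.isState_state hρ x
  have hs' := h.isState_state hρ' x'
  have hCM : 0 ≤ C * M := mul_nonneg h.nonneg hρ.pos.le
  -- The two fields differ by a Lipschitz term in the state and by the effect of changing the
  -- measure, at most `C (B + 1) w`. The latter is the Grönwall source.
  have := norm_le_of_hasDerivWithinAt (ε := C * (B + 1) * w)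
    (u := fun t => state f ρ x t - state f ρ' x' t)
    hCM (by positivity) (fun t ht => (hs.2 t ht).sub (hs'.2 t ht))
    (fun t ht => ?_) (t₀ := 0) (by simp) ht
  · rw [hs.1, hs'.1, sub_zero, abs_of_nonneg ht.1] at this
    refine this.trans ?_
    calc (‖x - x'‖ + C * (B + 1) * w * t) * Real.exp (C * M * t)
        ≤ (‖x - x'‖ + C * (B + 1) * w * 1) * Real.exp (C * M * 1) := by
          have := ht.1
          gcongr
          exacts [ht.2, ht.2]
      _ ≤ ((1 + C * (B + 1)) * (‖x - x'‖ + w)) * Real.exp (C * M * 1) := by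
          gcongr
          have : 0 ≤ C * (B + 1) * ‖x - x'‖ := by positivity
          linarith
      _ = _ := by simp only [mul_one]; ring
  · have h1 := h.integral_sub_left (hρ.moment t ht) (state f ρ x t) (state f ρ' x' t)
    have h2 := h.integral_sub_measure (hρ.moment t ht) (hρ'.moment t ht) (hW t ht) hw
      (state f ρ' x' t)
    refine (norm_sub_le_norm_sub_add_norm_sub _ (∫ θ, f (state f ρ' x' t) θ ∂(ρ t)) _).trans ?_
    refine add_le_add h1 (h2.trans ?_)
    have := hB ρ' hρ' x' hx' t ht
    gcongr

theorem ActivationBound.exists_costate_sub (h : ActivationBound f C) {g y : Euc d → ℝ} {R M : ℝ}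
    {B P L : ℝ} (hB0 : 0 ≤ B) (hP0 : 0 ≤ P) (hL0 : 0 ≤ L)
    (hB : ∀ ρ, BddPath ρ M → ∀ x, ‖x‖ ≤ R → ∀ t ∈ Icc (0 : ℝ) 1, ‖state f ρ x t‖ ≤ B)
    (hP : ∀ ρ, BddPath ρ M → ∀ x, ‖x‖ ≤ R → ∀ t ∈ Icc (0 : ℝ) 1, ‖costate f g y ρ x t‖ ≤ P)
    (hL : ∀ ρ ρ', BddPath ρ M → BddPath ρ' M → ∀ w, 0 < w →
      (∀ t ∈ Icc (0 : ℝ) 1, W2Le (ρ t) (ρ' t) w) → ∀ x x', ‖x‖ ≤ R → ‖x'‖ ≤ R →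
      ∀ t ∈ Icc (0 : ℝ) 1, ‖state f ρ x t - state f ρ' x' t‖ ≤ L * (‖x - x'‖ + w))
    (hL1 : ∀ ρ ρ', BddPath ρ M → BddPath ρ' M → ∀ w, 0 < w →
      (∀ t ∈ Icc (0 : ℝ) 1, W2Le (ρ t) (ρ' t) w) → ∀ x x', ‖x‖ ≤ R → ‖x'‖ ≤ R →
      ‖costate f g y ρ x 1 - costate f g y ρ' x' 1‖ ≤ L * (‖x - x'‖ + w)) :
    ∃ L', 0 ≤ L' ∧ ∀ ρ ρ', BddPath ρ M → BddPath ρ' M → ∀ w, 0 < w →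
    (∀ t ∈ Icc (0 : ℝ) 1, W2Le (ρ t) (ρ' t) w) → ∀ x x', ‖x‖ ≤ R → ‖x'‖ ≤ R →
    ∀ t ∈ Icc (0 : ℝ) 1, ‖costate f g y ρ x t - costate f g y ρ' x' t‖ ≤
      L' * (‖x - x'‖ + w) := by
  have hC := h.nonneg
  -- A moment bound is positive by definition, so for `M ≤ 0` there is no path to consider.
  rcases le_or_gt M 0 with hM | hM
  · exact ⟨0, le_rfl, fun ρ ρ' hρ => absurd hρ.pos hM.not_gt⟩
  refine ⟨(L + (C * M ^ 2 * L + 2 * C * (B + 1) * M) * P) * Real.exp (C * M), by positivity, ?_⟩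
  intro ρ ρ' hρ hρ' w hw hW x x' hx hx' t ht
  have hs := h.isCostate_costate g y hρ x
  have hs' := h.isCostate_costate g y hρ' x'
  set Q := ‖x - x'‖ + w with hQ
  have hQ0 : 0 ≤ Q := by positivity
  set c := (C * M ^ 2 * L + 2 * C * (B + 1) * M) * P with hc
  have hc0 : 0 ≤ c := by positivity
  have := norm_le_of_hasDerivWithinAt (ε := c * Q) (K := C * M)
    (u := fun t => costate f g y ρ x t - costate f g y ρ' x' t)
    (by positivity) (by positivity) (fun t ht => (hs.2 t ht).sub (hs'.2 t ht))
    (fun t ht => ?_) (t₀ := 1) (by simp) ht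
  · refine this.trans ?_
    have h1 := hL1 ρ ρ' hρ hρ' w hw hW x x' hx hx'
    have ht1 : |t - 1| ≤ 1 := abs_le.2 ⟨by linarith [ht.1], by linarith [ht.2]⟩
    calc _ ≤ (L * Q + c * Q * 1) * Real.exp (C * M * 1) := by gcongr
      _ = _ := by simp only [mul_one]; ring
  · set G := ∫ θ, fderiv ℝ (fun z => f z θ) (state f ρ x t) ∂(ρ t) with hG
    set G' := ∫ θ, fderiv ℝ (fun z => f z θ) (state f ρ' x' t) ∂(ρ' t) with hG'
    -- The first part is the homogeneous term for the difference of costates. The second is a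
    -- source, small because `G` depends in a Lipschitz way on state and measure.
    have e : -(ContinuousLinearMap.adjoint G (costate f g y ρ x t)) -
        -(ContinuousLinearMap.adjoint G' (costate f g y ρ' x' t)) =
        -(ContinuousLinearMap.adjoint G (costate f g y ρ x t - costate f g y ρ' x' t)) -
        ContinuousLinearMap.adjoint (G - G') (costate f g y ρ' x' t) := by
      simp only [map_sub, _root_.sub_apply]; abel
    have hGn : ‖G‖ ≤ C * M := h.norm_integral_fderiv_left_le (hρ.moment t ht) _
    have hGG : ‖G - G'‖ ≤ (C * M ^ 2 * L + 2 * C * (B + 1) * M) * Q := by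
      have h1 := h.integral_fderiv_left_sub_left (hρ.moment t ht) (state f ρ x t)
        (state f ρ' x' t)
      have h2 := h.integral_fderiv_left_sub_measure (hρ.moment t ht) (hρ'.moment t ht) (hW t ht)
        hw (state f ρ' x' t)
      have h3 := hL ρ ρ' hρ hρ' w hw hW x x' hx hx' t ht
      have h4 := hB ρ' hρ' x' hx' t ht
      have h5 : w ≤ Q := by rw [hQ]; linarith [norm_nonneg (x - x')]
      calc ‖G - G'‖ ≤ C * M ^ 2 * ‖state f ρ x t - state f ρ' x' t‖ +
            2 * C * (‖state f ρ' x' t‖ + 1) * M * w :=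
            (norm_sub_le_norm_sub_add_norm_sub _
              (∫ θ, fderiv ℝ (fun z => f z θ) (state f ρ' x' t) ∂(ρ t)) _).trans (add_le_add h1 h2)
        _ ≤ C * M ^ 2 * (L * Q) + 2 * C * (B + 1) * M * Q := by gcongr
        _ = _ := by ring
    rw [e]
    refine (norm_sub_le _ _).trans ?_
    rw [norm_neg]
    refine add_le_add ((ContinuousLinearMap.le_opNorm _ _).trans ?_)
      ((ContinuousLinearMap.le_opNorm _ _).trans ?_)
    · rw [LinearIsometryEquiv.norm_map]; gcongr
    · rw [LinearIsometryEquiv.norm_map]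
      have := hP ρ' hρ' x' hx' t ht
      calc _ ≤ ((C * M ^ 2 * L + 2 * C * (B + 1) * M) * Q) * P := by gcongr
        _ = _ := by rw [hc]; ring

theorem exists_lipschitz_on_ball {y : Euc d → ℝ} (hy : ContDiff ℝ 1 y) (R : ℝ) :
    ∃ K, 0 ≤ K ∧ (∀ x, ‖x‖ ≤ R → |y x| ≤ K) ∧
      ∀ x x', ‖x‖ ≤ R → ‖x'‖ ≤ R → |y x - y x'| ≤ K * ‖x - x'‖ := by
  obtain ⟨K₁, h₁⟩ := (isCompact_closedBall (0 : Euc d) R).exists_bound_of_continuousOn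
    hy.continuous.continuousOn
  obtain ⟨K₂, h₂⟩ := (isCompact_closedBall (0 : Euc d) R).exists_bound_of_continuousOn
    (hy.continuous_fderiv (by norm_num)).continuousOn
  refine ⟨max 0 (max K₁ K₂), le_max_left _ _, fun x hx => ?_, fun x x' hx hx' => ?_⟩
  · exact (h₁ x (by simpa using hx)).trans ((le_max_left _ _).trans (le_max_right _ _))
  · refine ((convex_closedBall (0 : Euc d) R).norm_image_sub_le_of_norm_fderiv_le (𝕜 := ℝ)
      (fun z _ => hy.differentiable (by norm_num) z) h₂ (by simpa using hx')
      (by simpa using hx)).trans ?_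
    gcongr
    exact (le_max_right _ _).trans (le_max_right _ _)

theorem norm_gradient_le_of_lipschitz {g : Euc d → ℝ} {K : ℝ≥0} (hg : LipschitzWith K g)
    (x : Euc d) : ‖gradient g x‖ ≤ K := by
  rw [gradient, LinearIsometryEquiv.norm_map]
  exact norm_fderiv_le_of_lipschitz ℝ hg

/-- Uniformity is the point: `L` depends on the path only through the moment bound `M`, which lets
the estimates be used along a whole flow and in the limit. -/
theorem StandingAssumption.exists_stabilityBound {g y : Euc d → ℝ} {μ : Measure (Euc d)}
    (hA : StandingAssumption f g y μ) (R M : ℝ) : ∃ L, StabilityBound f g y R M L := by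
  obtain ⟨C, h⟩ := hA.exists_activationBound
  obtain ⟨K, hK⟩ := hA.lipschitz_g
  obtain ⟨K', hK'⟩ := hA.lipschitz_grad_g
  obtain ⟨Y, hY0, hY, hYl⟩ := exists_lipschitz_on_ball (hA.contDiff_y.of_le (by norm_num)) R
  have hC := h.nonneg
  obtain ⟨B, hB0, hB⟩ : ∃ B, 0 ≤ B ∧ ∀ ρ, BddPath ρ M → ∀ x, ‖x‖ ≤ R → ∀ t ∈ Icc (0 : ℝ) 1,
      ‖state f ρ x t‖ ≤ B := by
    refine ⟨max 0 ((R + (‖f 0 0‖ + C * M)) * Real.exp (C * M)), le_max_left _ _,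
      fun ρ hρ x hx t ht => (h.norm_state_le hρ x ht).trans (le_trans ?_ (le_max_right _ _))⟩
    gcongr
  obtain ⟨L, hL0, hL⟩ := h.exists_state_sub hB0 hB
  have hres : ∀ ρ, BddPath ρ M → ∀ x, ‖x‖ ≤ R →
      |g (state f ρ x 1) - y x| ≤ |g 0| + K * B + Y := fun ρ hρ x hx => by
    have h1 := hK.dist_le_mul (state f ρ x 1) 0
    rw [Real.dist_eq, dist_zero_right] at h1
    have h2 := hB ρ hρ x hx 1 (by simp)
    have h3 : (K : ℝ) * ‖state f ρ x 1‖ ≤ K * B := by gcongr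
    have h4 := hY x hx
    rw [abs_le] at *
    have h5 := abs_le.1 (le_refl |g 0|)
    constructor <;> linarith
  set D := |g 0| + K * B + Y with hD
  have hD0 : 0 ≤ D := by positivity
  have hres2 : ∀ ρ ρ', BddPath ρ M → BddPath ρ' M → ∀ w, 0 < w →
      (∀ t ∈ Icc (0 : ℝ) 1, W2Le (ρ t) (ρ' t) w) → ∀ x x', ‖x‖ ≤ R → ‖x'‖ ≤ R →
      |(g (state f ρ x 1) - y x) - (g (state f ρ' x' 1) - y x')| ≤
        (K * L + Y) * (‖x - x'‖ + w) := by
    intro ρ ρ' hρ hρ' w hw hW x x' hx hx'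
    have h1 := hK.dist_le_mul (state f ρ x 1) (state f ρ' x' 1)
    rw [Real.dist_eq, dist_eq_norm] at h1
    have h2 := hL ρ ρ' hρ hρ' w hw hW x x' hx hx' 1 (by simp)
    have h3 := hYl x x' hx hx'
    have h4 : (K : ℝ) * ‖state f ρ x 1 - state f ρ' x' 1‖ ≤ K * (L * (‖x - x'‖ + w)) := by gcongr
    have h5 : Y * ‖x - x'‖ ≤ Y * (‖x - x'‖ + w) := by gcongr; linarith
    have h6 : (K * L + Y) * (‖x - x'‖ + w) =
      K * (L * (‖x - x'‖ + w)) + Y * (‖x - x'‖ + w) := by ring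
    rw [h6]
    rw [abs_le] at *
    constructor <;> linarith
  have hgrad := norm_gradient_le_of_lipschitz hK
  set P := D * K * Real.exp (C * M) with hP
  have hP0 : 0 ≤ P := by positivity
  have hcos : ∀ ρ, BddPath ρ M → ∀ x, ‖x‖ ≤ R → ∀ t ∈ Icc (0 : ℝ) 1,
      ‖costate f g y ρ x t‖ ≤ P := fun ρ hρ x hx t ht => by
    refine (h.norm_costate_le g y hρ x ht (t₀ := 1) (by simp)).trans ?_
    rw [(h.isCostate_costate g y hρ x).1, norm_smul, Real.norm_eq_abs]
    have := hres ρ hρ x hx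
    have := hgrad (state f ρ x 1)
    rw [hP]
    gcongr
  have hcos1 : ∀ ρ ρ', BddPath ρ M → BddPath ρ' M → ∀ w, 0 < w →
      (∀ t ∈ Icc (0 : ℝ) 1, W2Le (ρ t) (ρ' t) w) → ∀ x x', ‖x‖ ≤ R → ‖x'‖ ≤ R →
      ‖costate f g y ρ x 1 - costate f g y ρ' x' 1‖ ≤
        (L + ((K * L + Y) * K + D * (K' * L))) * (‖x - x'‖ + w) := by
    intro ρ ρ' hρ hρ' w hw hW x x' hx hx'
    rw [(h.isCostate_costate g y hρ x).1, (h.isCostate_costate g y hρ' x').1]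
    set Q := ‖x - x'‖ + w with hQ
    have hQ0 : 0 ≤ Q := by positivity
    set a := g (state f ρ x 1) - y x
    set a' := g (state f ρ' x' 1) - y x'
    set v := gradient g (state f ρ x 1)
    set v' := gradient g (state f ρ' x' 1)
    have e : ∀ (a a' : ℝ) (v v' : Euc d), a • v - a' • v' = (a - a') • v + a' • (v - v') := by
      intros; module
    have h1 : |a - a'| ≤ (K * L + Y) * Q := hres2 ρ ρ' hρ hρ' w hw hW x x' hx hx'
    have h2 : ‖v‖ ≤ K := hgrad _
    have h3 : |a'| ≤ D := hres ρ' hρ' x' hx'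
    have h4 : ‖v - v'‖ ≤ K' * (L * Q) := by
      have := hK'.dist_le_mul (state f ρ x 1) (state f ρ' x' 1)
      rw [dist_eq_norm, dist_eq_norm] at this
      refine this.trans ?_
      gcongr
      exact hL ρ ρ' hρ hρ' w hw hW x x' hx hx' 1 (by simp)
    rw [e]
    refine (norm_add_le _ _).trans ?_
    rw [norm_smul, norm_smul, Real.norm_eq_abs, Real.norm_eq_abs]
    calc |a - a'| * ‖v‖ + |a'| * ‖v - v'‖ ≤ ((K * L + Y) * Q) * K + D * (K' * (L * Q)) := by gcongr
      _ = ((K * L + Y) * K + D * (K' * L)) * Q := by ring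
      _ ≤ _ := mul_le_mul_of_nonneg_right (by linarith) hQ0
  -- One constant has to serve both for the states and for the final values of the costates.
  have hL2 : L ≤ L + ((K * L + Y) * K + D * (K' * L)) := by
    have : 0 ≤ (K * L + Y) * K + D * (K' * L) := by positivity
    linarith
  obtain ⟨L', hL'0, hL'⟩ := h.exists_costate_sub hB0 hP0 (hL0.trans hL2) hB hcos
    (fun ρ ρ' hρ hρ' w hw hW x x' hx hx' t ht =>
      (hL ρ ρ' hρ hρ' w hw hW x x' hx hx' t ht).trans (by gcongr)) hcos1
  have hKL : 0 ≤ K * L + Y := by positivity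
  set T := B + P + D + L + L' + (K * L + Y) with hT
  refine ⟨T, by positivity, fun ρ hρ x hx t ht => (hB ρ hρ x hx t ht).trans (by linarith),
    fun ρ hρ x hx t ht => (hcos ρ hρ x hx t ht).trans (by linarith),
    fun ρ hρ x hx => (hres ρ hρ x hx).trans (by linarith),
    fun ρ ρ' hρ hρ' w hw hW x x' hx hx' t ht =>
      (hL ρ ρ' hρ hρ' w hw hW x x' hx hx' t ht).trans ?_,
    fun ρ ρ' hρ hρ' w hw hW x x' hx hx' t ht =>
      (hL' ρ ρ' hρ hρ' w hw hW x x' hx hx' t ht).trans ?_,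
    fun ρ ρ' hρ hρ' w hw hW x x' hx hx' => (hres2 ρ ρ' hρ hρ' w hw hW x x' hx hx').trans ?_⟩
  all_goals
    gcongr
    linarith

end

/-! ### The variational derivative of the cost -/

section

variable {d k : ℕ} {f : Euc d → Euc k → Euc d} {g y : Euc d → ℝ} {μ : Measure (Euc d)}
  {ρ : ℝ → Measure (Euc k)} {R M L C : ℝ}

theorem StandingAssumption.exists_radius (hA : StandingAssumption f g y μ) :
    ∃ R, 0 < R ∧ ∀ᵐ x ∂μ, x ∈ Metric.closedBall (0 : Euc d) R := by
  obtain ⟨R, hR, h⟩ := hA.compact_μ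
  refine ⟨R, hR, ?_⟩
  rw [ae_iff]
  refine measure_mono_null (fun x hx => ?_) h
  change R ≤ ‖x‖
  by_contra hc
  exact hx (by simpa using (not_le.1 hc).le)

theorem aestronglyMeasurable_of_continuousOn {G : Type*} [NormedAddCommGroup G]
    {φ : Euc d → G} (hμ : ∀ᵐ x ∂μ, x ∈ Metric.closedBall (0 : Euc d) R)
    (hφ : ContinuousOn φ (Metric.closedBall 0 R)) : AEStronglyMeasurable φ μ := by
  rw [← Measure.restrict_eq_self_of_ae_mem hμ]
  exact hφ.aestronglyMeasurable_of_isCompact (isCompact_closedBall _ _)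
    Metric.isClosed_closedBall.measurableSet

/-- The stability bounds require `w > 0` even when both paths coincide. Letting `w → 0` recovers the
Lipschitz dependence on the starting point alone. -/
theorem continuousOn_of_forall_norm_sub_le {G : Type*} [NormedAddCommGroup G] {φ : Euc d → G}
    {L R : ℝ} (hL : 0 ≤ L) (h : ∀ x x', ‖x‖ ≤ R → ‖x'‖ ≤ R → ∀ w, 0 < w →
      ‖φ x - φ x'‖ ≤ L * (‖x - x'‖ + w)) : ContinuousOn φ (Metric.closedBall 0 R) := by
  have : LipschitzOnWith ⟨L, hL⟩ φ (Metric.closedBall 0 R) := by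
    refine LipschitzOnWith.of_dist_le_mul fun x hx x' hx' => ?_
    rw [dist_eq_norm, dist_eq_norm]
    have hlim : Tendsto (fun w : ℝ => L * (‖x - x'‖ + w)) (𝓝[>] 0) (𝓝 (L * ‖x - x'‖)) := by
      have : Continuous fun w : ℝ => L * (‖x - x'‖ + w) := by fun_prop
      have := this.tendsto 0
      rw [add_zero] at this
      exact this.mono_left nhdsWithin_le_nhds
    refine ge_of_tendsto hlim ?_
    filter_upwards [self_mem_nhdsWithin] with w hw
    exact h x x' (by simpa using hx) (by simpa using hx') w hw
  exact this.continuousOn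

namespace StabilityBound

theorem continuousOn_state (h : StabilityBound f g y R M L) (hρ : BddPath ρ M) {t : ℝ}
    (ht : t ∈ Icc (0 : ℝ) 1) :
    ContinuousOn (fun x => state f ρ x t) (Metric.closedBall 0 R) :=
  continuousOn_of_forall_norm_sub_le h.nonneg fun x x' hx hx' w hw =>
    h.state_sub ρ ρ hρ hρ w hw (fun _ _ => W2Le.refl _ _) x x' hx hx' t ht

theorem continuousOn_costate (h : StabilityBound f g y R M L) (hρ : BddPath ρ M) {t : ℝ}
    (ht : t ∈ Icc (0 : ℝ) 1) :
    ContinuousOn (fun x => costate f g y ρ x t) (Metric.closedBall 0 R) :=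
  continuousOn_of_forall_norm_sub_le h.nonneg fun x x' hx hx' w hw =>
    h.costate_sub ρ ρ hρ hρ w hw (fun _ _ => W2Le.refl _ _) x x' hx hx' t ht

end StabilityBound

/-- The derivative in `θ` of the integrand of `costVariation`. -/
noncomputable def integrandDeriv (f : Euc d → Euc k → Euc d) (g y : Euc d → ℝ)
    (ρ : ℝ → Measure (Euc k)) (t : ℝ) (θ : Euc k) (x : Euc d) : Euc k →L[ℝ] ℝ :=
  (innerSL ℝ (costate f g y ρ x t)).comp (fderiv ℝ (f (state f ρ x t)) θ)

theorem continuousOn_integrandDeriv (hf : ActivationBound f C)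
    (h : StabilityBound f g y R M L) (hρ : BddPath ρ M) {t : ℝ} (ht : t ∈ Icc (0 : ℝ) 1)
    (θ : Euc k) : ContinuousOn (integrandDeriv f g y ρ t θ) (Metric.closedBall 0 R) := by
  have h1 : ContinuousOn (fun x => innerSL ℝ (costate f g y ρ x t)) (Metric.closedBall 0 R) :=
    (innerSL ℝ).continuous.comp_continuousOn (h.continuousOn_costate hρ ht)
  have h2 : ContinuousOn (fun x => fderiv ℝ (f (state f ρ x t)) θ) (Metric.closedBall 0 R) :=
    (contDiff_fderiv_right hf.contDiff).continuous.comp_continuousOn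
      ((h.continuousOn_state hρ ht).prodMk continuousOn_const)
  exact h1.clm_comp h2

theorem norm_innerSL_comp_le (p : Euc d) (A : Euc k →L[ℝ] Euc d) :
    ‖(innerSL ℝ p).comp A‖ ≤ ‖p‖ * ‖A‖ := by
  refine (ContinuousLinearMap.opNorm_comp_le _ _).trans ?_
  rw [innerSL_apply_norm]

theorem norm_integrandDeriv_le (hf : ActivationBound f C)
    (h : StabilityBound f g y R M L) (hρ : BddPath ρ M) {t : ℝ} (ht : t ∈ Icc (0 : ℝ) 1)
    (θ : Euc k) {x : Euc d} (hx : ‖x‖ ≤ R) :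
    ‖integrandDeriv f g y ρ t θ x‖ ≤ L * (C * (L + 1)) := by
  refine (norm_innerSL_comp_le _ _).trans ?_
  have h1 := h.norm_costate ρ hρ x hx t ht
  have h2 := h.norm_state ρ hρ x hx t ht
  have h3 := hf.norm_fderiv_right (state f ρ x t) θ
  have := hf.nonneg
  have := h.nonneg
  have h4 : C * (‖state f ρ x t‖ + 1) ≤ C * (L + 1) := by gcongr
  exact mul_le_mul h1 (h3.trans h4) (norm_nonneg _) (by positivity)

theorem integrable_integrandDeriv [IsProbabilityMeasure μ] (hf : ActivationBound f C)
    (h : StabilityBound f g y R M L) (hμ : ∀ᵐ x ∂μ, x ∈ Metric.closedBall (0 : Euc d) R)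
    (hρ : BddPath ρ M) {t : ℝ} (ht : t ∈ Icc (0 : ℝ) 1)
    (θ : Euc k) : Integrable (integrandDeriv f g y ρ t θ) μ :=
  (integrable_const (L * (C * (L + 1)))).mono'
    (aestronglyMeasurable_of_continuousOn hμ (continuousOn_integrandDeriv hf h hρ ht θ))
    (hμ.mono fun _ hx => norm_integrandDeriv_le hf h hρ ht θ (by simpa using hx))

theorem continuousOn_integrand (hf : ActivationBound f C)
    (h : StabilityBound f g y R M L) (hρ : BddPath ρ M) {t : ℝ} (ht : t ∈ Icc (0 : ℝ) 1) :
    ContinuousOn (fun q : Euc d × Euc k =>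
      inner ℝ (costate f g y ρ q.1 t) (f (state f ρ q.1 t) q.2))
      (Metric.closedBall 0 R ×ˢ univ) := by
  have hm : MapsTo Prod.fst (Metric.closedBall (0 : Euc d) R ×ˢ (univ : Set (Euc k)))
    (Metric.closedBall 0 R) := fun q hq => hq.1
  refine ContinuousOn.inner ((h.continuousOn_costate hρ ht).comp continuousOn_fst hm) ?_
  exact hf.continuous.comp_continuousOn
    (((h.continuousOn_state hρ ht).comp continuousOn_fst hm).prodMk continuousOn_snd)

theorem abs_integrand_le (hf : ActivationBound f C)
    (h : StabilityBound f g y R M L) (hρ : BddPath ρ M) {t : ℝ} (ht : t ∈ Icc (0 : ℝ) 1)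
    (θ : Euc k) {x : Euc d} (hx : ‖x‖ ≤ R) :
    |inner ℝ (costate f g y ρ x t) (f (state f ρ x t) θ)| ≤
      L * (‖f 0 0‖ + C * (L + 1) * ‖θ‖) := by
  have h1 := h.norm_costate ρ hρ x hx t ht
  have h2 := h.norm_state ρ hρ x hx t ht
  have := hf.nonneg
  refine (abs_real_inner_le_norm _ _).trans
    (mul_le_mul h1 ((hf.norm_le _ θ).trans ?_) (norm_nonneg _) h.nonneg)
  gcongr

theorem continuousOn_integrand_left (hf : ActivationBound f C)
    (h : StabilityBound f g y R M L) (hρ : BddPath ρ M) {t : ℝ} (ht : t ∈ Icc (0 : ℝ) 1)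
    (θ : Euc k) :
    ContinuousOn (fun x => inner ℝ (costate f g y ρ x t) (f (state f ρ x t) θ))
      (Metric.closedBall 0 R) :=
  (continuousOn_integrand hf h hρ ht).comp
    (f := fun x : Euc d => (x, θ)) (by fun_prop) fun _ hx => ⟨hx, mem_univ _⟩

theorem integrable_integrand [IsProbabilityMeasure μ] (hf : ActivationBound f C)
    (h : StabilityBound f g y R M L) (hμ : ∀ᵐ x ∂μ, x ∈ Metric.closedBall (0 : Euc d) R)
    (hρ : BddPath ρ M) {t : ℝ} (ht : t ∈ Icc (0 : ℝ) 1) (θ : Euc k) :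
    Integrable (fun x => (inner ℝ (costate f g y ρ x t) (f (state f ρ x t) θ) : ℝ)) μ :=
  (integrable_const (L * (‖f 0 0‖ + C * (L + 1) * ‖θ‖))).mono'
    (aestronglyMeasurable_of_continuousOn hμ (continuousOn_integrand_left hf h hρ ht θ))
    (hμ.mono fun _ hx => abs_integrand_le hf h hρ ht θ (by simpa using hx))

theorem hasFDerivAt_costVariation [IsProbabilityMeasure μ] (hf : ActivationBound f C)
    (h : StabilityBound f g y R M L) (hμ : ∀ᵐ x ∂μ, x ∈ Metric.closedBall (0 : Euc d) R)
    (hρ : BddPath ρ M) {t : ℝ} (ht : t ∈ Icc (0 : ℝ) 1) (θ : Euc k) :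
    HasFDerivAt (costVariation f g y μ ρ t) (∫ x, integrandDeriv f g y ρ t θ x ∂μ) θ := by
  refine hasFDerivAt_integral_of_dominated_of_fderiv_le (𝕜 := ℝ) (s := univ)
    (F := fun θ x => (inner ℝ (costate f g y ρ x t) (f (state f ρ x t) θ) : ℝ))
    (F' := fun θ x => integrandDeriv f g y ρ t θ x) (bound := fun _ => L * (C * (L + 1)))
    univ_mem
    (Eventually.of_forall fun θ => (integrable_integrand hf h hμ hρ ht θ).aestronglyMeasurable)
    (integrable_integrand hf h hμ hρ ht θ)
    (integrable_integrandDeriv hf h hμ hρ ht θ).aestronglyMeasurable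
    (hμ.mono fun x hx θ _ => norm_integrandDeriv_le hf h hρ ht θ (by simpa using hx))
    (integrable_const _) (ae_of_all _ fun x θ _ => ?_)
  exact (innerSL ℝ (costate f g y ρ x t)).hasFDerivAt.comp θ
    (hf.differentiable_right (state f ρ x t) θ).hasFDerivAt

/-- `K` bounds the gradient of `δE/δρ`, its Lipschitz constant in `θ`, and its dependence on the
path of measures. -/
structure VariationBound (f : Euc d → Euc k → Euc d) (g y : Euc d → ℝ) (μ : Measure (Euc d))
    (M K : ℝ) : Prop where
  nonneg : 0 ≤ K
  differentiable : ∀ ρ, BddPath ρ M → ∀ t ∈ Icc (0 : ℝ) 1,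
    Differentiable ℝ (costVariation f g y μ ρ t)
  norm_gradient : ∀ ρ, BddPath ρ M → ∀ t ∈ Icc (0 : ℝ) 1, ∀ θ,
    ‖gradient (costVariation f g y μ ρ t) θ‖ ≤ K
  gradient_sub : ∀ ρ, BddPath ρ M → ∀ t ∈ Icc (0 : ℝ) 1, ∀ θ θ',
    ‖gradient (costVariation f g y μ ρ t) θ - gradient (costVariation f g y μ ρ t) θ'‖ ≤
      K * ‖θ - θ'‖
  gradient_sub_path : ∀ ρ ρ', BddPath ρ M → BddPath ρ' M → ∀ w, 0 < w →
    (∀ t ∈ Icc (0 : ℝ) 1, W2Le (ρ t) (ρ' t) w) → ∀ t ∈ Icc (0 : ℝ) 1, ∀ θ,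
    ‖gradient (costVariation f g y μ ρ t) θ - gradient (costVariation f g y μ ρ' t) θ‖ ≤
      K * (1 + ‖θ‖) * w

theorem norm_integral_sub_le_of_forall_le [IsProbabilityMeasure μ] {G : Type*}
    [NormedAddCommGroup G] [NormedSpace ℝ G] {φ φ' : Euc d → G} {B : ℝ}
    (hμ : ∀ᵐ x ∂μ, x ∈ Metric.closedBall (0 : Euc d) R) (hφ : Integrable φ μ)
    (hφ' : Integrable φ' μ) (hB : ∀ x, ‖x‖ ≤ R → ‖φ x - φ' x‖ ≤ B) :
    ‖∫ x, φ x ∂μ - ∫ x, φ' x ∂μ‖ ≤ B := by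
  rw [← integral_sub hφ hφ']
  have := norm_integral_le_of_norm_le_const (μ := μ) (f := fun x => φ x - φ' x) (C := B)
    (hμ.mono fun x hx => hB x (by simpa using hx))
  simpa using this

theorem StandingAssumption.exists_variationBound (hA : StandingAssumption f g y μ) (M : ℝ) :
    ∃ K, VariationBound f g y μ M K := by
  have := hA.prob_μ
  obtain ⟨C, hf⟩ := hA.exists_activationBound
  obtain ⟨R, hR, hμ⟩ := hA.exists_radius
  obtain ⟨L, h⟩ := hA.exists_stabilityBound R M
  have hC := hf.nonneg
  have hL := h.nonneg
  have hgrad : ∀ ρ, BddPath ρ M → ∀ t ∈ Icc (0 : ℝ) 1, ∀ θ,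
      gradient (costVariation f g y μ ρ t) θ =
        (InnerProductSpace.toDual ℝ (Euc k)).symm (∫ x, integrandDeriv f g y ρ t θ x ∂μ) :=
    fun ρ hρ t ht θ => by
      rw [gradient, (hasFDerivAt_costVariation hf h hμ hρ ht θ).fderiv]
  -- The three summands serve, in order, the size of the gradient, its Lipschitz constant in `θ`,
  -- and, together with the first, its dependence on the path.
  set K := L * (C * (L + 1)) + L * (C * (L + 1) ^ 2) + L * (C * (2 * L + 1) * L) with hK
  have e0 : 0 ≤ L * (C * (L + 1)) := by positivity
  have e1 : 0 ≤ L * (C * (L + 1) ^ 2) := by positivity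
  have e2 : 0 ≤ L * (C * (2 * L + 1) * L) := by positivity
  have k0 : L * (C * (L + 1)) ≤ K := by linarith
  have k1 : L * (C * (L + 1) ^ 2) ≤ K := by linarith
  refine ⟨K, by positivity,
    fun ρ hρ t ht θ => (hasFDerivAt_costVariation hf h hμ hρ ht θ).differentiableAt,
    fun ρ hρ t ht θ => ?_, fun ρ hρ t ht θ θ' => ?_, fun ρ ρ' hρ hρ' w hw hW t ht θ => ?_⟩
  · rw [hgrad ρ hρ t ht θ, LinearIsometryEquiv.norm_map]
    have := norm_integral_le_of_norm_le_const (hμ.mono fun x hx =>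
      norm_integrandDeriv_le hf h hρ ht θ (by simpa using hx))
    rw [probReal_univ, mul_one] at this
    exact this.trans k0
  · rw [hgrad ρ hρ t ht θ, hgrad ρ hρ t ht θ', ← map_sub, LinearIsometryEquiv.norm_map]
    refine (norm_integral_sub_le_of_forall_le hμ (integrable_integrandDeriv hf h hμ hρ ht θ)
      (integrable_integrandDeriv hf h hμ hρ ht θ')
      (B := L * (C * (L + 1) ^ 2) * ‖θ - θ'‖) fun x hx => ?_).trans (by gcongr)
    rw [integrandDeriv, integrandDeriv, ← ContinuousLinearMap.comp_sub]
    refine (norm_innerSL_comp_le _ _).trans ?_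
    have h1 := h.norm_costate ρ hρ x hx t ht
    have h2 := h.norm_state ρ hρ x hx t ht
    rw [mul_assoc]
    refine mul_le_mul h1 ((hf.fderiv_right_sub_right _ θ θ').trans ?_) (norm_nonneg _) hL
    gcongr
  · rw [hgrad ρ hρ t ht θ, hgrad ρ' hρ' t ht θ, ← map_sub, LinearIsometryEquiv.norm_map]
    refine norm_integral_sub_le_of_forall_le hμ (integrable_integrandDeriv hf h hμ hρ ht θ)
      (integrable_integrandDeriv hf h hμ hρ' ht θ) fun x hx => ?_
    set Z := state f ρ x t
    set Z' := state f ρ' x t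
    set p := costate f g y ρ x t
    set p' := costate f g y ρ' x t
    -- Changing first the costate and then the state. The second change brings in the mixed
    -- derivative of `f`, which grows like `‖θ‖`. This is the origin of the weight `1 + ‖θ‖`.
    have e : integrandDeriv f g y ρ t θ x - integrandDeriv f g y ρ' t θ x =
        (innerSL ℝ (p - p')).comp (fderiv ℝ (f Z) θ) +
        (innerSL ℝ p').comp (fderiv ℝ (f Z) θ - fderiv ℝ (f Z') θ) := by
      rw [ContinuousLinearMap.comp_sub, map_sub, ContinuousLinearMap.sub_comp]
      simp only [integrandDeriv]
      abel
    have hZ : ‖Z - Z'‖ ≤ L * w := by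
      simpa using h.state_sub ρ ρ' hρ hρ' w hw hW x x hx hx t ht
    have hp : ‖p - p'‖ ≤ L * w := by
      simpa using h.costate_sub ρ ρ' hρ hρ' w hw hW x x hx hx t ht
    have h1 : ‖p'‖ ≤ L := h.norm_costate ρ' hρ' x hx t ht
    have h2 : ‖Z‖ ≤ L := h.norm_state ρ hρ x hx t ht
    have h3 : ‖Z'‖ ≤ L := h.norm_state ρ' hρ' x hx t ht
    rw [e]
    refine (norm_add_le _ _).trans ((add_le_add (norm_innerSL_comp_le _ _)
      (norm_innerSL_comp_le _ _)).trans ?_)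
    have h4 := hf.norm_fderiv_right Z θ
    have h5 := hf.fderiv_right_sub_left Z Z' θ
    calc ‖p - p'‖ * ‖fderiv ℝ (f Z) θ‖ + ‖p'‖ * ‖fderiv ℝ (f Z) θ - fderiv ℝ (f Z') θ‖
        ≤ (L * w) * (C * (L + 1)) + L * (C * ‖θ‖ * (L + L + 1) * (L * w)) := by
          refine add_le_add (mul_le_mul hp (h4.trans ?_) (norm_nonneg _) (by positivity))
            (mul_le_mul h1 (h5.trans ?_) (norm_nonneg _) hL)
          · gcongr
          · gcongr
      _ = (L * (C * (L + 1)) + L * (C * (2 * L + 1) * L) * ‖θ‖) * w := by ring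
      _ ≤ (K + K * ‖θ‖) * w := by
          gcongr
          linarith
      _ = _ := by ring

theorem VariationBound.gradient_regCostVariation {K : ℝ} (h : VariationBound f g y μ M K)
    (hρ : BddPath ρ M) {t : ℝ} (ht : t ∈ Icc (0 : ℝ) 1) (s : ℝ) (θ : Euc k) :
    gradient (regCostVariation f g y μ s ρ t) θ =
      gradient (costVariation f g y μ ρ t) θ + (2 * Real.exp (-s)) • θ := by
  have h1 := (h.differentiable ρ hρ t ht θ).hasGradientAt
  have h2 : HasGradientAt (fun θ : Euc k => Real.exp (-s) * ‖θ‖ ^ 2) ((2 * Real.exp (-s)) • θ)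
      θ := by
    rw [hasGradientAt_iff_hasFDerivAt]
    have := ((hasStrictFDerivAt_norm_sq θ).hasFDerivAt).const_mul (Real.exp (-s))
    convert! this using 1
    ext v
    simp
    ring
  refine HasGradientAt.gradient ?_
  rw [hasGradientAt_iff_hasFDerivAt] at *
  rw [map_add]
  exact h1.add h2

end

/-! ### Mollification -/

section Mollify

open scoped Convolution

variable {k : ℕ} {G : Type*} [NormedAddCommGroup G] [NormedSpace ℝ G]

/-- Convolution with a normalized bump function. -/
noncomputable def mollify (η : ContDiffBump (0 : Euc k)) (g : Euc k → G) : Euc k → G :=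
  η.normed volume ⋆[ContinuousLinearMap.lsmul ℝ ℝ, volume] g

variable (η : ContDiffBump (0 : Euc k))

/-- A bump function supported in the ball of radius `ε`. -/
noncomputable def bumpOfRadius (k : ℕ) {ε : ℝ} (hε : 0 < ε) : ContDiffBump (0 : Euc k) :=
  ⟨ε / 2, ε, by positivity, by linarith⟩

theorem contDiff_mollify [CompleteSpace G] {g : Euc k → G} (hg : Continuous g) :
    ContDiff ℝ ((⊤ : ℕ∞) : WithTop ℕ∞) (mollify η g) :=
  HasCompactSupport.contDiff_convolution_left _ η.hasCompactSupport_normed η.contDiff_normed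
    hg.locallyIntegrable

theorem hasCompactSupport_mollify {g : Euc k → G} (hg : HasCompactSupport g) :
    HasCompactSupport (mollify η g) :=
  HasCompactSupport.convolution _ η.hasCompactSupport_normed hg

theorem norm_mollify_sub_le [CompleteSpace G] {g : Euc k → G} (hg : Continuous g) {x : Euc k}
    {c : ℝ} (h : ∀ x', ‖x' - x‖ < η.rOut → ‖g x' - g x‖ ≤ c) : ‖mollify η g x - g x‖ ≤ c := by
  have := η.dist_normed_convolution_le (μ := volume) (g := g) (x₀ := x) (ε := c)
    hg.aestronglyMeasurable fun x' hx' => by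
      rw [dist_eq_norm]; exact h x' (by simpa [dist_eq_norm] using hx')
  rwa [dist_eq_norm] at this

theorem integrable_normed_smul {g : Euc k → G} (hg : Continuous g) (x : Euc k) :
    Integrable (fun z => η.normed volume z • g (x - z)) volume :=
  (Continuous.smul η.continuous_normed (by fun_prop)).integrable_of_hasCompactSupport
    η.hasCompactSupport_normed.smul_right

/-- Both sides average against the same probability density, so it suffices to compare values at
equal shifts. Function and base point may change together. -/
theorem norm_mollify_sub_mollify_le {g g' : Euc k → G} (hg : Continuous g) (hg' : Continuous g')
    {x x' : Euc k} {c : ℝ} (h : ∀ z, ‖z‖ < η.rOut → ‖g (x - z) - g' (x' - z)‖ ≤ c) :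
    ‖mollify η g x - mollify η g' x'‖ ≤ c := by
  simp only [mollify, convolution_def, ContinuousLinearMap.lsmul_apply]
  rw [← integral_sub (integrable_normed_smul η hg x) (integrable_normed_smul η hg' x')]
  have hi : Integrable (fun z => η.normed volume z * c) volume :=
    η.integrable_normed.mul_const c
  refine (norm_integral_le_of_norm_le hi (ae_of_all _ fun z => ?_)).trans ?_
  · rw [← smul_sub, norm_smul, Real.norm_of_nonneg (η.nonneg_normed z)]
    by_cases hz : ‖z‖ < η.rOut
    · exact mul_le_mul_of_nonneg_left (h z hz) (η.nonneg_normed z)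
    · have : η.normed volume z = 0 := by
        rw [← Function.notMem_support, η.support_normed_eq]
        simpa using hz
      simp [this]
  · rw [integral_mul_const, η.integral_normed, one_mul]

theorem fderiv_mollify {g : Euc k → ℝ} (hg : ContDiff ℝ 1 g)
    (hc : HasCompactSupport g) (x : Euc k) :
    fderiv ℝ (mollify η g) x = mollify η (fderiv ℝ g) x := by
  have := HasCompactSupport.hasFDerivAt_convolution_right (ContinuousLinearMap.lsmul ℝ ℝ)
    (μ := volume) hc (η.continuous_normed (μ := volume)).locallyIntegrable hg x
  rw [mollify, this.fderiv]
  simp only [mollify, convolution_def]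
  congr 1

/-- Continuous compactly supported functions are uniform limits of test functions. -/
theorem exists_test_function_near {g : Euc k → ℝ} (hg : Continuous g) (hc : HasCompactSupport g)
    {ε : ℝ} (hε : 0 < ε) :
    ∃ h : Euc k → ℝ, ContDiff ℝ ((⊤ : ℕ∞) : WithTop ℕ∞) h ∧ HasCompactSupport h ∧
      ∀ x, |h x - g x| ≤ ε := by
  obtain ⟨δ, hδ, h⟩ := Metric.uniformContinuous_iff.1 (hc.uniformContinuous_of_continuous hg) ε hε
  refine ⟨mollify (bumpOfRadius k hδ) g, contDiff_mollify _ hg, hasCompactSupport_mollify _ hc,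
    fun x => norm_mollify_sub_le _ hg fun x' hx' => ?_⟩
  have := h (a := x') (b := x) (by rw [dist_eq_norm]; exact hx')
  rw [dist_eq_norm] at this
  exact this.le

/-- `C¹` compactly supported functions are limits of test functions in the `C¹` norm. -/
theorem exists_test_function_fderiv_near {g : Euc k → ℝ} (hg : ContDiff ℝ 1 g)
    (hc : HasCompactSupport g) {ε : ℝ} (hε : 0 < ε) :
    ∃ h : Euc k → ℝ, ContDiff ℝ ((⊤ : ℕ∞) : WithTop ℕ∞) h ∧ HasCompactSupport h ∧
      ∀ x, ‖fderiv ℝ h x - fderiv ℝ g x‖ ≤ ε := by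
  have hg' := hg.continuous_fderiv one_ne_zero
  obtain ⟨δ, hδ, h⟩ := Metric.uniformContinuous_iff.1
    ((hc.fderiv (𝕜 := ℝ)).uniformContinuous_of_continuous hg') ε hε
  refine ⟨mollify (bumpOfRadius k hδ) g, contDiff_mollify _ hg.continuous,
    hasCompactSupport_mollify _ hc, fun x => ?_⟩
  rw [fderiv_mollify _ hg hc]
  refine norm_mollify_sub_le _ hg' fun x' hx' => ?_
  have := h (a := x') (b := x) (by rw [dist_eq_norm]; exact hx')
  rw [dist_eq_norm] at this
  exact this.le

end Mollify

/-- Two finite measures giving the same integral to all test functions agree. -/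
theorem measure_ext_of_test_functions {k : ℕ} {ν ν' : Measure (Euc k)} [IsProbabilityMeasure ν]
    [IsProbabilityMeasure ν']
    (h : ∀ φ : Euc k → ℝ, ContDiff ℝ ((⊤ : ℕ∞) : WithTop ℕ∞) φ → HasCompactSupport φ →
      ∫ θ, φ θ ∂ν = ∫ θ, φ θ ∂ν') : ν = ν' := by
  refine Measure.ext_of_integral_eq_on_compactlySupported fun ψ => ?_
  refine eq_of_forall_dist_le fun ε hε => ?_
  obtain ⟨φ, hφ, hφc, hφψ⟩ := exists_test_function_near (g := ⇑ψ) ψ.continuous ψ.hasCompactSupport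
    (half_pos hε)
  have key : ∀ (κ : Measure (Euc k)) [IsProbabilityMeasure κ],
      |∫ θ, φ θ ∂κ - ∫ θ, ψ θ ∂κ| ≤ ε / 2 := fun κ _ => by
    rw [← integral_sub (g := ⇑ψ) (hφ.continuous.integrable_of_hasCompactSupport hφc)
      (ψ.continuous.integrable_of_hasCompactSupport ψ.hasCompactSupport)]
    have := norm_integral_le_of_norm_le_const (μ := κ) (f := fun x => φ x - ψ x)
      (ae_of_all _ hφψ)
    simpa using this
  have h1 := abs_le.1 (key ν)
  have h2 := abs_le.1 (key ν')
  rw [h φ hφ hφc] at h1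
  rw [Real.dist_eq, abs_le]
  constructor <;> linarith

/-! ### Flows of Lipschitz vector fields and the linear continuity equation -/

/-- A time-dependent vector field on `[0,S]`, continuous in time and Lipschitz in space. -/
structure LipField {k : ℕ} (v : ℝ → Euc k → Euc k) (S K : ℝ) : Prop where
  nonneg : 0 ≤ S
  lip_nonneg : 0 ≤ K
  lip : ∀ s ∈ Icc 0 S, ∀ θ θ', ‖v s θ - v s θ'‖ ≤ K * ‖θ - θ'‖
  cont : ∀ θ, ContinuousOn (fun s => v s θ) (Icc 0 S)

/-- `z` is an integral curve of `v` on `[0,S]`. -/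
def IsCurve {k : ℕ} (v : ℝ → Euc k → Euc k) (S : ℝ) (z : ℝ → Euc k) : Prop :=
  ∀ s ∈ Icc 0 S, HasDerivWithinAt z (v s (z s)) (Icc 0 S) s

/-- `Ξ a θ` is the integral curve of `v` on `[0,S]` passing through `θ` at time `a`. -/
def IsFlow {k : ℕ} (v : ℝ → Euc k → Euc k) (S : ℝ) (Ξ : ℝ → Euc k → ℝ → Euc k) : Prop :=
  ∀ a ∈ Icc 0 S, ∀ θ, Ξ a θ a = θ ∧ IsCurve v S (Ξ a θ)

section

variable {k : ℕ} {v : ℝ → Euc k → Euc k} {S K : ℝ} {z z' : ℝ → Euc k}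
  {Ξ : ℝ → Euc k → ℝ → Euc k}

theorem abs_sub_le_of_mem {s a : ℝ} (hs : s ∈ Icc 0 S) (ha : a ∈ Icc 0 S) : |s - a| ≤ S :=
  abs_le.2 ⟨by linarith [hs.1, ha.2], by linarith [hs.2, ha.1]⟩

namespace LipField

theorem exists_flow (hv : LipField v S K) : ∃ Ξ, IsFlow v S Ξ := by
  have : ∀ a θ, ∃ z : ℝ → Euc k, a ∈ Icc 0 S → z a = θ ∧ IsCurve v S z := fun a θ => by
    by_cases ha : a ∈ Icc 0 S
    · obtain ⟨z, hz⟩ := exists_ode_solution hv.lip_nonneg hv.lip hv.cont ha θ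
      exact ⟨z, fun _ => hz⟩
    · exact ⟨fun _ => 0, fun h => absurd h ha⟩
  choose Ξ hΞ using this
  exact ⟨Ξ, fun a ha θ => hΞ a θ ha⟩

theorem continuousOn_uncurry (hv : LipField v S K) :
    ContinuousOn (fun q : ℝ × Euc k => v q.1 q.2) (Icc 0 S ×ˢ univ) :=
  continuousOn_prod_of_continuousOn_lipschitzOnWith' _ ⟨K, hv.lip_nonneg⟩
    (fun s hs => LipschitzOnWith.of_dist_le_mul fun x _ x' _ => by
      rw [dist_eq_norm, dist_eq_norm]; exact hv.lip s hs x x') fun x _ => hv.cont x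

theorem curve_sub_le (hv : LipField v S K) (hz : IsCurve v S z) (hz' : IsCurve v S z') {a s : ℝ}
    (ha : a ∈ Icc 0 S) (hs : s ∈ Icc 0 S) :
    ‖z s - z' s‖ ≤ ‖z a - z' a‖ * Real.exp (K * S) := by
  have := norm_le_of_hasDerivWithinAt (ε := 0) (u := fun t => z t - z' t) hv.lip_nonneg le_rfl
    (fun t ht => (hz t ht).sub (hz' t ht))
    (fun t ht => (hv.lip t ht _ _).trans (by simp)) ha hs
  rw [zero_mul, add_zero] at this
  refine this.trans ?_
  have := abs_sub_le_of_mem hs ha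
  have := hv.lip_nonneg
  gcongr

/-- The difference of two curves changes in time `|s - a|` by at most a multiple of its initial
size. This gives the commutator estimate its factor of the mollification radius. -/
theorem curve_displacement_le (hv : LipField v S K) (hz : IsCurve v S z) (hz' : IsCurve v S z')
    {a s : ℝ} (ha : a ∈ Icc 0 S) (hs : s ∈ Icc 0 S) :
    ‖(z s - z' s) - (z a - z' a)‖ ≤ K * (‖z a - z' a‖ * Real.exp (K * S)) * |s - a| := by
  refine Convex.norm_image_sub_le_of_norm_hasDerivWithin_le (f := fun t => z t - z' t)
    (fun t ht => (hz t ht).sub (hz' t ht)) (fun t ht => (hv.lip t ht _ _).trans ?_)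
    (convex_Icc 0 S) ha hs
  have := hv.lip_nonneg
  gcongr
  exact hv.curve_sub_le hz hz' ha ht

/-- Valid forward and backward in time, so curves meeting a given ball at any time stay in one
larger ball, and transported functions keep compact support. -/
theorem exists_curve_bound (hv : LipField v S K) (r : ℝ) :
    ∃ r', ∀ z, IsCurve v S z → ∀ a ∈ Icc 0 S, ‖z a‖ ≤ r → ∀ s ∈ Icc 0 S, ‖z s‖ ≤ r' := by
  obtain ⟨M, hM⟩ := isCompact_Icc.exists_bound_of_continuousOn (hv.cont 0)
  have hM0 : 0 ≤ M := (norm_nonneg _).trans (hM 0 ⟨le_rfl, hv.nonneg⟩)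
  refine ⟨(r + M * S) * Real.exp (K * S), fun z hz a ha har s hs => ?_⟩
  have := norm_le_of_hasDerivWithinAt (ε := M) (u := z) hv.lip_nonneg hM0 hz
    (fun t ht => by
      have h1 := hv.lip t ht (z t) 0
      have h2 := norm_sub_norm_le (v t (z t)) (v t 0)
      have h3 := hM t ht
      simp only [sub_zero] at h1
      linarith) ha hs
  refine this.trans ?_
  have h1 := abs_sub_le_of_mem hs ha
  have h2 := hv.lip_nonneg
  have h3 : 0 ≤ r := (norm_nonneg _).trans har
  have h4 := hv.nonneg
  gcongr

theorem flow_comp (hv : LipField v S K) (hΞ : IsFlow v S Ξ) {a b s : ℝ} (ha : a ∈ Icc 0 S)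
    (hb : b ∈ Icc 0 S) (hs : s ∈ Icc 0 S) (θ : Euc k) : Ξ a (Ξ b θ a) s = Ξ b θ s := by
  have := hv.curve_sub_le (hΞ a ha (Ξ b θ a)).2 (hΞ b hb θ).2 ha hs
  rw [(hΞ a ha _).1, sub_self, norm_zero, zero_mul] at this
  exact sub_eq_zero.1 (norm_le_zero_iff.1 this)

theorem flow_sub_le (hv : LipField v S K) (hΞ : IsFlow v S Ξ) {a s : ℝ} (ha : a ∈ Icc 0 S)
    (hs : s ∈ Icc 0 S) (θ θ' : Euc k) :
    ‖Ξ a θ s - Ξ a θ' s‖ ≤ ‖θ - θ'‖ * Real.exp (K * S) := by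
  have := hv.curve_sub_le (hΞ a ha θ).2 (hΞ a ha θ').2 ha hs
  rwa [(hΞ a ha _).1, (hΞ a ha _).1] at this

theorem continuous_flow (hv : LipField v S K) (hΞ : IsFlow v S Ξ) {a s : ℝ} (ha : a ∈ Icc 0 S)
    (hs : s ∈ Icc 0 S) : Continuous fun θ => Ξ a θ s := by
  refine (LipschitzWith.of_dist_le_mul (K := ⟨Real.exp (K * S), (Real.exp_pos _).le⟩)
    fun θ θ' => ?_).continuous
  rw [dist_eq_norm, dist_eq_norm]
  exact (hv.flow_sub_le hΞ ha hs θ θ').trans (mul_comm _ _).le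

/-- First order expansion of a test function along the flow, uniform in the starting point. -/
theorem eventually_test_function_expansion (hv : LipField v S K) (hΞ : IsFlow v S Ξ)
    {w : Euc k → ℝ} (hw : ContDiff ℝ 1 w) (hc : HasCompactSupport w) {s : ℝ} (hs : s ∈ Icc 0 S)
    {ε : ℝ} (hε : 0 < ε) :
    ∀ᶠ s' in 𝓝[Icc 0 S] s, ∀ θ,
      |w (Ξ s' θ s) - w θ + (s' - s) * fderiv ℝ w θ (v s θ)| ≤ ε * |s' - s| := by
  obtain ⟨r, hr⟩ := hc.isCompact.isBounded.subset_closedBall 0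
  have hr' : ∀ θ, r < ‖θ‖ → w θ = 0 ∧ fderiv ℝ w θ = 0 := fun θ hθ => by
    have : θ ∉ tsupport w := fun h => by
      have := hr h
      simp only [Metric.mem_closedBall, dist_zero_right] at this
      linarith
    exact ⟨image_eq_zero_of_notMem_tsupport this, fderiv_of_notMem_tsupport ℝ this⟩
  -- A curve that ever meets the support of `w` stays in radius `r₂`. A curve starting within `max r
  -- r₂` stays in radius `r₃`. For the remaining starting points every term of the expansion
  -- vanishes.
  obtain ⟨r₂, hr₂⟩ := hv.exists_curve_bound r
  obtain ⟨r₃, hr₃⟩ := hv.exists_curve_bound (max r r₂)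
  set D : Set (ℝ × Euc k) := Icc 0 S ×ˢ Metric.closedBall 0 r₃ with hD
  have hDc : IsCompact D := isCompact_Icc.prod (isCompact_closedBall _ _)
  have hvc : ContinuousOn (fun q : ℝ × Euc k => v q.1 q.2) D :=
    hv.continuousOn_uncurry.mono (prod_mono_right (subset_univ _))
  have hqc : ContinuousOn (fun q : ℝ × Euc k => fderiv ℝ w q.2 (v q.1 q.2)) D :=
    ((hw.continuous_fderiv one_ne_zero).comp_continuousOn continuousOn_snd).clm_apply hvc
  obtain ⟨B, hB⟩ := hDc.exists_bound_of_continuousOn hvc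
  obtain ⟨δ, hδ, hunif⟩ := Metric.uniformContinuousOn_iff.1
    (hDc.uniformContinuousOn_of_continuous hqc) ε hε
  -- Within this time step, both the elapsed time and the displacement, at most `B` times it, stay
  -- below `δ`.
  have hδ' : 0 < δ / (|B| + 1) := by positivity
  filter_upwards [self_mem_nhdsWithin, nhdsWithin_le_nhds (Metric.ball_mem_nhds s hδ')]
    with s' hs' hball θ
  rw [Metric.mem_ball, Real.dist_eq] at hball
  have hball2 : (|B| + 1) * |s' - s| < δ := by
    rwa [lt_div_iff₀ (by positivity), mul_comm] at hball
  have hball3 : |s' - s| < δ := by nlinarith [abs_nonneg B, abs_nonneg (s' - s)]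
  obtain ⟨h0, hcurve⟩ := hΞ s' hs' θ
  rcases le_or_gt ‖θ‖ (max r r₂) with hθ | hθ
  · have hmem : ∀ t ∈ Icc 0 S, (t, Ξ s' θ t) ∈ D := fun t ht =>
      ⟨ht, by simpa using hr₃ _ hcurve s' hs' (by rwa [h0]) t ht⟩
    have hmemθ : (s, θ) ∈ D := ⟨hs, by simpa [h0] using (hmem s' hs').2⟩
    have huIcc : uIcc s' s ⊆ Icc 0 S := uIcc_subset_Icc hs' hs
    -- Subtracting the linear term leaves a function of `t` whose derivative is at most `ε` by
    -- uniform continuity on `D`, so the mean value inequality gives the expansion.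
    have hder : ∀ t ∈ uIcc s' s, HasDerivWithinAt
        (fun t => w (Ξ s' θ t) - t * fderiv ℝ w θ (v s θ))
        (fderiv ℝ w (Ξ s' θ t) (v t (Ξ s' θ t)) - fderiv ℝ w θ (v s θ)) (uIcc s' s) t := by
      intro t ht
      have h1 := ((hw.differentiable one_ne_zero (Ξ s' θ t)).hasFDerivAt).comp_hasDerivWithinAt t
        ((hcurve t (huIcc ht)).mono huIcc)
      have h2 := ((hasDerivAt_id t).mul_const (fderiv ℝ w θ (v s θ))).hasDerivWithinAt
        (s := uIcc s' s)
      rw [one_mul] at h2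
      exact h1.sub h2
    have hbd : ∀ t ∈ uIcc s' s,
        ‖fderiv ℝ w (Ξ s' θ t) (v t (Ξ s' θ t)) - fderiv ℝ w θ (v s θ)‖ ≤ ε := by
      intro t ht
      have hts : |t - s| ≤ |s' - s| := by
        rw [uIcc_comm] at ht
        exact abs_sub_left_of_mem_uIcc ht
      have hts' : |t - s'| ≤ |s' - s| := by
        rw [abs_sub_comm s' s]
        exact abs_sub_left_of_mem_uIcc ht
      have hdisp : ‖Ξ s' θ t - θ‖ ≤ B * |t - s'| := by
        have := Convex.norm_image_sub_le_of_norm_hasDerivWithin_le (f := Ξ s' θ)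
          (f' := fun r => v r (Ξ s' θ r)) (C := B) (s := Icc 0 S) hcurve
          (fun r hr => hB (r, Ξ s' θ r) (hmem r hr)) (convex_Icc 0 S) hs' (huIcc ht)
        rwa [h0] at this
      have := hunif (t, Ξ s' θ t) (hmem t (huIcc ht)) (s, θ) hmemθ (by
        rw [Prod.dist_eq, max_lt_iff]
        refine ⟨by rw [Real.dist_eq]; linarith, ?_⟩
        rw [dist_eq_norm]
        calc ‖Ξ s' θ t - θ‖ ≤ B * |t - s'| := hdisp
          _ ≤ (|B| + 1) * |s' - s| := by
              gcongr
              linarith [le_abs_self B]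
          _ < δ := hball2)
      rw [dist_eq_norm] at this
      exact this.le
    have := Convex.norm_image_sub_le_of_norm_hasDerivWithin_le (C := ε) hder hbd
      (convex_uIcc s' s) left_mem_uIcc right_mem_uIcc
    rw [h0, Real.norm_eq_abs, Real.norm_eq_abs, abs_sub_comm s s'] at this
    convert this using 2
    ring
  · have hθr : r < ‖θ‖ := (le_max_left _ _).trans_lt hθ
    have hθs : r < ‖Ξ s' θ s‖ := by
      by_contra hcon
      have := hr₂ _ hcurve s hs (not_lt.1 hcon) s' hs'
      rw [h0] at this
      exact absurd ((le_max_right _ _).trans_lt hθ) (not_lt.2 this)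
    rw [(hr' _ hθr).1, (hr' _ hθr).2, (hr' _ hθs).1]
    simp only [sub_self, _root_.zero_apply, mul_zero, add_zero, abs_zero]
    positivity

end LipField

end

/-- `ν` is a weak solution on `[0,S]` of the continuity equation with velocity field `v`. -/
structure IsWeakSolution {k : ℕ} (v : ℝ → Euc k → Euc k) (S : ℝ) (ν : ℝ → Measure (Euc k)) :
    Prop where
  prob : ∀ s ∈ Icc 0 S, IsProbabilityMeasure (ν s)
  cont : ∀ h : Euc k → ℝ, Continuous h → HasCompactSupport h →
    ContinuousOn (fun s => ∫ θ, h θ ∂(ν s)) (Icc 0 S)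
  eqn : ∀ h : Euc k → ℝ, ContDiff ℝ ((⊤ : ℕ∞) : WithTop ℕ∞) h → HasCompactSupport h →
    ∀ s ∈ Ioo 0 S, HasDerivAt (fun s' => ∫ θ, h θ ∂(ν s')) (∫ θ, fderiv ℝ h θ (v s θ) ∂(ν s)) s

/-- Slopes are controlled only at interior points and with a margin above `c`. The comparison
therefore runs on `[a,S]` with `a > 0` and slope `c' > c`, after which `a → 0` by continuity and `c'
→ c`. -/
theorem abs_sub_le_of_eventually_slope_le {m : ℝ → ℝ} {S c : ℝ} (hS : 0 ≤ S)
    (hm : ContinuousOn m (Icc 0 S))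
    (hs : ∀ s ∈ Ioo 0 S, ∀ r, c < r → ∀ᶠ s' in 𝓝[>] s, |m s' - m s| ≤ r * |s' - s|) :
    |m S - m 0| ≤ c * S := by
  rcases hS.eq_or_lt with rfl | hS
  · simp
  have key : ∀ c', c < c' → ∀ a ∈ Ioo 0 S, |m S - m a| ≤ c' * (S - a) := by
    intro c' hc' a ha
    have hsub : Icc a S ⊆ Icc 0 S := Icc_subset_Icc_left ha.1.le
    have := image_norm_le_of_liminf_right_slope_norm_lt_deriv_boundary (f := fun s => m s - m a)
      (f' := fun _ => c) (a := a) (b := S) (B := fun s => c' * (s - a)) (B' := fun _ => c')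
      ((hm.mono hsub).sub continuousOn_const) (fun s hsI r hr => ?_) (by simp) (by fun_prop)
      (fun s _ => by
        have := ((hasDerivAt_id s).sub_const a).const_mul c'
        rw [mul_one] at this
        exact this.hasDerivWithinAt) (fun _ _ _ => hc') (x := S) ⟨ha.2.le, le_rfl⟩
    · exact this
    · obtain ⟨r', hr'1, hr'2⟩ := exists_between hr
      refine Eventually.frequently ?_
      filter_upwards [hs s ⟨ha.1.trans_le hsI.1, hsI.2⟩ r' hr'1, self_mem_nhdsWithin]
        with s' hs' hlt
      have hpos : 0 < s' - s := sub_pos.2 hlt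
      rw [slope_def_field, div_lt_iff₀ hpos]
      rw [abs_of_pos hpos] at hs'
      have h1 := abs_norm_sub_norm_le (m s' - m a) (m s - m a)
      rw [sub_sub_sub_cancel_right] at h1
      have h2 := (le_abs_self _).trans h1
      rw [Real.norm_eq_abs (m s' - m s)] at h2
      simp only [Function.comp_apply]
      nlinarith
  have key2 : ∀ c', c < c' → |m S - m 0| ≤ c' * S := by
    intro c' hc'
    have h0 : Tendsto m (𝓝[>] 0) (𝓝 (m 0)) :=
      (hm 0 ⟨le_rfl, hS.le⟩).mono_left (nhdsWithin_le_of_mem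
        (mem_of_superset (Ioo_mem_nhdsGT hS) Ioo_subset_Icc_self))
    have h1 : Tendsto (fun a => |m S - m a|) (𝓝[>] 0) (𝓝 |m S - m 0|) :=
      (tendsto_const_nhds.sub h0).abs
    have h2 : Tendsto (fun a : ℝ => c' * (S - a)) (𝓝[>] 0) (𝓝 (c' * (S - 0))) := by
      have : Continuous fun a : ℝ => c' * (S - a) := by fun_prop
      exact (this.tendsto 0).mono_left nhdsWithin_le_nhds
    rw [sub_zero] at h2
    refine le_of_tendsto_of_tendsto h1 h2 ?_
    filter_upwards [Ioo_mem_nhdsGT hS] with a ha using key c' hc' a ha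
  refine le_of_forall_pos_le_add fun δ hδ => ?_
  refine (key2 (c + δ / S) (by linarith [div_pos hδ hS])).trans (le_of_eq ?_)
  field_simp

section

variable {k : ℕ} {v : ℝ → Euc k → Euc k} {S K : ℝ} {Ξ : ℝ → Euc k → ℝ → Euc k}
  {ν : ℝ → Measure (Euc k)} {φ : Euc k → ℝ}

theorem integrable_of_bound {κ : Measure (Euc k)} [IsProbabilityMeasure κ] {h : Euc k → ℝ} {B : ℝ}
    (hh : Continuous h) (hB : ∀ θ, ‖h θ‖ ≤ B) : Integrable h κ :=
  (integrable_const B).mono' hh.aestronglyMeasurable (ae_of_all _ hB)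

namespace LipField

theorem hasCompactSupport_comp_flow (hv : LipField v S K) (hΞ : IsFlow v S Ξ)
    (hc : HasCompactSupport φ) {s : ℝ} (hs : s ∈ Icc 0 S) :
    HasCompactSupport fun θ => φ (Ξ s θ S) := by
  have hS : S ∈ Icc 0 S := ⟨hv.nonneg, le_rfl⟩
  obtain ⟨r, hr⟩ := hc.isCompact.isBounded.subset_closedBall 0
  obtain ⟨r₂, hr₂⟩ := hv.exists_curve_bound r
  refine HasCompactSupport.of_support_subset_isCompact (isCompact_closedBall 0 r₂) fun θ hθ => ?_
  have h1 : Ξ s θ S ∈ tsupport φ := subset_tsupport _ hθ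
  have := hr₂ _ (hΞ s hs θ).2 S hS (by simpa using hr h1) s hs
  rw [(hΞ s hs θ).1] at this
  simpa using this

/-- The commutator of convolution and transport. By the flow property the two values come from the
points `Ξ s' (θ - z) s` and `Ξ s' θ s - z`, and their distance is of order `‖z‖ |s' - s|`. -/
theorem mollify_comp_flow_sub_le (hv : LipField v S K) (hΞ : IsFlow v S Ξ) {Λ : ℝ} (hΛ : 0 ≤ Λ)
    (hφ : Continuous φ) (hL : ∀ θ θ', |φ θ - φ θ'| ≤ Λ * ‖θ - θ'‖) (η : ContDiffBump (0 : Euc k))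
    {s s' : ℝ} (hs : s ∈ Icc 0 S) (hs' : s' ∈ Icc 0 S) (θ : Euc k) :
    |mollify η (fun θ => φ (Ξ s' θ S)) θ - mollify η (fun θ => φ (Ξ s θ S)) (Ξ s' θ s)| ≤
      Λ * Real.exp (K * S) * (K * Real.exp (K * S)) * η.rOut * |s' - s| := by
  have hS : S ∈ Icc 0 S := ⟨hv.nonneg, le_rfl⟩
  refine norm_mollify_sub_mollify_le η (hφ.comp (hv.continuous_flow hΞ hs' hS))
    (hφ.comp (hv.continuous_flow hΞ hs hS)) fun z hz => ?_
  change |φ (Ξ s' (θ - z) S) - φ (Ξ s (Ξ s' θ s - z) S)| ≤ _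
  rw [← hv.flow_comp hΞ hs hs' hS (θ - z)]
  refine (hL _ _).trans ?_
  have h1 := hv.flow_sub_le hΞ hs hS (Ξ s' (θ - z) s) (Ξ s' θ s - z)
  have h2 := hv.curve_displacement_le (hΞ s' hs' (θ - z)).2 (hΞ s' hs' θ).2 hs' hs
  rw [(hΞ s' hs' (θ - z)).1, (hΞ s' hs' θ).1, abs_sub_comm] at h2
  have e1 : θ - z - θ = -z := by abel
  have e2 : Ξ s' (θ - z) s - Ξ s' θ s - -z = Ξ s' (θ - z) s - (Ξ s' θ s - z) := by abel
  rw [e1, e2, norm_neg] at h2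
  have h3 := hv.lip_nonneg
  calc Λ * ‖Ξ s (Ξ s' (θ - z) s) S - Ξ s (Ξ s' θ s - z) S‖
      ≤ Λ * (K * (η.rOut * Real.exp (K * S)) * |s' - s| * Real.exp (K * S)) := by
        refine mul_le_mul_of_nonneg_left (h1.trans ?_) hΛ
        refine mul_le_mul_of_nonneg_right (h2.trans ?_) (Real.exp_pos _).le
        gcongr
    _ = _ := by ring

/-- The increment splits into the commutator error, the first order expansion of `w` along the flow,
and the defect in the weak equation tested with the fixed function `w`. The first two are integrated
against the same measure `ν s'`, so the velocity term appears there rather than at `ν s`. -/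
theorem eventually_abs_sub_le (hv : LipField v S K) (hΞ : IsFlow v S Ξ)
    (hν : IsWeakSolution v S ν) {Λ : ℝ} (hΛ : 0 ≤ Λ)
    (hφ : Continuous φ) (hc : HasCompactSupport φ) (hL : ∀ θ θ', |φ θ - φ θ'| ≤ Λ * ‖θ - θ'‖)
    (η : ContDiffBump (0 : Euc k)) {s : ℝ} (hs : s ∈ Icc 0 S) {w : Euc k → ℝ}
    (hw : w = mollify η fun θ => φ (Ξ s θ S)) {ε : ℝ} (hε : 0 < ε) :
    ∀ᶠ s' in 𝓝[Icc 0 S] s,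
      |∫ θ, mollify η (fun θ => φ (Ξ s' θ S)) θ ∂(ν s') - ∫ θ, w θ ∂(ν s)| ≤
        (Λ * Real.exp (K * S) * (K * Real.exp (K * S)) * η.rOut + ε) * |s' - s| +
        |(∫ θ, w θ ∂(ν s') - ∫ θ, w θ ∂(ν s)) -
          (s' - s) * ∫ θ, fderiv ℝ w θ (v s θ) ∂(ν s')| := by
  have hS : S ∈ Icc 0 S := ⟨hv.nonneg, le_rfl⟩
  have hsm : ContDiff ℝ ((⊤ : ℕ∞) : WithTop ℕ∞) w := by
    rw [hw]; exact contDiff_mollify η (hφ.comp (hv.continuous_flow hΞ hs hS))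
  have hw1 : ContDiff ℝ 1 w := hsm.of_le (by exact_mod_cast le_top)
  have hwc : HasCompactSupport w := by
    rw [hw]; exact hasCompactSupport_mollify η (hv.hasCompactSupport_comp_flow hΞ hc hs)
  filter_upwards [hv.eventually_test_function_expansion hΞ hw1 hwc hs hε, self_mem_nhdsWithin]
    with s' hexp hs'
  have := hν.prob s' hs'
  obtain ⟨B, hB⟩ := hwc.exists_bound_of_continuous hw1.continuous
  set U := mollify η fun θ => φ (Ξ s' θ S) with hU
  have iU : Integrable U (ν s') := by
    have hUc : HasCompactSupport U :=
      hasCompactSupport_mollify η (hv.hasCompactSupport_comp_flow hΞ hc hs')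
    exact (contDiff_mollify η
      (hφ.comp (hv.continuous_flow hΞ hs' hS))).continuous.integrable_of_hasCompactSupport hUc
  have iw : Integrable w (ν s') := integrable_of_bound hw1.continuous hB
  have iwf : Integrable (fun θ => w (Ξ s' θ s)) (ν s') :=
    integrable_of_bound (hw1.continuous.comp (hv.continuous_flow hΞ hs' hs)) fun θ => hB _
  have hvs : Continuous (v s) := (LipschitzWith.of_dist_le_mul (K := ⟨K, hv.lip_nonneg⟩)
    fun θ θ' => by rw [dist_eq_norm, dist_eq_norm]; exact hv.lip s hs θ θ').continuous
  have iq : Integrable (fun θ => fderiv ℝ w θ (v s θ)) (ν s') := by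
    refine ((hw1.continuous_fderiv one_ne_zero).clm_apply hvs).integrable_of_hasCompactSupport ?_
    exact (hwc.fderiv (𝕜 := ℝ)).mono fun θ hθ h0 => hθ (by simp [h0])
  have hA : |∫ θ, (U θ - w (Ξ s' θ s)) ∂(ν s')| ≤
      Λ * Real.exp (K * S) * (K * Real.exp (K * S)) * η.rOut * |s' - s| := by
    have := norm_integral_le_of_norm_le_const (μ := ν s') (f := fun θ => U θ - w (Ξ s' θ s))
      (ae_of_all _ fun θ => by
        rw [hw]; exact hv.mollify_comp_flow_sub_le hΞ hΛ hφ hL η hs hs' θ)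
    simpa using this
  have hE : |∫ θ, (w (Ξ s' θ s) - w θ + (s' - s) * fderiv ℝ w θ (v s θ)) ∂(ν s')| ≤
      ε * |s' - s| := by
    have := norm_integral_le_of_norm_le_const (μ := ν s')
      (f := fun θ => w (Ξ s' θ s) - w θ + (s' - s) * fderiv ℝ w θ (v s θ)) (ae_of_all _ hexp)
    simpa using this
  rw [integral_sub iU iwf] at hA
  rw [integral_add (by exact iwf.sub iw) (iq.const_mul _), integral_sub iwf iw, integral_const_mul] at hE
  have e : ∫ θ, U θ ∂(ν s') - ∫ θ, w θ ∂(ν s) =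
      (∫ θ, U θ ∂(ν s') - ∫ θ, w (Ξ s' θ s) ∂(ν s')) +
      (∫ θ, w (Ξ s' θ s) ∂(ν s') - ∫ θ, w θ ∂(ν s') +
        (s' - s) * ∫ θ, fderiv ℝ w θ (v s θ) ∂(ν s')) +
      ((∫ θ, w θ ∂(ν s') - ∫ θ, w θ ∂(ν s)) -
          (s' - s) * ∫ θ, fderiv ℝ w θ (v s θ) ∂(ν s')) := by ring
  rw [e]
  refine (abs_add_three _ _ _).trans ?_
  rw [add_mul]
  gcongr

/-- Duality: `u s θ = φ (Ξ s θ S)` is constant along characteristics, so `∫ u s dν(s)` should not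
vary. Since `u s` is only Lipschitz, it is mollified at radius `ε`. The resulting `m` has slope at
most `c ε` and differs from the original integral by at most `L ε`. -/
theorem integral_eq_integral_comp_flow (hv : LipField v S K) (hΞ : IsFlow v S Ξ)
    (hν : IsWeakSolution v S ν) (hφ : ContDiff ℝ ((⊤ : ℕ∞) : WithTop ℕ∞) φ)
    (hc : HasCompactSupport φ) : ∫ θ, φ θ ∂(ν S) = ∫ θ, φ (Ξ 0 θ S) ∂(ν 0) := by
  have hS : S ∈ Icc 0 S := ⟨hv.nonneg, le_rfl⟩
  have h0 : (0 : ℝ) ∈ Icc 0 S := ⟨le_rfl, hv.nonneg⟩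
  obtain ⟨Λ, hΛ⟩ := hφ.lipschitzWith_of_hasCompactSupport hc (by simp)
  have hL : ∀ θ θ', |φ θ - φ θ'| ≤ Λ * ‖θ - θ'‖ := fun θ θ' => by
    have := hΛ.dist_le_mul θ θ'
    rwa [Real.dist_eq, dist_eq_norm] at this
  set c : ℝ := Λ * Real.exp (K * S) * (K * Real.exp (K * S)) with hcdef
  have hcc : 0 ≤ c := by have := hv.lip_nonneg; positivity
  set L : ℝ := Λ * Real.exp (K * S) with hLdef
  have hL0 : 0 ≤ L := by positivity
  set u : ℝ → Euc k → ℝ := fun s θ => φ (Ξ s θ S) with hu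
  have huc : ∀ s ∈ Icc 0 S, Continuous (u s) := fun s hs =>
    hφ.continuous.comp (hv.continuous_flow hΞ hs hS)
  have key : ∀ ε, 0 < ε → |∫ θ, u S θ ∂(ν S) - ∫ θ, u 0 θ ∂(ν 0)| ≤ ε * (c * S + 2 * L) := by
    intro ε hε
    set η := bumpOfRadius k hε with hη
    have hrad : η.rOut = ε := rfl
    set m : ℝ → ℝ := fun s => ∫ θ, mollify η (u s) θ ∂(ν s) with hm
    have hsm : ∀ s ∈ Icc 0 S, ContDiff ℝ ((⊤ : ℕ∞) : WithTop ℕ∞) (mollify η (u s)) :=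
      fun s hs => contDiff_mollify η (huc s hs)
    have hwc : ∀ s ∈ Icc 0 S, HasCompactSupport (mollify η (u s)) := fun s hs =>
      hasCompactSupport_mollify η (hv.hasCompactSupport_comp_flow hΞ hc hs)
    have hqcont : ∀ s ∈ Icc 0 S, ContinuousOn
        (fun s' => ∫ θ, fderiv ℝ (mollify η (u s)) θ (v s θ) ∂(ν s')) (Icc 0 S) := by
      intro s hs
      have hvs : Continuous (v s) := (LipschitzWith.of_dist_le_mul (K := ⟨K, hv.lip_nonneg⟩)
        fun θ θ' => by rw [dist_eq_norm, dist_eq_norm]; exact hv.lip s hs θ θ').continuous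
      refine hν.cont _ (((hsm s hs).continuous_fderiv (by simp)).clm_apply hvs) ?_
      exact ((hwc s hs).fderiv (𝕜 := ℝ)).mono fun θ hθ h0 => hθ (by simp [h0])
    have hwcont : ∀ s ∈ Icc 0 S, ContinuousOn
        (fun s' => ∫ θ, mollify η (u s) θ ∂(ν s')) (Icc 0 S) := fun s hs =>
      hν.cont _ (hsm s hs).continuous (hwc s hs)
    have hloc : ∀ s ∈ Icc 0 S, ∀ δ, 0 < δ → ∀ᶠ s' in 𝓝[Icc 0 S] s, |m s' - m s| ≤
        (c * ε + δ) * |s' - s| + |(∫ θ, mollify η (u s) θ ∂(ν s') - ∫ θ, mollify η (u s) θ ∂(ν s))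
          - (s' - s) * ∫ θ, fderiv ℝ (mollify η (u s)) θ (v s θ) ∂(ν s')| := fun s hs δ hδ =>
      hv.eventually_abs_sub_le hΞ hν Λ.2 hφ.continuous hc hL η hs rfl hδ
    -- The weak equation is available only in the open interval. At the endpoints the local estimate
    -- combined with continuity of integrals of a fixed function suffices.
    have hmc : ContinuousOn m (Icc 0 S) := by
      intro s hs
      rw [ContinuousWithinAt, tendsto_iff_dist_tendsto_zero]
      have hid : Tendsto (fun s' : ℝ => s' - s) (𝓝[Icc 0 S] s) (𝓝 0) := by
        have : Continuous fun s' : ℝ => s' - s := by fun_prop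
        have := this.tendsto s
        rw [sub_self] at this
        exact this.mono_left nhdsWithin_le_nhds
      have hlim : Tendsto (fun s' => (c * ε + 1) * |s' - s| +
          |(∫ θ, mollify η (u s) θ ∂(ν s') - ∫ θ, mollify η (u s) θ ∂(ν s))
          - (s' - s) * ∫ θ, fderiv ℝ (mollify η (u s)) θ (v s θ) ∂(ν s')|)
          (𝓝[Icc 0 S] s) (𝓝 0) := by
        have h1 := (hid.abs.const_mul (c * ε + 1)).add
          ((((hwcont s hs s hs).tendsto.sub_const (∫ θ, mollify η (u s) θ ∂(ν s))).sub
            (hid.mul (hqcont s hs s hs).tendsto)).abs)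
        simpa using h1
      refine squeeze_zero' (Eventually.of_forall fun _ => dist_nonneg) ?_ hlim
      filter_upwards [hloc s hs 1 one_pos] with s' hs'
      exact hs'
    have hslope : ∀ s ∈ Ioo 0 S, ∀ r, c * ε < r → ∀ᶠ s' in 𝓝[>] s,
        |m s' - m s| ≤ r * |s' - s| := by
      intro s hs r hr
      have hsI := Ioo_subset_Icc_self hs
      -- Three errors of size `δ |s' - s|` occur: the flow expansion, the derivative in the weak
      -- equation, and the replacement of the velocity integral at `s'` by the one at `s`.
      set δ := (r - c * ε) / 3 with hδ
      have hδ0 : 0 < δ := by have := sub_pos.2 hr; positivity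
      have hmem : Icc 0 S ∈ 𝓝 s := Icc_mem_nhds hs.1 hs.2
      have hle : 𝓝[>] s ≤ 𝓝[Icc 0 S] s := by
        rw [nhdsWithin_eq_nhds.2 hmem]; exact nhdsWithin_le_nhds
      have h1 := hle (hloc s hsI δ hδ0)
      have h2 := nhdsWithin_le_nhds (s := Ioi s)
        ((hν.eqn _ (hsm s hsI) (hwc s hsI) s hs).isLittleO.def hδ0)
      have h3 := hle ((hqcont s hsI s hsI).tendsto.eventually (Metric.ball_mem_nhds _ hδ0))
      filter_upwards [h1, h2, h3] with s' h1 h2 h3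
      replace h3 := Metric.mem_ball.1 h3
      rw [Real.dist_eq] at h3
      rw [Real.norm_eq_abs, Real.norm_eq_abs, smul_eq_mul] at h2
      refine h1.trans ?_
      set W := ∫ θ, mollify η (u s) θ ∂(ν s')
      set W₀ := ∫ θ, mollify η (u s) θ ∂(ν s)
      set Q := ∫ θ, fderiv ℝ (mollify η (u s)) θ (v s θ) ∂(ν s')
      set Q₀ := ∫ θ, fderiv ℝ (mollify η (u s)) θ (v s θ) ∂(ν s)
      have e : (W - W₀) - (s' - s) * Q = (W - W₀ - (s' - s) * Q₀) - (s' - s) * (Q - Q₀) := by ring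
      have h4 : |(W - W₀) - (s' - s) * Q| ≤ δ * |s' - s| + |s' - s| * δ := by
        rw [e]
        refine (abs_sub _ _).trans (add_le_add h2 ?_)
        rw [abs_mul]
        gcongr
      have h5 : r = c * ε + δ + 2 * δ := by rw [hδ]; ring
      rw [h5]
      linarith
    have hmain := abs_sub_le_of_eventually_slope_le hv.nonneg hmc hslope
    have hnear : ∀ s ∈ Icc 0 S, |m s - ∫ θ, u s θ ∂(ν s)| ≤ L * ε := by
      intro s hs
      have := hν.prob s hs
      have i1 : Integrable (mollify η (u s)) (ν s) :=
        (hsm s hs).continuous.integrable_of_hasCompactSupport (hwc s hs)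
      have i2 : Integrable (u s) (ν s) := (huc s hs).integrable_of_hasCompactSupport
        (hv.hasCompactSupport_comp_flow hΞ hc hs)
      rw [hm]
      simp only
      rw [← integral_sub i1 i2]
      have := norm_integral_le_of_norm_le_const (μ := ν s)
        (f := fun θ => mollify η (u s) θ - u s θ) (C := L * ε) (ae_of_all _ fun θ => by
          refine norm_mollify_sub_le η (huc s hs) fun θ' hθ' => ?_
          refine (hL _ _).trans ?_
          have h1 := hv.flow_sub_le hΞ hs hS θ' θ
          rw [hrad] at hθ'
          calc (Λ : ℝ) * ‖Ξ s θ' S - Ξ s θ S‖ ≤ Λ * (ε * Real.exp (K * S)) := by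
                refine mul_le_mul_of_nonneg_left (h1.trans ?_) Λ.2
                gcongr
            _ = L * ε := by rw [hLdef]; ring)
      simpa using this
    have n1 := abs_le.1 (hnear S hS)
    have n2 := abs_le.1 (hnear 0 h0)
    have n3 := abs_le.1 hmain
    rw [abs_le]
    constructor <;> nlinarith
  have hzero : ∫ θ, u S θ ∂(ν S) - ∫ θ, u 0 θ ∂(ν 0) = 0 := by
    have hnn : 0 ≤ c * S + 2 * L := by have := hv.nonneg; positivity
    refine abs_nonpos_iff.1 (le_of_forall_pos_le_add fun δ hδ => ?_)
    rw [zero_add]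
    refine (key (δ / (c * S + 2 * L + 1)) (by positivity)).trans ?_
    rw [div_mul_eq_mul_div, div_le_iff₀ (by positivity)]
    nlinarith
  have huS : ∀ θ, u S θ = φ θ := fun θ => by rw [hu]; simp only [(hΞ S hS θ).1]
  simp only [huS] at hzero
  exact sub_eq_zero.1 hzero

/-- The solution of the continuity equation is transported by the flow. -/
theorem eq_map_flow (hv : LipField v S K) (hΞ : IsFlow v S Ξ) (hν : IsWeakSolution v S ν) :
    ν S = (ν 0).map fun θ => Ξ 0 θ S := by
  have hS : S ∈ Icc 0 S := ⟨hv.nonneg, le_rfl⟩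
  have h0 : (0 : ℝ) ∈ Icc 0 S := ⟨le_rfl, hv.nonneg⟩
  have := hν.prob S hS
  have := hν.prob 0 h0
  have hcont := hv.continuous_flow hΞ h0 hS
  have : IsProbabilityMeasure ((ν 0).map fun θ => Ξ 0 θ S) :=
    Measure.isProbabilityMeasure_map hcont.aemeasurable
  refine measure_ext_of_test_functions fun φ hφ hc => ?_
  rw [integral_map hcont.aemeasurable hφ.continuous.aestronglyMeasurable]
  exact hv.integral_eq_integral_comp_flow hΞ hν hφ hc

end LipField

end

/-! ### Uniqueness of the gradient flow -/

section Restrict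

variable {k : ℕ} {v : ℝ → Euc k → Euc k} {S S' K : ℝ} {Ξ : ℝ → Euc k → ℝ → Euc k}
  {ν : ℝ → Measure (Euc k)}

theorem LipField.mono (hv : LipField v S K) (h0 : 0 ≤ S') (h : S' ≤ S) : LipField v S' K :=
  ⟨h0, hv.lip_nonneg, fun s hs => hv.lip s ⟨hs.1, hs.2.trans h⟩,
    fun θ => (hv.cont θ).mono (Icc_subset_Icc_right h)⟩

theorem IsFlow.mono (hΞ : IsFlow v S Ξ) (h : S' ≤ S) : IsFlow v S' Ξ := fun a ha θ =>
  ⟨(hΞ a ⟨ha.1, ha.2.trans h⟩ θ).1, fun s hs =>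
    ((hΞ a ⟨ha.1, ha.2.trans h⟩ θ).2 s ⟨hs.1, hs.2.trans h⟩).mono (Icc_subset_Icc_right h)⟩

end Restrict

theorem W2Le.mono {k : ℕ} {ρ ρ' : Measure (Euc k)} {w w' : ℝ} (h : W2Le ρ ρ' w) (hw : 0 ≤ w)
    (hw' : w ≤ w') : W2Le ρ ρ' w' := by
  obtain ⟨π, h1, h2, hi, hle⟩ := h
  exact ⟨π, h1, h2, hi, hle.trans (by gcongr)⟩

theorem integrable_one_add_norm_sq {k : ℕ} {ν : Measure (Euc k)} {M : ℝ} (hM : MomentBound ν M)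
    {u : Euc k → Euc k} (hu : Continuous u) {c : ℝ}
    (h : ∀ θ, ‖u θ‖ ≤ c * (1 + ‖θ‖)) :
    Integrable (fun θ => ‖u θ‖ ^ 2) ν ∧ ∫ θ, ‖u θ‖ ^ 2 ∂ν ≤ (c * (2 * (1 + M))) ^ 2 := by
  have hb : ∀ θ, ‖‖u θ‖ ^ 2‖ ≤ 2 * c ^ 2 + 0 * ‖θ‖ + 2 * c ^ 2 * ‖θ‖ ^ 2 := fun θ => by
    rw [Real.norm_of_nonneg (by positivity)]
    calc ‖u θ‖ ^ 2 ≤ (c * (1 + ‖θ‖)) ^ 2 := by gcongr; exact h θ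
      _ ≤ _ := by nlinarith [mul_nonneg (sq_nonneg c) (sq_nonneg (1 - ‖θ‖))]
  have hcu : Continuous fun θ => ‖u θ‖ ^ 2 := by fun_prop
  refine ⟨hM.integrable_of_le hcu hb, ?_⟩
  have := hM.norm_integral_le le_rfl (by positivity) hb
  refine ((le_abs_self _).trans this).trans ?_
  nlinarith [mul_nonneg (sq_nonneg c) hM.pos.le, mul_nonneg (sq_nonneg c) (sq_nonneg M)]

/-- A pair of maps of a common source gives a coupling. -/
theorem W2Le.of_map {k : ℕ} {ν : Measure (Euc k)} {M : ℝ} (hM : MomentBound ν M)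
    {X X' : Euc k → Euc k} (hX : Continuous X) (hX' : Continuous X') {c : ℝ}
    (h : ∀ θ, ‖X θ - X' θ‖ ≤ c * (1 + ‖θ‖)) :
    W2Le (ν.map X) (ν.map X') (c * (2 * (1 + M))) := by
  have hm : Measurable fun θ => (X θ, X' θ) := hX.measurable.prodMk hX'.measurable
  have hcont : Continuous fun z : Euc k × Euc k => ‖z.1 - z.2‖ ^ 2 := by fun_prop
  have key := integrable_one_add_norm_sq hM (u := fun θ => X θ - X' θ) (hX.sub hX') h
  refine ⟨ν.map fun θ => (X θ, X' θ), ?_, ?_, ?_, ?_⟩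
  · rw [Measure.fst, Measure.map_map measurable_fst hm]; rfl
  · rw [Measure.snd, Measure.map_map measurable_snd hm]; rfl
  · rw [integrable_map_measure hcont.aestronglyMeasurable hm.aemeasurable]
    exact key.1
  · rw [integral_map hm.aemeasurable hcont.aestronglyMeasurable]
    exact key.2

theorem W2Le.of_momentBound {k : ℕ} {ρ ρ' : Measure (Euc k)} {M : ℝ} (h : MomentBound ρ M)
    (h' : MomentBound ρ' M) : W2Le ρ ρ' (2 * M) := by
  have := h.prob
  have := h'.prob
  have i1 : Integrable (fun z : Euc k × Euc k => ‖z.1‖ ^ 2) (ρ.prod ρ') := h.integrable.comp_fst ρ'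
  have i2 : Integrable (fun z : Euc k × Euc k => ‖z.2‖ ^ 2) (ρ.prod ρ') := h'.integrable.comp_snd ρ
  have hb : ∀ z : Euc k × Euc k, ‖z.1 - z.2‖ ^ 2 ≤ 2 * ‖z.1‖ ^ 2 + 2 * ‖z.2‖ ^ 2 := fun z => by
    have := norm_sub_le z.1 z.2
    nlinarith [norm_nonneg (z.1 - z.2), sq_nonneg (‖z.1‖ - ‖z.2‖), norm_nonneg z.1,
      norm_nonneg z.2]
  have hi2 : Integrable (fun z : Euc k × Euc k => 2 * ‖z.1‖ ^ 2 + 2 * ‖z.2‖ ^ 2) (ρ.prod ρ') :=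
    (i1.const_mul 2).add (i2.const_mul 2)
  have hi : Integrable (fun z : Euc k × Euc k => ‖z.1 - z.2‖ ^ 2) (ρ.prod ρ') :=
    hi2.mono' (by fun_prop) (ae_of_all _ fun z => by simpa using hb z)
  refine ⟨ρ.prod ρ', Measure.fst_prod, Measure.snd_prod, hi, ?_⟩
  refine (integral_mono hi hi2 hb).trans ?_
  rw [integral_add (i1.const_mul 2) (i2.const_mul 2), integral_const_mul, integral_const_mul,
    integral_fun_fst (fun θ : Euc k => ‖θ‖ ^ 2), integral_fun_snd (fun θ : Euc k => ‖θ‖ ^ 2)]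
  simp only [probReal_univ, one_smul]
  linarith [h.le, h'.le]

/-- Convergence in `W₂` implies convergence of integrals of compactly supported functions. -/
theorem eventually_abs_integral_sub_lt {k : ℕ} {h : Euc k → ℝ} (hh : Continuous h)
    (hc : HasCompactSupport h) {ε : ℝ} (hε : 0 < ε) :
    ∃ w, 0 < w ∧ ∀ ρ ρ' : Measure (Euc k), IsProbabilityMeasure ρ → IsProbabilityMeasure ρ' →
      W2Le ρ ρ' w → |∫ θ, h θ ∂ρ - ∫ θ, h θ ∂ρ'| < ε := by
  obtain ⟨g, hg, hgc, hgh⟩ := exists_test_function_near hh hc (ε := ε / 4) (by positivity)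
  obtain ⟨Λ, hΛ⟩ := hg.lipschitzWith_of_hasCompactSupport hgc (by simp)
  -- This makes the Lipschitz term less than `ε / 4`. Two approximation errors of `ε / 4` are added
  -- to it.
  refine ⟨ε / (4 * (Λ + 1)), by positivity, fun ρ ρ' hρ hρ' hW => ?_⟩
  have hw : 0 < ε / (4 * (Λ + 1)) := by positivity
  have near : ∀ (κ : Measure (Euc k)) [IsProbabilityMeasure κ],
      |∫ θ, g θ ∂κ - ∫ θ, h θ ∂κ| ≤ ε / 4 := fun κ _ => by
    rw [← integral_sub (hg.continuous.integrable_of_hasCompactSupport hgc)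
      (hh.integrable_of_hasCompactSupport hc)]
    have := norm_integral_le_of_norm_le_const (μ := κ) (f := fun x => g x - h x)
      (ae_of_all _ hgh)
    simpa using this
  have mid : |∫ θ, g θ ∂ρ - ∫ θ, g θ ∂ρ'| ≤ Λ * (ε / (4 * (Λ + 1))) := by
    obtain ⟨π, h1, h2, hi, hle⟩ := hW
    have hp : IsProbabilityMeasure π := ⟨by rw [← Measure.fst_univ, h1, measure_univ]⟩
    have ig : ∀ κ : Measure (Euc k), IsProbabilityMeasure κ → Integrable g κ := fun κ _ =>
      hg.continuous.integrable_of_hasCompactSupport hgc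
    have ig1 := ig ρ hρ
    have ig2 := ig ρ' hρ'
    rw [← h1, Measure.fst, integrable_map_measure hg.continuous.aestronglyMeasurable
      measurable_fst.aemeasurable] at ig1
    rw [← h2, Measure.snd, integrable_map_measure hg.continuous.aestronglyMeasurable
      measurable_snd.aemeasurable] at ig2
    rw [← h1, ← h2, Measure.fst, Measure.snd,
      integral_map measurable_fst.aemeasurable hg.continuous.aestronglyMeasurable,
      integral_map measurable_snd.aemeasurable hg.continuous.aestronglyMeasurable,
      ← integral_sub (by exact ig1) (by exact ig2)]
    have c0 := integral_mul_le_of_sq_le (π := π) (u := fun _ => (1 : ℝ))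
      (v := fun z : Euc k × Euc k => ‖z.1 - z.2‖) one_pos hw (by fun_prop) (by fun_prop) (by simp)
      hi (by simp) hle
    simp only [one_mul] at c0
    refine (norm_integral_le_of_norm_le (f := fun z : Euc k × Euc k => g z.1 - g z.2)
      (c0.1.const_mul (Λ : ℝ)) (ae_of_all _ fun z => ?_)).trans ?_
    · have := hΛ.dist_le_mul z.1 z.2
      rwa [dist_eq_norm, dist_eq_norm] at this
    · rw [integral_const_mul]
      exact mul_le_mul_of_nonneg_left c0.2 Λ.2
  have mid' : (Λ : ℝ) * (ε / (4 * (Λ + 1))) < ε / 4 := by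
    rw [← mul_div_assoc, div_lt_div_iff₀ (by positivity) (by norm_num)]
    nlinarith [Λ.2]
  have n1 := abs_le.1 (near ρ)
  have n2 := abs_le.1 (near ρ')
  have n3 := abs_le.1 mid
  rw [abs_lt]
  constructor <;> linarith

section

variable {d k : ℕ} {f : Euc d → Euc k → Euc d} {g y : Euc d → ℝ} {μ : Measure (Euc d)}
  {ρini : ℝ → Measure (Euc k)} {ρ ρ' : ℝ → ℝ → Measure (Euc k)} {M K S : ℝ}

/-- The velocity field of the gradient flow. -/
noncomputable def velocity (f : Euc d → Euc k → Euc d) (g y : Euc d → ℝ) (μ : Measure (Euc d))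
    (ρ : ℝ → ℝ → Measure (Euc k)) (t s : ℝ) (θ : Euc k) : Euc k :=
  -gradient (regCostVariation f g y μ s (ρ s) t) θ

theorem IsFlowPath.exists_bddPath (h : IsFlowPath ρ) (S : ℝ) :
    ∃ M, ∀ s ∈ Icc (0 : ℝ) S, BddPath (ρ s) M :=
  let ⟨M, hM⟩ := h.exists_momentBound S
  ⟨M, fun s hs => ⟨h.1 s hs.1, hM s hs⟩⟩

theorem velocity_eq (hK : VariationBound f g y μ M K) {s t : ℝ} (hρ : BddPath (ρ s) M)
    (ht : t ∈ Icc (0 : ℝ) 1) (θ : Euc k) : velocity f g y μ ρ t s θ =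
      -(gradient (costVariation f g y μ (ρ s) t) θ + (2 * Real.exp (-s)) • θ) := by
  rw [velocity, hK.gradient_regCostVariation hρ ht]

theorem IsFlowPath.eventually_W2Le (h : IsFlowPath ρ) {s₀ : ℝ} (hs₀ : 0 ≤ s₀) {w : ℝ}
    (hw : 0 < w) :
    ∀ᶠ s in 𝓝[Ici 0] s₀, ∀ t ∈ Icc (0 : ℝ) 1, W2Le (ρ s t) (ρ s₀ t) w := by
  filter_upwards [(h.2 s₀ hs₀).eventually_lt_const (u := ENNReal.ofReal w) (by simpa)]
    with s hs t ht
  exact (W2Le.of_d1_lt hs ht).2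

/-- The summand `2` is the Lipschitz constant of `2 e^{-s} θ` for `s ≥ 0`. Continuity in `s` follows
from continuity of the flow in `d1` through `gradient_sub_path`. -/
theorem lipField_velocity (hK : VariationBound f g y μ M K) (h : IsFlowPath ρ) (hS : 0 ≤ S)
    (hρ : ∀ s ∈ Icc (0 : ℝ) S, BddPath (ρ s) M) {t : ℝ} (ht : t ∈ Icc (0 : ℝ) 1) :
    LipField (velocity f g y μ ρ t) S (K + 2) := by
  refine ⟨hS, by have := hK.nonneg; positivity, fun s hs θ θ' => ?_, fun θ => ?_⟩
  · rw [velocity_eq hK (hρ s hs) ht, velocity_eq hK (hρ s hs) ht, ← norm_neg]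
    have e : ∀ (a b : Euc k) (c : ℝ), -(-(a + c • θ) - -(b + c • θ')) = (a - b) + c • (θ - θ') := by
      intros; module
    rw [e]
    refine (norm_add_le _ _).trans ?_
    rw [add_mul]
    refine add_le_add (hK.gradient_sub (ρ s) (hρ s hs) t ht θ θ') ?_
    rw [norm_smul, Real.norm_of_nonneg (by positivity)]
    have : Real.exp (-s) ≤ 1 := Real.exp_le_one_iff.2 (by linarith [hs.1])
    gcongr
    linarith
  · refine ContinuousOn.congr (f := fun s =>
      -(gradient (costVariation f g y μ (ρ s) t) θ + (2 * Real.exp (-s)) • θ)) ?_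
      fun s hs => velocity_eq hK (hρ s hs) ht θ
    have h1 : ContinuousOn (fun s : ℝ => (2 * Real.exp (-s)) • θ) (Icc 0 S) := by fun_prop
    refine (ContinuousOn.add ?_ h1).neg
    intro s₀ hs₀
    rw [ContinuousWithinAt, Metric.tendsto_nhds]
    intro ε hε
    have hKn := hK.nonneg
    have hw : 0 < ε / (K * (1 + ‖θ‖) + 1) := by positivity
    filter_upwards [nhdsWithin_mono s₀ Icc_subset_Ici_self (h.eventually_W2Le hs₀.1 hw),
      self_mem_nhdsWithin] with s hs hsI
    rw [dist_eq_norm]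
    refine (hK.gradient_sub_path _ _ (hρ s hsI) (hρ s₀ hs₀) _ hw hs t ht θ).trans_lt ?_
    rw [← mul_div_assoc, div_lt_iff₀ (by positivity)]
    nlinarith

theorem isWeakSolution_velocity (h : IsGradientFlow f g y μ ρini ρ) {t : ℝ}
    (ht : t ∈ Icc (0 : ℝ) 1) : IsWeakSolution (velocity f g y μ ρ t) S (fun s => ρ s t) := by
  have hp : ∀ s, 0 ≤ s → IsProbabilityMeasure (ρ s t) := fun s hs =>
    ((h.isFlowPath.1 s hs).1 t ht).1
  refine ⟨fun s hs => hp s hs.1, fun φ hφ hc s₀ hs₀ => ?_, fun φ hφ hc s hs => ?_⟩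
  · rw [ContinuousWithinAt, Metric.tendsto_nhds]
    intro ε hε
    obtain ⟨w, hw, hw'⟩ := eventually_abs_integral_sub_lt hφ hc hε
    filter_upwards [nhdsWithin_mono s₀ Icc_subset_Ici_self
      (h.isFlowPath.eventually_W2Le hs₀.1 hw), self_mem_nhdsWithin] with s hs hsI
    exact hw' _ _ (hp s hsI.1) (hp s₀ hs₀.1) (hs t ht)
  · have := h.equation φ hφ hc t ht s hs.1
    convert! this using 1
    rw [← integral_neg]
    refine integral_congr_ae (ae_of_all _ fun θ => ?_)
    simp only [velocity, map_neg, neg_inj]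
    rw [inner_gradient_left]

/-- Two gradient flows with the same initial value, at distance at most `N e^{ls}`, are at distance
at most `(N/2) e^{ls}` if `l` is large. -/
theorem halve_distance (hK : VariationBound f g y μ M K) (h : IsGradientFlow f g y μ ρini ρ)
    (h' : IsGradientFlow f g y μ ρini ρ') (hS : 0 ≤ S)
    (hρ : ∀ s ∈ Icc (0 : ℝ) S, BddPath (ρ s) M) (hρ' : ∀ s ∈ Icc (0 : ℝ) S, BddPath (ρ' s) M)
    {G l N : ℝ} (hG : G = (1 + K * S) * Real.exp ((K + 2) * S))
    (hl : l = 8 * ((K + 1) * (1 + G)) * (1 + M) + 2 * (K + 2) + 1) (hN : 0 < N)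
    (hd : ∀ s ∈ Icc (0 : ℝ) S, ∀ t ∈ Icc (0 : ℝ) 1,
      W2Le (ρ s t) (ρ' s t) (N * Real.exp (l * s))) :
    ∀ s ∈ Icc (0 : ℝ) S, ∀ t ∈ Icc (0 : ℝ) 1,
      W2Le (ρ s t) (ρ' s t) (N / 2 * Real.exp (l * s)) := by
  intro s hs t ht
  have hKn := hK.nonneg
  have hG0 : 0 ≤ G := by rw [hG]; positivity
  have h0S : (0 : ℝ) ∈ Icc 0 S := ⟨le_rfl, hS⟩
  have hM0 : MomentBound (ρ 0 t) M := (hρ 0 h0S).moment t ht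
  have hMpos := hM0.pos
  have hlpos : 0 < l := by rw [hl]; positivity
  have hv := lipField_velocity hK h.isFlowPath hS hρ ht
  have hv' := lipField_velocity hK h'.isFlowPath hS hρ' ht
  obtain ⟨Ξ, hΞ⟩ := hv.exists_flow
  obtain ⟨Ξ', hΞ'⟩ := hv'.exists_flow
  have hs0 : (0 : ℝ) ∈ Icc 0 s := ⟨le_rfl, hs.1⟩
  -- Both flows are images of the same initial measure, so the pair of characteristics is a
  -- coupling.
  have e1 : ρ s t = (ρ 0 t).map fun θ => Ξ 0 θ s :=
    (hv.mono hs.1 hs.2).eq_map_flow (hΞ.mono hs.2) (isWeakSolution_velocity h ht)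
  have e2 : ρ' s t = (ρ 0 t).map fun θ => Ξ' 0 θ s := by
    have := (hv'.mono hs.1 hs.2).eq_map_flow (hΞ'.mono hs.2) (isWeakSolution_velocity h' ht)
    rwa [h'.initial t ht, ← h.initial t ht] at this
  -- Amplitude of the source `‖v - v'‖` along a characteristic, up to the weight `1 + ‖θ‖`. Using `K
  -- + 1` instead of `K` keeps it positive.
  set A : ℝ := (K + 1) * (1 + G) * N with hA
  have hA0 : 0 < A := by positivity
  have hdist : ∀ θ, ‖Ξ 0 θ s - Ξ' 0 θ s‖ ≤ 2 * A / l * Real.exp (l * s) * (1 + ‖θ‖) := by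
    intro θ
    -- Converts the weight `1 + ‖·‖`, taken at the moving point, into one at the starting point,
    -- where the initial second moment controls it.
    have hgrow : ∀ r ∈ Icc 0 S, ‖Ξ' 0 θ r‖ ≤ G * (1 + ‖θ‖) := by
      intro r hr
      have := norm_le_of_hasDerivWithinAt (K := K + 2) (ε := K) (u := Ξ' 0 θ) (by positivity) hKn
        (hΞ' 0 h0S θ).2 (fun q hq => ?_) h0S hr
      · rw [(hΞ' 0 h0S θ).1, sub_zero, abs_of_nonneg hr.1] at this
        refine this.trans ?_
        have hr1 := hr.1
        calc (‖θ‖ + K * r) * Real.exp ((K + 2) * r)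
            ≤ (‖θ‖ + K * S) * Real.exp ((K + 2) * S) := by gcongr; exacts [hr.2, hr.2]
          _ ≤ ((1 + K * S) * (1 + ‖θ‖)) * Real.exp ((K + 2) * S) := by
              gcongr
              have : 0 ≤ K * S * ‖θ‖ := by positivity
              nlinarith
          _ = G * (1 + ‖θ‖) := by rw [hG]; ring
      · rw [velocity_eq hK (hρ' q hq) ht, norm_neg]
        refine (norm_add_le _ _).trans ?_
        have h1 := hK.norm_gradient (ρ' q) (hρ' q hq) t ht (Ξ' 0 θ q)
        rw [norm_smul, Real.norm_of_nonneg (by positivity)]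
        have h2 : Real.exp (-q) ≤ 1 := Real.exp_le_one_iff.2 (by linarith [hq.1])
        have h3 := norm_nonneg (Ξ' 0 θ q)
        nlinarith
    have := norm_le_exp_of_hasDerivWithinAt (K := K + 2) (A := A * (1 + ‖θ‖)) (l := l) (b := S)
      (u := fun r => Ξ 0 θ r - Ξ' 0 θ r) (by positivity) ?_ hlpos
      (fun r hr => ((hΞ 0 h0S θ).2 r hr).sub ((hΞ' 0 h0S θ).2 r hr))
      (by simp only [(hΞ 0 h0S θ).1, (hΞ' 0 h0S θ).1, sub_self]) (fun r hr => ?_) hs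
    · refine this.trans (le_of_eq ?_)
      ring
    · rw [hl]
      have : 0 < 8 * ((K + 1) * (1 + G)) * (1 + M) := by positivity
      linarith
    · have h1 := hv.lip r hr (Ξ 0 θ r) (Ξ' 0 θ r)
      have h2 := hK.gradient_sub_path _ _ (hρ r hr) (hρ' r hr) _ (by positivity)
        (hd r hr) t ht (Ξ' 0 θ r)
      have e : velocity f g y μ ρ t r (Ξ' 0 θ r) - velocity f g y μ ρ' t r (Ξ' 0 θ r) =
          -(gradient (costVariation f g y μ (ρ r) t) (Ξ' 0 θ r) -
            gradient (costVariation f g y μ (ρ' r) t) (Ξ' 0 θ r)) := by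
        rw [velocity_eq hK (hρ r hr) ht, velocity_eq hK (hρ' r hr) ht]; abel
      refine (norm_sub_le_norm_sub_add_norm_sub _ (velocity f g y μ ρ t r (Ξ' 0 θ r)) _).trans ?_
      rw [e, norm_neg]
      refine add_le_add h1 (h2.trans ?_)
      have h3 := hgrow r hr
      have h4 : K * (1 + ‖Ξ' 0 θ r‖) ≤ (K + 1) * (1 + G) * (1 + ‖θ‖) := by
        calc K * (1 + ‖Ξ' 0 θ r‖) ≤ (K + 1) * ((1 + ‖θ‖) + G * (1 + ‖θ‖)) := by
              gcongr
              · linarith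
              · linarith [norm_nonneg θ]
          _ = _ := by ring
      calc _ ≤ ((K + 1) * (1 + G) * (1 + ‖θ‖)) * (N * Real.exp (l * r)) := by gcongr
        _ = _ := by rw [hA]; ring
  have hW := W2Le.of_map hM0 (hv.continuous_flow hΞ h0S hs) (hv'.continuous_flow hΞ' h0S hs)
    hdist
  rw [← e1, ← e2] at hW
  refine hW.mono (by positivity) ?_
  -- This is the reason for the first term of `l`. The term `2 * (K + 2) + 1` met the requirement of
  -- the exponential Grönwall bound.
  have h5 : 2 * A / l * (2 * (1 + M)) ≤ N / 2 := by
    rw [div_mul_eq_mul_div, div_le_div_iff₀ hlpos (by norm_num), hA, hl]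
    have : 0 ≤ N * (2 * (K + 2) + 1) := by positivity
    nlinarith
  calc 2 * A / l * Real.exp (l * s) * (2 * (1 + M))
      = 2 * A / l * (2 * (1 + M)) * Real.exp (l * s) := by ring
    _ ≤ _ := by gcongr

/-- The gradient flow is determined by its initial value. -/
theorem IsGradientFlow.W2Le_of_initial_eq (hA : StandingAssumption f g y μ)
    (h : IsGradientFlow f g y μ ρini ρ) (h' : IsGradientFlow f g y μ ρini ρ') {s : ℝ}
    (hs : 0 ≤ s) {w : ℝ} (hw : 0 < w) : ∀ t ∈ Icc (0 : ℝ) 1, W2Le (ρ s t) (ρ' s t) w := by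
  intro t ht
  obtain ⟨M₁, hM₁⟩ := h.isFlowPath.exists_bddPath s
  obtain ⟨M₂, hM₂⟩ := h'.isFlowPath.exists_bddPath s
  set M := max M₁ M₂
  have hρ : ∀ r ∈ Icc (0 : ℝ) s, BddPath (ρ r) M := fun r hr =>
    ⟨(hM₁ r hr).isPath, fun t ht => ((hM₁ r hr).moment t ht).mono (le_max_left _ _)⟩
  have hρ' : ∀ r ∈ Icc (0 : ℝ) s, BddPath (ρ' r) M := fun r hr =>
    ⟨(hM₂ r hr).isPath, fun t ht => ((hM₂ r hr).moment t ht).mono (le_max_right _ _)⟩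
  have hsI : s ∈ Icc 0 s := ⟨hs, le_rfl⟩
  have hM0 : 0 < M := (hρ s hsI).pos
  obtain ⟨K, hK⟩ := hA.exists_variationBound M
  set G := (1 + K * s) * Real.exp ((K + 2) * s) with hG
  set l := 8 * ((K + 1) * (1 + G)) * (1 + M) + 2 * (K + 2) + 1 with hl
  have hKn := hK.nonneg
  have hl0 : 0 ≤ l := by positivity
  -- The product coupling gives distance at most `2 * M` to start with, and each application of
  -- `halve_distance` gains a factor `1/2`.
  have key : ∀ n : ℕ, ∀ r ∈ Icc (0 : ℝ) s, ∀ t ∈ Icc (0 : ℝ) 1,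
      W2Le (ρ r t) (ρ' r t) (2 * M * (1 / 2) ^ n * Real.exp (l * r)) := by
    intro n
    induction n with
    | zero =>
      intro r hr t ht
      refine (W2Le.of_momentBound ((hρ r hr).moment t ht) ((hρ' r hr).moment t ht)).mono
        (by positivity) ?_
      have : 1 ≤ Real.exp (l * r) := Real.one_le_exp (mul_nonneg hl0 hr.1)
      rw [pow_zero, mul_one]
      exact le_mul_of_one_le_right (by positivity) this
    | succ n ih =>
      have := halve_distance hK h h' hs hρ hρ' hG hl (by positivity) ih
      have e : (2 * M * (1 / 2 : ℝ) ^ (n + 1)) = 2 * M * (1 / 2) ^ n / 2 := by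
        rw [pow_succ]; ring
      rwa [e]
  have hlim : Tendsto (fun n : ℕ => 2 * M * (1 / 2 : ℝ) ^ n * Real.exp (l * s)) atTop (𝓝 0) := by
    have := ((tendsto_pow_atTop_nhds_zero_of_lt_one (r := (1 / 2 : ℝ)) (by norm_num)
      (by norm_num)).const_mul (2 * M)).mul_const (Real.exp (l * s))
    simpa using this
  obtain ⟨n, hn⟩ := (hlim.eventually_lt_const hw).exists
  exact (key n s hsI t ht).mono (by positivity) hn.le

end

/-! ### Long-time limits are stationary -/

/-- If a function and its derivative converge at infinity, the derivative tends to zero. -/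
theorem eq_zero_of_tendsto_deriv {F J : ℝ → ℝ} {l j : ℝ}
    (hF : ∀ s, 0 < s → HasDerivAt F (J s) s) (hl : Tendsto F atTop (𝓝 l))
    (hj : Tendsto J atTop (𝓝 j)) : j = 0 := by
  -- By the mean value theorem on `[s, s + 1]`, the increment `F (s + 1) - F s`, which tends to
  -- zero, is a value of `J` at a point going to infinity.
  have hmvt : ∀ s : ℝ, ∃ ξ, 0 < s → s < ξ ∧ J ξ = F (s + 1) - F s := fun s => by
    by_cases hs : 0 < s
    · obtain ⟨ξ, hξ, h⟩ := exists_hasDerivAt_eq_slope F J (lt_add_one s)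
        (fun r hr => (hF r (hs.trans_le hr.1)).continuousAt.continuousWithinAt)
        fun r hr => hF r (hs.trans hr.1)
      exact ⟨ξ, fun _ => ⟨hξ.1, by rw [h]; simp⟩⟩
    · exact ⟨0, fun h => absurd h hs⟩
  choose ξ hξ using hmvt
  have hξt : Tendsto ξ atTop atTop := by
    refine tendsto_atTop_mono' atTop ?_ tendsto_id
    filter_upwards [eventually_gt_atTop 0] with s hs using (hξ s hs).1.le
  have h1 : Tendsto (fun s => F (s + 1) - F s) atTop (𝓝 (l - l)) :=
    (hl.comp (tendsto_atTop_add_const_right atTop 1 tendsto_id)).sub hl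
  rw [sub_self] at h1
  refine tendsto_nhds_unique (hj.comp hξt) (h1.congr' ?_)
  filter_upwards [eventually_gt_atTop 0] with s hs using (hξ s hs).2.symm

section

variable {d k : ℕ} {f : Euc d → Euc k → Euc d} {g y : Euc d → ℝ} {μ : Measure (Euc d)}
  {ρini : ℝ → Measure (Euc k)} {ρ : ℝ → ℝ → Measure (Euc k)} {ρinf : ℝ → Measure (Euc k)}
  {M K R L C : ℝ}

theorem HasFullySupportedLimit.exists_bddPath (h : HasFullySupportedLimit ρ ρinf)
    (hρ : IsFlowPath ρ) : ∃ M, BddPath ρinf M ∧ ∀ᶠ s in atTop, BddPath (ρ s) M := by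
  obtain ⟨M, hM⟩ := h.isPath.exists_momentBound
  have hpos := (hM 0 (by simp)).pos
  refine ⟨2 * (M + 1), ⟨h.isPath, fun t ht => (hM t ht).mono (by linarith)⟩, ?_⟩
  filter_upwards [h.tendsto.eventually_lt_const (u := ENNReal.ofReal 1) (by simp),
    eventually_ge_atTop 0] with s hs hs0
  exact ⟨hρ.1 s hs0, momentBound_of_d1_lt hs hM⟩

theorem HasFullySupportedLimit.eventually_W2Le (h : HasFullySupportedLimit ρ ρinf) {w : ℝ}
    (hw : 0 < w) : ∀ᶠ s in atTop, ∀ t ∈ Icc (0 : ℝ) 1, W2Le (ρ s t) (ρinf t) w := by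
  filter_upwards [h.tendsto.eventually_lt_const (u := ENNReal.ofReal w) (by simpa)] with s hs t ht
  exact (W2Le.of_d1_lt hs ht).2

theorem VariationBound.continuous_gradient (hK : VariationBound f g y μ M K)
    {ρ : ℝ → Measure (Euc k)} (hρ : BddPath ρ M) {t : ℝ} (ht : t ∈ Icc (0 : ℝ) 1) :
    Continuous (gradient (costVariation f g y μ ρ t)) :=
  (LipschitzWith.of_dist_le_mul (K := ⟨K, hK.nonneg⟩) fun θ θ' => by
    rw [dist_eq_norm, dist_eq_norm]; exact hK.gradient_sub ρ hρ t ht θ θ').continuous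

theorem HasCompactSupport.fderiv_apply {h : Euc k → ℝ} (hc : HasCompactSupport h)
    (u : Euc k → Euc k) : HasCompactSupport fun θ => fderiv ℝ h θ (u θ) :=
  (hc.fderiv (𝕜 := ℝ)).mono fun θ hθ h0 => hθ (by simp [h0])

/-- Stationarity of the limit. The weak equation passes to the limit `s → ∞`, and since the tested
integrals converge, the limit of their derivatives can only be zero. -/
theorem integral_fderiv_gradient_limit_eq_zero (hK : VariationBound f g y μ M K)
    (hflow : IsGradientFlow f g y μ ρini ρ) (hlim : HasFullySupportedLimit ρ ρinf)
    (hinf : BddPath ρinf M) (hρ : ∀ᶠ s in atTop, BddPath (ρ s) M) {t : ℝ}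
    (ht : t ∈ Icc (0 : ℝ) 1) {h : Euc k → ℝ} (hh : ContDiff ℝ ((⊤ : ℕ∞) : WithTop ℕ∞) h)
    (hc : HasCompactSupport h) :
    ∫ θ, fderiv ℝ h θ (gradient (costVariation f g y μ ρinf t) θ) ∂(ρinf t) = 0 := by
  have hKn := hK.nonneg
  have hpinf := (hinf.moment t ht).prob
  have hfc : Continuous (fderiv ℝ h) := hh.continuous_fderiv (by simp)
  set ψ : Euc k → ℝ := fun θ => fderiv ℝ h θ (gradient (costVariation f g y μ ρinf t) θ) with hψ
  have hψc : Continuous ψ := hfc.clm_apply (hK.continuous_gradient hinf ht)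
  have hψs : HasCompactSupport ψ := HasCompactSupport.fderiv_apply hc _
  have hwc : Continuous fun θ => (1 + ‖θ‖) • fderiv ℝ h θ := by fun_prop
  have hws : HasCompactSupport fun θ => (1 + ‖θ‖) • fderiv ℝ h θ :=
    (hc.fderiv (𝕜 := ℝ)).mono fun θ hθ h0 => hθ (by simp [h0])
  -- Compact support of `h` absorbs the weight `1 + ‖θ‖` both in the path dependence and in the
  -- regularizing term `2 e^{-s} θ`.
  obtain ⟨B, hB⟩ := hws.exists_bound_of_continuous hwc
  have hB' : ∀ θ, (1 + ‖θ‖) * ‖fderiv ℝ h θ‖ ≤ B := fun θ => by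
    have := hB θ
    rwa [norm_smul, Real.norm_of_nonneg (by positivity)] at this
  have hB0 : 0 ≤ B := (norm_nonneg _).trans (hB 0)
  have hFlim : Tendsto (fun s => ∫ θ, h θ ∂(ρ s t)) atTop (𝓝 (∫ θ, h θ ∂(ρinf t))) := by
    rw [Metric.tendsto_nhds]
    intro ε hε
    obtain ⟨w, hw, hw'⟩ := eventually_abs_integral_sub_lt hh.continuous hc hε
    filter_upwards [hlim.eventually_W2Le hw, hρ] with s hs hρs
    exact hw' _ _ (hρs.moment t ht).prob hpinf (hs t ht)
  -- Three errors are balanced: the change of measure under the fixed integrand `ψ` (`ε/2`), the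
  -- change of the potential (`ε/4`), and the regularization (`ε/4`).
  have hJlim : Tendsto (fun s => -∫ θ, inner ℝ (gradient h θ)
      (gradient (regCostVariation f g y μ s (ρ s) t) θ) ∂(ρ s t)) atTop
      (𝓝 (-∫ θ, ψ θ ∂(ρinf t))) := by
    refine Tendsto.neg ?_
    rw [Metric.tendsto_nhds]
    intro ε hε
    obtain ⟨w₁, hw₁, hw₁'⟩ := eventually_abs_integral_sub_lt hψc hψs (half_pos hε)
    have hw₂ : 0 < ε / (4 * (B * K + 1)) := by positivity
    have hexp : Tendsto (fun s : ℝ => B * (2 * Real.exp (-s))) atTop (𝓝 0) := by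
      have := (Real.tendsto_exp_neg_atTop_nhds_zero.const_mul 2).const_mul B
      simpa using this
    filter_upwards [hlim.eventually_W2Le hw₁, hlim.eventually_W2Le hw₂, hρ,
      hexp.eventually_lt_const (show 0 < ε / 4 by positivity)] with s hs₁ hs₂ hρs hs₃
    have hp := (hρs.moment t ht).prob
    set χ : Euc k → ℝ := fun θ => fderiv ℝ h θ
      (gradient (costVariation f g y μ (ρ s) t) θ + (2 * Real.exp (-s)) • θ) with hχ
    have hχc : Continuous χ :=
      hfc.clm_apply ((hK.continuous_gradient hρs ht).add (by fun_prop))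
    have e : ∀ θ, inner ℝ (gradient h θ) (gradient (regCostVariation f g y μ s (ρ s) t) θ) =
        χ θ := fun θ => by
      rw [inner_gradient_left, hK.gradient_regCostVariation hρs ht]
    simp only [e]
    have iχ : Integrable χ (ρ s t) :=
      hχc.integrable_of_hasCompactSupport (HasCompactSupport.fderiv_apply hc _)
    have iψ : Integrable ψ (ρ s t) := hψc.integrable_of_hasCompactSupport hψs
    have h1 : |∫ θ, ψ θ ∂(ρ s t) - ∫ θ, ψ θ ∂(ρinf t)| < ε / 2 :=
      hw₁' _ _ hp hpinf (hs₁ t ht)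
    have h2 : |∫ θ, χ θ ∂(ρ s t) - ∫ θ, ψ θ ∂(ρ s t)| ≤
        B * (K * (ε / (4 * (B * K + 1))) + 2 * Real.exp (-s)) := by
      rw [← integral_sub iχ iψ]
      have := norm_integral_le_of_norm_le_const (μ := ρ s t) (f := fun θ => χ θ - ψ θ)
        (C := B * (K * (ε / (4 * (B * K + 1))) + 2 * Real.exp (-s))) (ae_of_all _ fun θ => ?_)
      · simpa using this
      · simp only [hχ, hψ]
        rw [← map_sub]
        refine (ContinuousLinearMap.le_opNorm _ _).trans ?_
        have h3 := hK.gradient_sub_path _ _ hρs hinf _ hw₂ hs₂ t ht θ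
        have h4 : ‖gradient (costVariation f g y μ (ρ s) t) θ + (2 * Real.exp (-s)) • θ -
            gradient (costVariation f g y μ ρinf t) θ‖ ≤
            (1 + ‖θ‖) * (K * (ε / (4 * (B * K + 1))) + 2 * Real.exp (-s)) := by
          rw [add_sub_right_comm]
          refine (norm_add_le _ _).trans ?_
          rw [norm_smul, Real.norm_of_nonneg (by positivity)]
          have := Real.exp_pos (-s)
          nlinarith
        calc _ ≤ ‖fderiv ℝ h θ‖ *
              ((1 + ‖θ‖) * (K * (ε / (4 * (B * K + 1))) + 2 * Real.exp (-s))) := by gcongr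
          _ = ((1 + ‖θ‖) * ‖fderiv ℝ h θ‖) *
              (K * (ε / (4 * (B * K + 1))) + 2 * Real.exp (-s)) := by ring
          _ ≤ _ := by gcongr; exact hB' θ
    have h5 : B * (K * (ε / (4 * (B * K + 1)))) ≤ ε / 4 := by
      have : B * (K * (ε / (4 * (B * K + 1)))) = (B * K / (B * K + 1)) * (ε / 4) := by
        field_simp
      rw [this]
      refine mul_le_of_le_one_left (by positivity) ?_
      rw [div_le_one (by positivity)]
      linarith
    rw [Real.dist_eq]
    rw [abs_lt] at h1 ⊢
    rw [abs_le] at h2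
    rw [mul_add] at h2
    constructor <;> linarith
  have := eq_zero_of_tendsto_deriv (fun s hs => hflow.equation h hh hc t ht s hs) hFlim hJlim
  linarith

/-- The potential itself is only `C¹`, so the class of test functions is enlarged by approximation
in the `C¹` norm, using that the gradient of the potential is bounded. -/
theorem integral_fderiv_gradient_eq_zero_of_contDiff (hK : VariationBound f g y μ M K)
    (hinf : BddPath ρinf M) {t : ℝ} (ht : t ∈ Icc (0 : ℝ) 1)
    (hst : ∀ h : Euc k → ℝ, ContDiff ℝ ((⊤ : ℕ∞) : WithTop ℕ∞) h → HasCompactSupport h →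
      ∫ θ, fderiv ℝ h θ (gradient (costVariation f g y μ ρinf t) θ) ∂(ρinf t) = 0)
    {h : Euc k → ℝ} (hh : ContDiff ℝ 1 h) (hc : HasCompactSupport h) :
    ∫ θ, fderiv ℝ h θ (gradient (costVariation f g y μ ρinf t) θ) ∂(ρinf t) = 0 := by
  have hp := (hinf.moment t ht).prob
  have hKn := hK.nonneg
  have hgc := hK.continuous_gradient hinf ht
  refine abs_nonpos_iff.1 (le_of_forall_pos_le_add fun ε hε => ?_)
  rw [zero_add]
  obtain ⟨h', hh', hc', hn⟩ := exists_test_function_fderiv_near hh hc (ε := ε / (K + 1))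
    (by positivity)
  have i1 := ((hh.continuous_fderiv one_ne_zero).clm_apply hgc).integrable_of_hasCompactSupport
    (μ := ρinf t) (HasCompactSupport.fderiv_apply hc _)
  have i2 := ((hh'.continuous_fderiv (by simp)).clm_apply hgc).integrable_of_hasCompactSupport
    (μ := ρinf t) (HasCompactSupport.fderiv_apply hc' _)
  rw [← sub_zero (∫ θ, fderiv ℝ h θ _ ∂(ρinf t)), ← hst h' hh' hc', ← integral_sub i1 i2]
  have := norm_integral_le_of_norm_le_const (μ := ρinf t) (C := ε / (K + 1) * K)
    (f := fun θ => fderiv ℝ h θ (gradient (costVariation f g y μ ρinf t) θ) -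
      fderiv ℝ h' θ (gradient (costVariation f g y μ ρinf t) θ)) (ae_of_all _ fun θ => by
        rw [← _root_.sub_apply]
        refine (ContinuousLinearMap.le_opNorm _ _).trans ?_
        have := hn θ
        rw [norm_sub_rev] at this
        exact mul_le_mul this (hK.norm_gradient ρinf hinf t ht θ) (norm_nonneg _) (by positivity))
  rw [probReal_univ, mul_one] at this
  refine this.trans ?_
  rw [div_mul_eq_mul_div, div_le_iff₀ (by positivity)]
  nlinarith

/-- A stationary potential with bounded gradient is critical almost everywhere. -/
theorem integral_norm_gradient_sq_eq_zero {ν : Measure (Euc k)} (hM : MomentBound ν M)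
    {V : Euc k → ℝ} (hV : ContDiff ℝ 1 V) (hK : ∀ θ, ‖gradient V θ‖ ≤ K)
    (hst : ∀ h : Euc k → ℝ, ContDiff ℝ 1 h → HasCompactSupport h →
      ∫ θ, fderiv ℝ h θ (gradient V θ) ∂ν = 0) : ∫ θ, ‖gradient V θ‖ ^ 2 ∂ν = 0 := by
  have hp := hM.prob
  have hK0 : 0 ≤ K := (norm_nonneg _).trans (hK 0)
  have hVf : ∀ θ, ‖fderiv ℝ V θ‖ ≤ K := fun θ => by
    have := hK θ
    rwa [gradient, LinearIsometryEquiv.norm_map] at this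
  have hgc : Continuous (gradient V) :=
    (InnerProductSpace.toDual ℝ (Euc k)).symm.continuous.comp
      (hV.continuous_fderiv one_ne_zero)
  have hVd := hV.differentiable one_ne_zero
  have hVg : ∀ θ, |V θ| ≤ |V 0| + K * ‖θ‖ := fun θ => by
    have := convex_univ.norm_image_sub_le_of_norm_fderiv_le (𝕜 := ℝ) (f := V)
      (fun z _ => hVd z) (fun z _ => hVf z) (mem_univ 0) (mem_univ θ)
    rw [sub_zero] at this
    have h2 := norm_sub_norm_le (V θ) (V 0)
    simp only [Real.norm_eq_abs] at this h2
    linarith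
  set χ : ContDiffBump (0 : Euc k) := ⟨1, 2, one_pos, by norm_num⟩ with hχ
  obtain ⟨B, hB⟩ := (χ.hasCompactSupport.fderiv (𝕜 := ℝ)).exists_bound_of_continuous
    ((χ.contDiff (n := 1)).continuous_fderiv one_ne_zero)
  have hB0 : 0 ≤ B := (norm_nonneg _).trans (hB 0)
  have hχd : ∀ θ, DifferentiableAt ℝ χ θ := fun θ =>
    (χ.contDiff (n := 1)).differentiable one_ne_zero θ
  -- Scale of the cutoff `X n`: its gradient is of order `a n`, which wins against the linear growth
  -- of `V` once the first moment is finite.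
  set a : ℕ → ℝ := fun n => 1 / ((n : ℝ) + 1) with ha
  have ha0 : ∀ n, 0 < a n := fun n => by positivity
  set X : ℕ → Euc k → ℝ := fun n θ => χ (a n • θ) with hX
  have hXd : ∀ n θ, HasFDerivAt (X n) (a n • fderiv ℝ χ (a n • θ)) θ := fun n θ => by
    have h1 : HasFDerivAt (fun θ : Euc k => a n • θ) (a n • ContinuousLinearMap.id ℝ (Euc k)) θ :=
      (hasFDerivAt_id θ).const_smul (a n)
    have h2 := (hχd (a n • θ)).hasFDerivAt.comp θ h1
    convert! h2 using 1
    ext v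
    simp
  have hXc : ∀ n, ContDiff ℝ 1 (X n) := fun n =>
    χ.contDiff.comp (contDiff_const_smul (a n))
  have hXs : ∀ n, HasCompactSupport (X n) := fun n =>
    χ.hasCompactSupport.comp_smul (ha0 n).ne'
  have hder : ∀ n θ, fderiv ℝ (fun θ => V θ * X n θ) θ (gradient V θ) =
      X n θ * ‖gradient V θ‖ ^ 2 + V θ * (a n * fderiv ℝ χ (a n • θ) (gradient V θ)) := by
    intro n θ
    have h1 := ((hVd θ).hasFDerivAt.mul (hXd n θ)).fderiv
    change fderiv ℝ (V * X n) θ _ = _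
    rw [h1]
    have : fderiv ℝ V θ (gradient V θ) = ‖gradient V θ‖ ^ 2 := by
      rw [← inner_gradient_left, real_inner_self_eq_norm_sq]
    simp only [_root_.add_apply, _root_.smul_apply, smul_eq_mul, this]
    ring
  have hX01 : ∀ n θ, 0 ≤ X n θ ∧ X n θ ≤ 1 := fun n θ => ⟨χ.nonneg, χ.le_one⟩
  have i1 : ∀ n, Integrable (fun θ => X n θ * ‖gradient V θ‖ ^ 2) ν := fun n =>
    integrable_of_bound (B := K ^ 2) ((hXc n).continuous.mul (by fun_prop)) fun θ => by
      have h1 := hX01 n θ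
      rw [norm_mul, Real.norm_of_nonneg h1.1, Real.norm_of_nonneg (by positivity)]
      have := hK θ
      calc X n θ * ‖gradient V θ‖ ^ 2 ≤ 1 * K ^ 2 := by gcongr; exact h1.2
        _ = K ^ 2 := one_mul _
  have hb2 : ∀ n θ, ‖V θ * (a n * fderiv ℝ χ (a n • θ) (gradient V θ))‖ ≤
      a n * (B * K * |V 0|) + a n * (B * K * K) * ‖θ‖ + 0 * ‖θ‖ ^ 2 := fun n θ => by
    rw [norm_mul, norm_mul, Real.norm_of_nonneg (ha0 n).le, Real.norm_eq_abs]
    have h1 : ‖fderiv ℝ χ (a n • θ) (gradient V θ)‖ ≤ B * K :=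
      (ContinuousLinearMap.le_opNorm _ _).trans
        (mul_le_mul (hB _) (hK θ) (norm_nonneg _) hB0)
    have := (ha0 n).le
    calc |V θ| * (a n * ‖fderiv ℝ χ (a n • θ) (gradient V θ)‖)
        ≤ (|V 0| + K * ‖θ‖) * (a n * (B * K)) := by gcongr; exact hVg θ
      _ = _ := by ring
  have c2 : ∀ n, Continuous fun θ => V θ * (a n * fderiv ℝ χ (a n • θ) (gradient V θ)) := by
    intro n
    have h1 : Continuous fun θ : Euc k => fderiv ℝ χ (a n • θ) :=
      ((χ.contDiff (n := 1)).continuous_fderiv one_ne_zero).comp (continuous_const_smul (a n))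
    exact hV.continuous.mul (continuous_const.mul (h1.clm_apply hgc))
  have i2 : ∀ n, Integrable (fun θ => V θ * (a n * fderiv ℝ χ (a n • θ) (gradient V θ))) ν :=
    fun n => hM.integrable_of_le (c2 n) (hb2 n)
  have hle : ∀ n, ∫ θ, X n θ * ‖gradient V θ‖ ^ 2 ∂ν ≤ a n * (B * K * |V 0| + B * K * K * M) := by
    intro n
    -- Testing with the truncated potential produces `∫ X n ‖∇V‖²` plus a term carrying the gradient
    -- of the cutoff, of size `O(a n)`.
    have h0 := hst (fun θ => V θ * X n θ) (hV.mul (hXc n)) (hXs n).mul_left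
    simp only [hder] at h0
    rw [integral_add (i1 n) (i2 n)] at h0
    have h1 := hM.norm_integral_le (by have := (ha0 n).le; positivity) le_rfl (hb2 n)
    have h2 := neg_le_of_abs_le h1
    have h3 : a n * (B * K * |V 0| + B * K * K * M) =
      a n * (B * K * |V 0|) + a n * (B * K * K) * M + 0 * M ^ 2 := by ring
    rw [h3]
    linarith
  have hlimX : ∀ θ, Tendsto (fun n => X n θ * ‖gradient V θ‖ ^ 2) atTop
      (𝓝 (‖gradient V θ‖ ^ 2)) := fun θ => by
    have h1 : Tendsto (fun n => a n • θ) atTop (𝓝 ((0 : ℝ) • θ)) :=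
      tendsto_one_div_add_atTop_nhds_zero_nat.smul_const θ
    have h2 : Tendsto (fun n => χ (a n • θ)) atTop (𝓝 (χ ((0 : ℝ) • θ))) :=
      (χ.continuous.tendsto _).comp h1
    rw [zero_smul, χ.one_of_mem_closedBall (by simp [hχ])] at h2
    simpa using h2.mul_const (‖gradient V θ‖ ^ 2)
  have hlim := tendsto_integral_of_dominated_convergence (μ := ν) (fun _ => K ^ 2)
    (fun n => (i1 n).aestronglyMeasurable) (integrable_const _)
    (fun n => ae_of_all _ fun θ => by
      have h1 := hX01 n θ
      rw [norm_mul, Real.norm_of_nonneg h1.1, Real.norm_of_nonneg (by positivity)]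
      have := hK θ
      calc X n θ * ‖gradient V θ‖ ^ 2 ≤ 1 * K ^ 2 := by gcongr; exact h1.2
        _ = K ^ 2 := one_mul _) (ae_of_all _ hlimX)
  have hzero : Tendsto (fun n => a n * (B * K * |V 0| + B * K * K * M)) atTop (𝓝 0) := by
    have := (tendsto_one_div_add_atTop_nhds_zero_nat (𝕜 := ℝ)).mul_const
      (B * K * |V 0| + B * K * K * M)
    rw [zero_mul] at this
    exact this
  exact le_antisymm (le_of_tendsto_of_tendsto' hlim hzero hle)
    (integral_nonneg fun θ => by positivity)

/-- The gradient vanishes almost everywhere and is continuous. The open set where it is nonzero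
would have positive measure if it contained a point. -/
theorem exists_forall_eq_of_full_support {ν : Measure (Euc k)} (hM : MomentBound ν M)
    (hsupp : ν.support = univ)
    {V : Euc k → ℝ} (hV : ContDiff ℝ 1 V) (hK : ∀ θ, ‖gradient V θ‖ ≤ K)
    (hst : ∀ h : Euc k → ℝ, ContDiff ℝ 1 h → HasCompactSupport h →
      ∫ θ, fderiv ℝ h θ (gradient V θ) ∂ν = 0) : ∀ θ, V θ = V 0 := by
  have hp := hM.prob
  have h0 := integral_norm_gradient_sq_eq_zero hM hV hK hst
  have hgc : Continuous (gradient V) :=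
    (InnerProductSpace.toDual ℝ (Euc k)).symm.continuous.comp
      (hV.continuous_fderiv one_ne_zero)
  have hi : Integrable (fun θ => ‖gradient V θ‖ ^ 2) ν :=
    integrable_of_bound (B := K ^ 2) (by fun_prop) fun θ => by
      rw [Real.norm_of_nonneg (by positivity)]
      exact pow_le_pow_left₀ (norm_nonneg _) (hK θ) 2
  rw [integral_eq_zero_iff_of_nonneg (fun θ => by positivity) hi] at h0
  have hgz : ∀ θ, gradient V θ = 0 := by
    intro θ
    by_contra hθ
    have hopen : IsOpen {θ | gradient V θ ≠ 0} := isOpen_ne_fun hgc continuous_const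
    have hmem : θ ∈ ν.support := by rw [hsupp]; trivial
    have hpos := (Measure.mem_support_iff_forall θ).1 hmem _ (hopen.mem_nhds hθ)
    refine hpos.ne' ?_
    have h1 : ∀ᵐ θ ∂ν, gradient V θ = 0 := h0.mono fun θ hθ => by
      simpa using hθ
    exact h1
  intro θ
  refine is_const_of_fderiv_eq_zero (𝕜 := ℝ) (hV.differentiable one_ne_zero) (fun θ => ?_) θ 0
  have := hgz θ
  rw [gradient] at this
  simpa using this

end

/-! ### From a constant first variation to zero cost, and the uniform constant `C₀` -/

variable {d k : ℕ} {f : Euc d → Euc k → Euc d} {g y : Euc d → ℝ} {μ : Measure (Euc d)}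
  {C R M N L K : ℝ} {ρ ρinf ρini : ℝ → Measure (Euc k)}

theorem VariationBound.contDiff_costVariation (hK : VariationBound f g y μ M K)
    (hρ : BddPath ρ M) {t : ℝ} (ht : t ∈ Icc (0 : ℝ) 1) :
    ContDiff ℝ 1 (costVariation f g y μ ρ t) := by
  refine contDiff_one_iff_fderiv.2 ⟨hK.differentiable ρ hρ t ht, ?_⟩
  have := (InnerProductSpace.toDual ℝ (Euc k)).continuous.comp (hK.continuous_gradient hρ ht)
  refine this.congr fun θ => ?_
  simp [gradient]

theorem integrable_of_continuousOn [IsProbabilityMeasure μ] {G : Type*} [NormedAddCommGroup G]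
    {φ : Euc d → G} (hμ : ∀ᵐ x ∂μ, x ∈ Metric.closedBall (0 : Euc d) R)
    (hφ : ContinuousOn φ (Metric.closedBall 0 R)) : Integrable φ μ := by
  have := hφ.integrableOn_compact (μ := μ) (isCompact_closedBall _ _)
  rwa [IntegrableOn, Measure.restrict_eq_self_of_ae_mem hμ] at this

theorem integral_inner_integral_eq [IsProbabilityMeasure μ] (hf : ActivationBound f C)
    (h : StabilityBound f g y R M L) (hμ : ∀ᵐ x ∂μ, x ∈ Metric.closedBall (0 : Euc d) R)
    (hρ : BddPath ρ M) {t : ℝ} (ht : t ∈ Icc (0 : ℝ) 1) {ν : Measure (Euc k)}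
    (hν : MomentBound ν N) :
    ∫ x, (inner ℝ (costate f g y ρ x t) (∫ θ, f (state f ρ x t) θ ∂ν) : ℝ) ∂μ =
      ∫ θ, costVariation f g y μ ρ t θ ∂ν := by
  have := hν.prob
  simp_rw [← integral_inner (hf.integrable hν _)]
  refine integral_integral_swap ?_
  -- State and costate are controlled only for `x` in the ball, so joint measurability is checked on
  -- the product of the ball with `ℝᵏ`, which carries the whole measure.
  have hr : μ.prod ν = (μ.prod ν).restrict (Metric.closedBall 0 R ×ˢ univ) := by
    rw [← Measure.prod_restrict, Measure.restrict_univ, Measure.restrict_eq_self_of_ae_mem hμ]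
  have hm : AEStronglyMeasurable (Function.uncurry fun (x : Euc d) (θ : Euc k) =>
      (inner ℝ (costate f g y ρ x t) (f (state f ρ x t) θ) : ℝ)) (μ.prod ν) := by
    rw [hr]
    exact (continuousOn_integrand hf h hρ ht).aestronglyMeasurable
      (Metric.isClosed_closedBall.measurableSet.prod MeasurableSet.univ)
  have hi : Integrable (fun θ : Euc k => L * (‖f 0 0‖ + C * (L + 1) * ‖θ‖)) ν :=
    hν.integrable_of_le (c₀ := L * ‖f 0 0‖) (c₁ := L * (C * (L + 1))) (c₂ := 0)
      (by fun_prop) fun θ => by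
        have := hf.nonneg
        have := h.nonneg
        rw [Real.norm_of_nonneg (by positivity)]
        apply le_of_eq
        ring
  refine (hi.comp_snd μ).mono' hm ?_
  filter_upwards [Measure.quasiMeasurePreserving_fst.ae hμ] with q hq
  exact abs_integrand_le hf h hρ ht q.2 (by simpa using hq)

/-- For `F = ∫ f(·,θ) dν` this is Fubini, the integral of the constant `c` against a probability
measure being `c`. The density assumption and boundedness of the costate extend it to all continuous
`F`. -/
theorem integral_inner_comp_state_eq (hA : StandingAssumption f g y μ) (hf : ActivationBound f C)
    (h : StabilityBound f g y R M L) (hμ : ∀ᵐ x ∂μ, x ∈ Metric.closedBall (0 : Euc d) R)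
    (hρ : BddPath ρ M) {t : ℝ} (ht : t ∈ Icc (0 : ℝ) 1) {c : ℝ}
    (hc : ∀ θ, costVariation f g y μ ρ t θ = c) (F : C(Euc d, Euc d)) :
    ∫ x, (inner ℝ (costate f g y ρ x t) (F (state f ρ x t)) : ℝ) ∂μ = c := by
  have := hA.prob_μ
  have hL := h.nonneg
  rw [← sub_eq_zero, ← abs_nonpos_iff]
  refine le_of_forall_pos_le_add fun ε hε => ?_
  rw [zero_add]
  -- The radius `L + 1` is positive and covers all states. The precision `ε / (L + 1)` compensates
  -- for the costate bound `L`.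
  obtain ⟨φ, ⟨ν, hν, hφ⟩, hd⟩ := (hA.dense_range (L + 1) (by linarith)).exists_dist_lt
    (F.restrict (Metric.closedBall 0 (L + 1))) (ε := ε / (L + 1)) (by positivity)
  obtain ⟨N, hN⟩ := hν.exists_momentBound
  have hFφ : ∀ z, ‖z‖ ≤ L → ‖F z - ∫ θ, f z θ ∂ν‖ ≤ ε / (L + 1) := fun z hz => by
    have hz' : z ∈ Metric.closedBall (0 : Euc d) (L + 1) := by
      rw [mem_closedBall_zero_iff]; linarith
    have := (ContinuousMap.dist_apply_le_dist (f := F.restrict (Metric.closedBall 0 (L + 1)))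
      (g := φ) ⟨z, hz'⟩).trans hd.le
    rwa [hφ, dist_eq_norm] at this
  have hint := integral_inner_integral_eq hf h hμ hρ ht hN
  simp only [hc, integral_const] at hint
  have := hN.prob
  rw [probReal_univ, one_smul] at hint
  rw [← hint, ← Real.norm_eq_abs]
  have hZ := h.continuousOn_state hρ ht
  have hp := h.continuousOn_costate hρ ht
  have hcν : Continuous fun z => ∫ θ, f z θ ∂ν :=
    (LipschitzWith.of_dist_le_mul (K := ⟨C * N, mul_nonneg hf.nonneg hN.pos.le⟩) fun z z' => by
      rw [dist_eq_norm, dist_eq_norm]; exact hf.integral_sub_left hN z z').continuous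
  refine norm_integral_sub_le_of_forall_le hμ
    (integrable_of_continuousOn hμ (hp.inner (𝕜 := ℝ) (F.continuous.comp_continuousOn hZ)))
    (integrable_of_continuousOn hμ (hp.inner (𝕜 := ℝ) (hcν.comp_continuousOn hZ))) fun x hx => ?_
  rw [← inner_sub_right]
  refine (norm_inner_le_norm _ _).trans ?_
  calc _ ≤ L * (ε / (L + 1)) := by
        gcongr
        · exact h.norm_costate ρ hρ x hx t ht
        · exact hFφ _ (h.norm_state ρ hρ x hx t ht)
    _ ≤ ε := by
        rw [← mul_div_assoc, div_le_iff₀ (by positivity)]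
        nlinarith

/-- If the variation of the cost is constant in the parameter, then the costate vanishes. -/
theorem costate_ae_eq_zero (hA : StandingAssumption f g y μ) (hf : ActivationBound f C)
    (h : StabilityBound f g y R M L) (hμ : ∀ᵐ x ∂μ, x ∈ Metric.closedBall (0 : Euc d) R)
    (hρ : BddPath ρ M) {t : ℝ} (ht : t ∈ Icc (0 : ℝ) 1) {c : ℝ}
    (hc : ∀ θ, costVariation f g y μ ρ t θ = c) : ∀ᵐ x ∂μ, costate f g y ρ x t = 0 := by
  have := hA.prob_μ
  have key := integral_inner_comp_state_eq hA hf h hμ hρ ht hc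
  have hZ := h.continuousOn_state hρ ht
  have hp := h.continuousOn_costate hρ ht
  -- Take `F = 0`.
  have hc0 : c = 0 := by
    have := key 0
    simpa using this.symm
  set B := Metric.closedBall (0 : Euc d) R
  have : CompactSpace B := isCompact_iff_compactSpace.1 (isCompact_closedBall _ _)
  -- The state map is continuous on a compact ball and injective, since its values at `t` determine
  -- those at `0`. Tietze extension then provides `F` with `F(Z) = p` on the ball, and testing with
  -- it yields `𝔼|p|² = c = 0`.
  have he : IsClosedEmbedding (B.domRestrict fun x => state f ρ x t) := by
    refine (continuousOn_iff_continuous_domRestrict.1 hZ).isClosedEmbedding fun x x' hxx => ?_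
    have h0 : (0 : ℝ) ∈ Icc (0 : ℝ) 1 := by simp
    have h1 := hf.norm_state_sub_le hρ x x' h0 ht
    have h2 : state f ρ x t = state f ρ x' t := hxx
    rw [(hf.isState_state hρ x).1, (hf.isState_state hρ x').1, h2, sub_self, norm_zero,
      zero_mul] at h1
    exact Subtype.ext (sub_eq_zero.1 (norm_le_zero_iff.1 h1))
  obtain ⟨F, hF⟩ := ContinuousMap.exists_extension he
    ⟨B.domRestrict fun x => costate f g y ρ x t, continuousOn_iff_continuous_domRestrict.1 hp⟩
  have hF' : ∀ x ∈ B, F (state f ρ x t) = costate f g y ρ x t := fun x hx =>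
    DFunLike.congr_fun hF ⟨x, hx⟩
  have h0 : ∫ x, ‖costate f g y ρ x t‖ ^ 2 ∂μ = 0 := by
    rw [← hc0, ← key F]
    refine integral_congr_ae (hμ.mono fun x hx => ?_)
    simp only
    rw [hF' x hx, real_inner_self_eq_norm_sq]
  have hi : Integrable (fun x => ‖costate f g y ρ x t‖ ^ 2) μ :=
    integrable_of_continuousOn hμ (hp.norm.pow 2)
  rw [integral_eq_zero_iff_of_nonneg (fun x => by positivity) hi] at h0
  filter_upwards [h0] with x hx
  simpa using hx

/-- A costate that is zero at one time is zero at time `1`, where it equals the residual times `∇g`,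
and `∇g` is bounded away from zero. -/
theorem cost_eq_zero_of_costate (hA : StandingAssumption f g y μ) (hf : ActivationBound f C)
    (hρ : BddPath ρ M) {t : ℝ} (ht : t ∈ Icc (0 : ℝ) 1)
    (h0 : ∀ᵐ x ∂μ, costate f g y ρ x t = 0) : cost f g y μ ρ = 0 := by
  obtain ⟨δ, hδ, hg⟩ := hA.grad_g_lower
  rw [cost, ← lintegral_zero (μ := μ)]
  refine lintegral_congr_ae ?_
  filter_upwards [h0] with x hx
  have h1 := hf.norm_costate_le g y hρ x (t := 1) (by simp) ht
  rw [hx, norm_zero, zero_mul, norm_le_zero_iff, (hf.isCostate_costate g y hρ x).1] at h1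
  rcases smul_eq_zero.1 h1 with h2 | h2
  · simp [h2]
  · have := hg (state f ρ x 1)
    rw [h2, norm_zero] at this
    linarith

theorem cost_limit_eq_zero (hA : StandingAssumption f g y μ) {ρ : ℝ → ℝ → Measure (Euc k)}
    (hflow : IsGradientFlow f g y μ ρini ρ) (hlim : HasFullySupportedLimit ρ ρinf) :
    cost f g y μ ρinf = 0 := by
  obtain ⟨C, hf⟩ := hA.exists_activationBound
  obtain ⟨R, -, hμ⟩ := hA.exists_radius
  obtain ⟨M, hM, hev⟩ := hlim.exists_bddPath hflow.isFlowPath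
  obtain ⟨L, h⟩ := hA.exists_stabilityBound R M
  obtain ⟨K, hK⟩ := hA.exists_variationBound M
  obtain ⟨t, ht, hsupp⟩ := hlim.full_support
  have hst : ∀ h : Euc k → ℝ, ContDiff ℝ 1 h → HasCompactSupport h →
      ∫ θ, fderiv ℝ h θ (gradient (costVariation f g y μ ρinf t) θ) ∂(ρinf t) = 0 :=
    fun _ => integral_fderiv_gradient_eq_zero_of_contDiff hK hM ht fun _ hh hc =>
      integral_fderiv_gradient_limit_eq_zero hK hflow hlim hM hev ht hh hc
  exact cost_eq_zero_of_costate hA hf hM ht (costate_ae_eq_zero hA hf h hμ hM ht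
    (exists_forall_eq_of_full_support (hM.moment t ht) hsupp (hK.contDiff_costVariation hM ht)
      (hK.norm_gradient ρinf hM t ht) hst))

/-- Paths at zero distance have the same cost. -/
theorem cost_congr (hA : StandingAssumption f g y μ) {ρ ρ' : ℝ → Measure (Euc k)}
    (hρ : BddPath ρ M) (hρ' : BddPath ρ' M)
    (hW : ∀ w, 0 < w → ∀ t ∈ Icc (0 : ℝ) 1, W2Le (ρ t) (ρ' t) w) :
    cost f g y μ ρ = cost f g y μ ρ' := by
  obtain ⟨R, -, hμ⟩ := hA.exists_radius
  obtain ⟨L, h⟩ := hA.exists_stabilityBound R M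
  have hL := h.nonneg
  refine lintegral_congr_ae (hμ.mono fun x hx => ?_)
  have hx' : ‖x‖ ≤ R := by simpa using hx
  have h0 : state f ρ x 1 - state f ρ' x 1 = 0 := by
    rw [← norm_le_zero_iff]
    refine le_of_forall_pos_le_add fun ε hε => ?_
    have h1 := h.state_sub ρ ρ' hρ hρ' (ε / (L + 1)) (by positivity) (hW _ (by positivity)) x x
      hx' hx' 1 (by simp)
    rw [sub_self, norm_zero, zero_add] at h1
    refine h1.trans ?_
    rw [zero_add, ← mul_div_assoc, div_le_iff₀ (by positivity)]
    nlinarith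
  simp only
  rw [sub_eq_zero.1 h0]

/-- The residual vanishes almost everywhere at the limit path and depends on the path in a Lipschitz
way, uniformly for `x` in the ball, so it is eventually small uniformly in `x`. -/
theorem eventually_cost_le (hA : StandingAssumption f g y μ) {ρ : ℝ → ℝ → Measure (Euc k)}
    (hflow : IsGradientFlow f g y μ ρini ρ) (hlim : HasFullySupportedLimit ρ ρinf)
    {ε : ℝ} (hε : 0 < ε) : ∀ᶠ s in atTop, cost f g y μ (ρ s) ≤ ENNReal.ofReal ε := by
  have := hA.prob_μ
  have hcost := cost_limit_eq_zero hA hflow hlim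
  obtain ⟨R, -, hμ⟩ := hA.exists_radius
  obtain ⟨M, hM, hev⟩ := hlim.exists_bddPath hflow.isFlowPath
  obtain ⟨L, h⟩ := hA.exists_stabilityBound R M
  have hL := h.nonneg
  have hae : ∀ᵐ x ∂μ, g (state f ρinf x 1) - y x = 0 := by
    have hc : ContinuousOn (fun x => g (state f ρinf x 1) - y x) (Metric.closedBall 0 R) :=
      (hA.contDiff_g.continuous.comp_continuousOn (h.continuousOn_state hM (by simp))).sub
        hA.contDiff_y.continuous.continuousOn
    have hm := (aestronglyMeasurable_of_continuousOn hμ hc).aemeasurable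
    rw [cost, lintegral_eq_zero_iff' ((hm.pow_const 2).const_mul (1 / 2)).ennreal_ofReal] at hcost
    filter_upwards [hcost] with x hx
    have h1 : (1 / 2) * (g (state f ρinf x 1) - y x) ^ 2 ≤ 0 := ENNReal.ofReal_eq_zero.1 hx
    have h2 := sq_nonneg (g (state f ρinf x 1) - y x)
    exact pow_eq_zero_iff two_ne_zero |>.1 (by linarith)
  -- At this distance the residual is at most `√ε`, so its square is at most `ε`.
  have hw : 0 < √ε / (L + 1) := by positivity
  filter_upwards [hlim.eventually_W2Le hw, hev] with s hs hs'
  rw [← mul_one (ENNReal.ofReal ε), ← measure_univ (μ := μ), ← lintegral_const]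
  refine lintegral_mono_ae ?_
  filter_upwards [hμ, hae] with x hx hx0
  have hx' : ‖x‖ ≤ R := by simpa using hx
  refine ENNReal.ofReal_le_ofReal ?_
  have h1 := h.abs_sub_sub (ρ s) ρinf hs' hM _ hw hs x x hx' hx'
  rw [hx0, sub_zero, sub_self, norm_zero, zero_add] at h1
  have h2 : L * (√ε / (L + 1)) ≤ √ε := by
    rw [← mul_div_assoc, div_le_iff₀ (by positivity)]
    nlinarith [Real.sqrt_nonneg ε]
  have h3 : (g (state f (ρ s) x 1) - y x) ^ 2 ≤ ε := by
    rw [← sq_abs, ← Real.sq_sqrt hε.le]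
    exact pow_le_pow_left₀ (abs_nonneg _) (h1.trans h2) 2
  linarith

/-- The cost along a gradient flow depends only on the initial value. -/
theorem IsGradientFlow.cost_eq (hA : StandingAssumption f g y μ)
    {ρ ρ' : ℝ → ℝ → Measure (Euc k)} (h : IsGradientFlow f g y μ ρini ρ)
    (h' : IsGradientFlow f g y μ ρini ρ') {s : ℝ} (hs : 0 ≤ s) :
    cost f g y μ (ρ s) = cost f g y μ (ρ' s) := by
  obtain ⟨M, hM⟩ := (h.isFlowPath.1 s hs).exists_bddPath
  obtain ⟨M', hM'⟩ := (h'.isFlowPath.1 s hs).exists_bddPath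
  exact cost_congr hA (M := max M M')
    ⟨hM.isPath, fun t ht => (hM.moment t ht).mono (le_max_left _ _)⟩
    ⟨hM'.isPath, fun t ht => (hM'.moment t ht).mono (le_max_right _ _)⟩
    fun _ hw => h.W2Le_of_initial_eq hA h' hs hw

/-- A threshold valid for one flow with a fully supported limit is valid for every other, because
the cost at time `s` is determined by `ρini`. If no such flow exists, any constant will do. -/
theorem exists_forall_cost_le (hA : StandingAssumption f g y μ) (ρini : ℝ → Measure (Euc k))
    {ε : ℝ} (hε : 0 < ε) : ∃ C₀ : ℝ, 0 < C₀ ∧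
      ∀ (ρ : ℝ → ℝ → Measure (Euc k)) (ρinf : ℝ → Measure (Euc k)),
        IsGradientFlow f g y μ ρini ρ → HasFullySupportedLimit ρ ρinf →
          ∀ s : ℝ, C₀ < s → cost f g y μ (ρ s) ≤ ENNReal.ofReal ε := by
  by_cases hex : ∃ (ρ : ℝ → ℝ → Measure (Euc k)) (ρinf : ℝ → Measure (Euc k)),
      IsGradientFlow f g y μ ρini ρ ∧ HasFullySupportedLimit ρ ρinf
  · obtain ⟨ρ, ρinf, h, hlim⟩ := hex
    obtain ⟨a, ha⟩ := eventually_atTop.1 (eventually_cost_le hA h hlim hε)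
    refine ⟨max a 1, by positivity, fun ρ' _ h' _ s hs => ?_⟩
    have hs1 : 1 < s := (le_max_right _ _).trans_lt hs
    rw [h'.cost_eq hA h (by linarith)]
    exact ha s ((le_max_left _ _).trans hs.le)
  · exact ⟨1, one_pos, fun ρ ρinf h hlim => absurd ⟨ρ, ρinf, h, hlim⟩ hex⟩

end MeanFieldResNet

theorem mainTheorem2 {d k : ℕ}
    (f : MeanFieldResNet.Euc d → MeanFieldResNet.Euc k → MeanFieldResNet.Euc d)
    (g y : MeanFieldResNet.Euc d → ℝ) (μ : Measure (MeanFieldResNet.Euc d))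
    (hA : MeanFieldResNet.StandingAssumption f g y μ)
    (ρini : ℝ → Measure (MeanFieldResNet.Euc k)) (hini : MeanFieldResNet.Admissible ρini) :
    (∀ (ρ : ℝ → ℝ → Measure (MeanFieldResNet.Euc k)) (ρinf : ℝ → Measure (MeanFieldResNet.Euc k)),
      MeanFieldResNet.IsGradientFlow f g y μ ρini ρ →
      MeanFieldResNet.HasFullySupportedLimit ρ ρinf →
        MeanFieldResNet.cost f g y μ ρinf = 0 ∧
        ∀ ρ' : ℝ → Measure (MeanFieldResNet.Euc k), MeanFieldResNet.IsPath ρ' →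
          MeanFieldResNet.cost f g y μ ρinf ≤ MeanFieldResNet.cost f g y μ ρ') ∧
    ∀ ε : ℝ, 0 < ε → ∃ C₀ : ℝ, 0 < C₀ ∧
      ∀ (ρ : ℝ → ℝ → Measure (MeanFieldResNet.Euc k)) (ρinf : ℝ → Measure (MeanFieldResNet.Euc k)),
        MeanFieldResNet.IsGradientFlow f g y μ ρini ρ →
        MeanFieldResNet.HasFullySupportedLimit ρ ρinf →
          ∀ s : ℝ, C₀ < s → MeanFieldResNet.cost f g y μ (ρ s) ≤ ENNReal.ofReal ε := by
  exact ⟨fun _ _ h hlim => by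
      have h0 := MeanFieldResNet.cost_limit_eq_zero hA h hlim
      exact ⟨h0, fun _ _ => h0.trans_le zero_le⟩,
    fun _ hε => MeanFieldResNet.exists_forall_cost_le hA ρini hε⟩
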